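/- **Naive set theory.** Set terms are $t ::= x \mid \{x \mid A\}$ and formulas are $A ::= t\in u \mid A\supset B\mid \forall x.A$. Deductions are natural deductions with the introduction and elimination rules for $\supset$ and $\forall$ and the two abstraction rules: from $A[t/x]$ infer $t\in\{x\mid A\}$, and from $t\in\{x\mid A\}$ infer $A[t/x]$. A deduction is *normal* if no introduction is immediately followed by the elimination of the same connective, and *normalizable* if it reduces to a normal one by removing such detours. $A_1,\dots,A_m\vdash_{\mathsf{FPST}}A$ means that there is a normalizable deduction of $A$ from assumptions among $A_1,\dots,A_m$, in which the free individual variables are among those declared. **The framework.** $\mathsf{LLF}_{\mathcal P}$ is the logical framework $\mathsf{LF}$ (dependent types, raw conversion) extended with lock types $\mathcal L^{\mathcal P}_{N,\sigma}[\rho]$, lock objects $\mathcal L^{\mathcal P}_{N,\sigma}[M]$ and unlock objects $\mathcal U^{\mathcal P}_{N,\sigma}[M]$. Reduction is $\beta\mathcal L$: $\beta$ together with $\mathcal U^{\mathcal P}_{N,\sigma}[\mathcal L^{\mathcal P}_{N,\sigma}[M]]\to M$, closed under all contexts, and $=_{\beta\mathcal L}$ is the generated equivalence. The rules added to $\mathsf{LF}$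 are: * if $\Gamma\vdash\rho:\mathsf{Type}$ and $\Gamma\vdash N:\sigma$, then $\Gamma\vdash\mathcal L^{\mathcal P}_{N,\sigma}[\rho]:\mathsf{Type}$; if $\Gamma\vdash M:\rho$ and $\Gamma\vdash N:\sigma$, then $\Gamma\vdash\mathcal L^{\mathcal P}_{N,\sigma}[M]:\mathcal L^{\mathcal P}_{N,\sigma}[\rho]$; * if $\Gamma\vdash M:\mathcal L^{\mathcal P}_{N,\sigma}[\rho]$ and $\mathcal P(\Gamma\vdash N:\sigma)$ holds, then $\Gamma\vdash\mathcal U^{\mathcal P}_{N,\sigma}[M]:\rho$; * (guarded unlock) if $\Gamma\vdash N:\mathcal L^{\mathcal P}_{S',\sigma'}[\tau]$, $S=_{\beta\mathcal L}S'$ and $\sigma=_{\beta\mathcal L}\sigma'$, where $x$ is not free in $S,\sigma$, then: $\Gamma,x{:}\tau\vdash\mathcal L^{\mathcal P}_{S,\sigma}[\rho]:\mathsf{Type}$ implies $\Gamma\vdash\mathcal L^{\mathcal P}_{S,\sigma}[\rho']:\mathsf{Type}$, and $\Gamma,x{:}\tau\vdash\mathcal L^{\mathcal P}_{S,\sigma}[M]:\mathcal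 L^{\mathcal P}_{S,\sigma}[\rho]$ implies $\Gamma\vdash\mathcal L^{\mathcal P}_{S,\sigma}[M']:\mathcal L^{\mathcal P}_{S,\sigma}[\rho']$, where $\rho',M'$ are $\rho,M$ with $\mathcal U^{\mathcal P}_{S',\sigma'}[N]$ substituted for $x$. **The signature** $\Sigma_{\mathsf{FPST}}$ consists of $o,\iota:\mathsf{Type}$; $T,V:o\to\mathsf{Type}$; $\mathsf{lam}:(\iota\to o)\to\iota$; $\forall:(\iota\to o)\to o$; $\varepsilon:\iota\to\iota\to o$; $\supset\,:o\to o\to o$; $\delta:\Pi A{:}o.\,V(A)\to T(A)$; $\supset_{\mathsf{intro}}:\Pi A,B{:}o.\,(V(A)\to T(B))\to T(A\supset B)$; $$\supset_{\mathsf{elim}}:\Pi A,B{:}o.\,\Pi x{:}T(A).\,\Pi y{:}T(A\supset B).\ \mathcal L^{\mathsf{Fitch}}_{\langle x,y\rangle,\,T(A)\times T(A\supset B)}[T(B)];$$ $\forall_{\mathsf{intro}}:\Pi P{:}\iota\to o.\,(\Pi x{:}\iota.\,T(P\,x))\to T(\forall P)$; $\forall_{\mathsf{elim}}:\Pi P{:}\iota\to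 o.\,\Pi t{:}\iota.\,T(\forall P)\to T(P\,t)$; $\varepsilon_{\mathsf{intro}}:\Pi P{:}\iota\to o.\,\Pi t{:}\iota.\,T(P\,t)\to T(\varepsilon\,t\,(\mathsf{lam}\,P))$; and $\varepsilon_{\mathsf{elim}}:\Pi P{:}\iota\to o.\,\Pi t{:}\iota.\,T(\varepsilon\,t\,(\mathsf{lam}\,P))\to T(P\,t)$. Here $\langle x,y\rangle=\lambda u{:}T(A)\to T(A\supset B)\to T(B).\,u\,x\,y$, and $T(A)\times T(A\supset B)$ abbreviates the type $(T(A)\to T(A\supset B)\to T(B))\to T(B)$ of this pair. **Proof objects.** An object in which the use of every rule is visible encodes a deduction: $\delta\,A\,x$ is an assumption, $\supset_{\mathsf{intro}}A\,B\,(\lambda x.M)$ a $\supset$-introduction, $\mathcal U^{\mathsf{Fitch}}[\supset_{\mathsf{elim}}A\,B\,N\,M]$ a $\supset$-elimination, and so on ($\supset_{\mathsf{intro}}A\,B\,(\delta\,A')$ is read as $\supset_{\mathsf{intro}}A\,B\,(\lambda x.\,\delta\,A'\,x)$). A proof object $M$ is *normalizable* if it $\beta\mathcal L$-reduces to an object that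 encodes a normalizable deduction. The predicate $\mathsf{Fitch}(\Gamma\vdash\langle x,y\rangle:T(A)\times T(A\supset B))$, with the type given up to $=_{\beta\mathcal L}$, holds iff the combined proof $\mathcal U^{\mathsf{Fitch}}[\supset_{\mathsf{elim}}A\,B\,x\,y]$ $\beta\mathcal L$-reduces to an object $R$ that encodes a normalizable deduction and in which all occurrences of free variables of judgement type (that is, declared in $\Gamma$ with a type $T(C)$ or $V(C)$) lie within the scope of a $\delta$. **Theorem (adequacy).** Let $y_1,\dots,y_n$ be individual variables ($n\ge 0$), let $A_1,\dots,A_m,A$ ($m\ge 0$) be formulas with free variables among them, and denote the evident encodings of formulas as objects of type $o$ by the same letters. Then $$A_1,\dots,A_m\vdash_{\mathsf{FPST}}A$$ if and only if there is a normalizable object $M$ such that $$y_1{:}\iota,\dots,y_n{:}\iota,\ x_1{:}V(A_1),\dots,x_m{:}V(A_m)\ \vdash_{\Sigma_{\mathsf{FPST}}}\ M:T(A).$$ -/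

import Mathlib

/-! ## The Lax Logical Framework -/

namespace LLFP

/-- The names available for type constants, object constants and lock predicates. -/
structure Vocabulary where
  famConst : Type
  objConst : Type
  pred : Type

/-- The three syntactic categories. -/
inductive Cat where
  | kind
  | fam
  | obj

/-- Pseudo-syntax of kinds, families and objects, with de Bruijn indices for object variables
(`kpi`, `pi` and `lam` bind the index `0` in their second argument).
`flock p N σ ρ` and `lock p N σ M` are the lock type and the lock object for the predicate `p` on
the judgement `N : σ`, and `unlock p N σ M` is the corresponding unlock object. -/
inductive Expr (𝒱 : Vocabulary) : Cat → Type where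
  | type : Expr 𝒱 .kind
  | kpi (σ : Expr 𝒱 .fam) (K : Expr 𝒱 .kind) : Expr 𝒱 .kind
  | fconst (a : 𝒱.famConst) : Expr 𝒱 .fam
  | pi (σ τ : Expr 𝒱 .fam) : Expr 𝒱 .fam
  | fapp (σ : Expr 𝒱 .fam) (N : Expr 𝒱 .obj) : Expr 𝒱 .fam
  | flock (p : 𝒱.pred) (N : Expr 𝒱 .obj) (σ ρ : Expr 𝒱 .fam) : Expr 𝒱 .fam
  | const (c : 𝒱.objConst) : Expr 𝒱 .obj
  | var (i : ℕ) : Expr 𝒱 .obj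
  | lam (σ : Expr 𝒱 .fam) (M : Expr 𝒱 .obj) : Expr 𝒱 .obj
  | app (M N : Expr 𝒱 .obj) : Expr 𝒱 .obj
  | lock (p : 𝒱.pred) (N : Expr 𝒱 .obj) (σ : Expr 𝒱 .fam) (M : Expr 𝒱 .obj) : Expr 𝒱 .obj
  | unlock (p : 𝒱.pred) (N : Expr 𝒱 .obj) (σ : Expr 𝒱 .fam) (M : Expr 𝒱 .obj) : Expr 𝒱 .obj

abbrev Kind (𝒱 : Vocabulary) : Type := Expr 𝒱 .kind
abbrev Fam (𝒱 : Vocabulary) : Type := Expr 𝒱 .fam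
abbrev Obj (𝒱 : Vocabulary) : Type := Expr 𝒱 .obj

/-- Extension of a renaming under a binder. -/
def upRen (f : ℕ → ℕ) : ℕ → ℕ
  | 0 => 0
  | n + 1 => f n + 1

namespace Expr

variable {𝒱 : Vocabulary}

/-- Renaming of the free variables. -/
def rename : {s : Cat} → (ℕ → ℕ) → Expr 𝒱 s → Expr 𝒱 s
  | _, _, .type => .type
  | _, f, .kpi σ K => .kpi (rename f σ) (rename (upRen f) K)
  | _, _, .fconst a => .fconst a
  | _, f, .pi σ τ => .pi (rename f σ) (rename (upRen f) τ)
  | _, f, .fapp σ N => .fapp (rename f σ) (rename f N)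
  | _, f, .flock p N σ ρ => .flock p (rename f N) (rename f σ) (rename f ρ)
  | _, _, .const c => .const c
  | _, f, .var i => .var (f i)
  | _, f, .lam σ M => .lam (rename f σ) (rename (upRen f) M)
  | _, f, .app M N => .app (rename f M) (rename f N)
  | _, f, .lock p N σ M => .lock p (rename f N) (rename f σ) (rename f M)
  | _, f, .unlock p N σ M => .unlock p (rename f N) (rename f σ) (rename f M)

/-- Weakening by one variable. -/
def shift {s : Cat} (e : Expr 𝒱 s) : Expr 𝒱 s := rename Nat.succ e

/-- Extension of a substitution under a binder. -/
def upSub (θ : ℕ → Obj 𝒱) : ℕ → Obj 𝒱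
  | 0 => .var 0
  | n + 1 => shift (θ n)

/-- Simultaneous capture-avoiding substitution. -/
def subst : {s : Cat} → (ℕ → Obj 𝒱) → Expr 𝒱 s → Expr 𝒱 s
  | _, _, .type => .type
  | _, θ, .kpi σ K => .kpi (subst θ σ) (subst (upSub θ) K)
  | _, _, .fconst a => .fconst a
  | _, θ, .pi σ τ => .pi (subst θ σ) (subst (upSub θ) τ)
  | _, θ, .fapp σ N => .fapp (subst θ σ) (subst θ N)
  | _, θ, .flock p N σ ρ => .flock p (subst θ N) (subst θ σ) (subst θ ρ)
  | _, _, .const c => .const c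
  | _, θ, .var i => θ i
  | _, θ, .lam σ M => .lam (subst θ σ) (subst (upSub θ) M)
  | _, θ, .app M N => .app (subst θ M) (subst θ N)
  | _, θ, .lock p N σ M => .lock p (subst θ N) (subst θ σ) (subst θ M)
  | _, θ, .unlock p N σ M => .unlock p (subst θ N) (subst θ σ) (subst θ M)

/-- The substitution of `N` for the variable `0`. -/
def single (N : Obj 𝒱) : ℕ → Obj 𝒱
  | 0 => N
  | n + 1 => .var n

/-- `e[N/x]`, where `x` is the variable `0` of `e`. -/
def inst {s : Cat} (e : Expr 𝒱 s) (N : Obj 𝒱) : Expr 𝒱 s := subst (single N) e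

/-- The non-dependent function type `σ → τ`. -/
def arrow (σ τ : Fam 𝒱) : Fam 𝒱 := .pi σ (shift τ)

/-- One-step `βℒ`-reduction: the two main rules and closure under all contexts. -/
inductive Step : {s : Cat} → Expr 𝒱 s → Expr 𝒱 s → Prop where
  | beta (σ : Fam 𝒱) (M N : Obj 𝒱) : Step (.app (.lam σ M) N) (inst M N)
  | release (p : 𝒱.pred) (N : Obj 𝒱) (σ : Fam 𝒱) (M : Obj 𝒱) :
      Step (.unlock p N σ (.lock p N σ M)) M
  | kpiDom {σ σ' : Fam 𝒱} {K : Kind 𝒱} : Step σ σ' → Step (.kpi σ K) (.kpi σ' K)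
  | kpiCod {σ : Fam 𝒱} {K K' : Kind 𝒱} : Step K K' → Step (.kpi σ K) (.kpi σ K')
  | piDom {σ σ' τ : Fam 𝒱} : Step σ σ' → Step (.pi σ τ) (.pi σ' τ)
  | piCod {σ τ τ' : Fam 𝒱} : Step τ τ' → Step (.pi σ τ) (.pi σ τ')
  | fappFun {σ σ' : Fam 𝒱} {N : Obj 𝒱} : Step σ σ' → Step (.fapp σ N) (.fapp σ' N)
  | fappArg {σ : Fam 𝒱} {N N' : Obj 𝒱} : Step N N' → Step (.fapp σ N) (.fapp σ N')
  | flockObj {p : 𝒱.pred} {N N' : Obj 𝒱} {σ ρ : Fam 𝒱} :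
      Step N N' → Step (.flock p N σ ρ) (.flock p N' σ ρ)
  | flockFam {p : 𝒱.pred} {N : Obj 𝒱} {σ σ' ρ : Fam 𝒱} :
      Step σ σ' → Step (.flock p N σ ρ) (.flock p N σ' ρ)
  | flockBody {p : 𝒱.pred} {N : Obj 𝒱} {σ ρ ρ' : Fam 𝒱} :
      Step ρ ρ' → Step (.flock p N σ ρ) (.flock p N σ ρ')
  | lamDom {σ σ' : Fam 𝒱} {M : Obj 𝒱} : Step σ σ' → Step (.lam σ M) (.lam σ' M)
  | lamBody {σ : Fam 𝒱} {M M' : Obj 𝒱} : Step M M' → Step (.lam σ M) (.lam σ M')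
  | appFun {M M' N : Obj 𝒱} : Step M M' → Step (.app M N) (.app M' N)
  | appArg {M N N' : Obj 𝒱} : Step N N' → Step (.app M N) (.app M N')
  | lockObj {p : 𝒱.pred} {N N' : Obj 𝒱} {σ : Fam 𝒱} {M : Obj 𝒱} :
      Step N N' → Step (.lock p N σ M) (.lock p N' σ M)
  | lockFam {p : 𝒱.pred} {N : Obj 𝒱} {σ σ' : Fam 𝒱} {M : Obj 𝒱} :
      Step σ σ' → Step (.lock p N σ M) (.lock p N σ' M)
  | lockBody {p : 𝒱.pred} {N : Obj 𝒱} {σ : Fam 𝒱} {M M' : Obj 𝒱} :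
      Step M M' → Step (.lock p N σ M) (.lock p N σ M')
  | unlockObj {p : 𝒱.pred} {N N' : Obj 𝒱} {σ : Fam 𝒱} {M : Obj 𝒱} :
      Step N N' → Step (.unlock p N σ M) (.unlock p N' σ M)
  | unlockFam {p : 𝒱.pred} {N : Obj 𝒱} {σ σ' : Fam 𝒱} {M : Obj 𝒱} :
      Step σ σ' → Step (.unlock p N σ M) (.unlock p N σ' M)
  | unlockBody {p : 𝒱.pred} {N : Obj 𝒱} {σ : Fam 𝒱} {M M' : Obj 𝒱} :
      Step M M' → Step (.unlock p N σ M) (.unlock p N σ M')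

/-- Many-step `βℒ`-reduction. -/
def Red {s : Cat} : Expr 𝒱 s → Expr 𝒱 s → Prop := Relation.ReflTransGen Step

/-- `βℒ`-definitional equality. -/
def Conv {s : Cat} : Expr 𝒱 s → Expr 𝒱 s → Prop := Relation.EqvGen Step

end Expr

open LLFP.Expr

/-- A declaration of a type constant or of an object constant. -/
inductive Decl (𝒱 : Vocabulary) where
  | fam (a : 𝒱.famConst) (K : Kind 𝒱)
  | obj (c : 𝒱.objConst) (σ : Fam 𝒱)

/-- Signatures, the latest declaration first. -/
abbrev Sig (𝒱 : Vocabulary) : Type := List (Decl 𝒱)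

/-- Contexts, the latest variable (the index `0`) first; the type of each variable is an expression
over the variables declared before it. -/
abbrev Ctx (𝒱 : Vocabulary) : Type := List (Fam 𝒱)

/-- An interpretation of the lock predicates as predicates of judgements `Γ ⊢ N : σ` over a
signature. -/
abbrev Oracle (𝒱 : Vocabulary) : Type := 𝒱.pred → Sig 𝒱 → Ctx 𝒱 → Obj 𝒱 → Fam 𝒱 → Prop

/-- The five judgement forms over a signature. -/
inductive Judgement (𝒱 : Vocabulary) where
  | sig
  | ctx (Γ : Ctx 𝒱)
  | kind (Γ : Ctx 𝒱) (K : Kind 𝒱)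
  | fam (Γ : Ctx 𝒱) (σ : Fam 𝒱) (K : Kind 𝒱)
  | obj (Γ : Ctx 𝒱) (M : Obj 𝒱) (σ : Fam 𝒱)

/-- The type system. In the two guarded unlock rules the subscripts `S`, `σ` of the outer lock
do not contain the variable that is substituted, hence the `shift`. -/
inductive Derives {𝒱 : Vocabulary} (𝒪 : Oracle 𝒱) : Sig 𝒱 → Judgement 𝒱 → Prop where
  | sigEmpty : Derives 𝒪 [] .sig
  | sigKind {Sg : Sig 𝒱} {a : 𝒱.famConst} {K : Kind 𝒱} :
      Derives 𝒪 Sg (.kind [] K) → (∀ K', Decl.fam a K' ∉ Sg) →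
      Derives 𝒪 (.fam a K :: Sg) .sig
  | sigType {Sg : Sig 𝒱} {c : 𝒱.objConst} {σ : Fam 𝒱} :
      Derives 𝒪 Sg (.fam [] σ .type) → (∀ σ', Decl.obj c σ' ∉ Sg) →
      Derives 𝒪 (.obj c σ :: Sg) .sig
  | ctxEmpty {Sg : Sig 𝒱} : Derives 𝒪 Sg .sig → Derives 𝒪 Sg (.ctx [])
  | ctxType {Sg : Sig 𝒱} {Γ : Ctx 𝒱} {σ : Fam 𝒱} :
      Derives 𝒪 Sg (.fam Γ σ .type) → Derives 𝒪 Sg (.ctx (σ :: Γ))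
  | kindType {Sg : Sig 𝒱} {Γ : Ctx 𝒱} :
      Derives 𝒪 Sg (.ctx Γ) → Derives 𝒪 Sg (.kind Γ .type)
  | kindPi {Sg : Sig 𝒱} {Γ : Ctx 𝒱} {σ : Fam 𝒱} {K : Kind 𝒱} :
      Derives 𝒪 Sg (.kind (σ :: Γ) K) → Derives 𝒪 Sg (.kind Γ (.kpi σ K))
  | famConst {Sg : Sig 𝒱} {Γ : Ctx 𝒱} {a : 𝒱.famConst} {K : Kind 𝒱} :
      Derives 𝒪 Sg (.ctx Γ) → Decl.fam a K ∈ Sg → Derives 𝒪 Sg (.fam Γ (.fconst a) K)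
  | famPi {Sg : Sig 𝒱} {Γ : Ctx 𝒱} {σ τ : Fam 𝒱} :
      Derives 𝒪 Sg (.fam (σ :: Γ) τ .type) → Derives 𝒪 Sg (.fam Γ (.pi σ τ) .type)
  | famApp {Sg : Sig 𝒱} {Γ : Ctx 𝒱} {σ τ : Fam 𝒱} {K : Kind 𝒱} {N : Obj 𝒱} :
      Derives 𝒪 Sg (.fam Γ σ (.kpi τ K)) → Derives 𝒪 Sg (.obj Γ N τ) →
      Derives 𝒪 Sg (.fam Γ (.fapp σ N) (inst K N))
  | famLock {Sg : Sig 𝒱} {Γ : Ctx 𝒱} {p : 𝒱.pred} {N : Obj 𝒱} {σ ρ : Fam 𝒱} :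
      Derives 𝒪 Sg (.fam Γ ρ .type) → Derives 𝒪 Sg (.obj Γ N σ) →
      Derives 𝒪 Sg (.fam Γ (.flock p N σ ρ) .type)
  | famConv {Sg : Sig 𝒱} {Γ : Ctx 𝒱} {σ : Fam 𝒱} {K K' : Kind 𝒱} :
      Derives 𝒪 Sg (.fam Γ σ K) → Derives 𝒪 Sg (.kind Γ K') → Conv K K' →
      Derives 𝒪 Sg (.fam Γ σ K')
  | famGuardedUnlock {Sg : Sig 𝒱} {Γ : Ctx 𝒱} {p : 𝒱.pred} {S S' N : Obj 𝒱}
      {σ σ' ρ τ : Fam 𝒱} :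
      Derives 𝒪 Sg (.fam (τ :: Γ) (.flock p (shift S) (shift σ) ρ) .type) →
      Derives 𝒪 Sg (.obj Γ N (.flock p S' σ' τ)) → Conv σ σ' → Conv S S' →
      Derives 𝒪 Sg (.fam Γ (.flock p S σ (inst ρ (.unlock p S' σ' N))) .type)
  | objConst {Sg : Sig 𝒱} {Γ : Ctx 𝒱} {c : 𝒱.objConst} {σ : Fam 𝒱} :
      Derives 𝒪 Sg (.ctx Γ) → Decl.obj c σ ∈ Sg → Derives 𝒪 Sg (.obj Γ (.const c) σ)
  | objVar {Sg : Sig 𝒱} {Γ : Ctx 𝒱} {i : ℕ} {σ : Fam 𝒱} :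
      Derives 𝒪 Sg (.ctx Γ) → Γ[i]? = some σ →
      Derives 𝒪 Sg (.obj Γ (.var i) (rename (· + (i + 1)) σ))
  | objAbs {Sg : Sig 𝒱} {Γ : Ctx 𝒱} {σ τ : Fam 𝒱} {M : Obj 𝒱} :
      Derives 𝒪 Sg (.obj (σ :: Γ) M τ) → Derives 𝒪 Sg (.obj Γ (.lam σ M) (.pi σ τ))
  | objApp {Sg : Sig 𝒱} {Γ : Ctx 𝒱} {σ τ : Fam 𝒱} {M N : Obj 𝒱} :
      Derives 𝒪 Sg (.obj Γ M (.pi σ τ)) → Derives 𝒪 Sg (.obj Γ N σ) →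
      Derives 𝒪 Sg (.obj Γ (.app M N) (inst τ N))
  | objConv {Sg : Sig 𝒱} {Γ : Ctx 𝒱} {σ τ : Fam 𝒱} {M : Obj 𝒱} :
      Derives 𝒪 Sg (.obj Γ M σ) → Derives 𝒪 Sg (.fam Γ τ .type) → Conv σ τ →
      Derives 𝒪 Sg (.obj Γ M τ)
  | objLock {Sg : Sig 𝒱} {Γ : Ctx 𝒱} {p : 𝒱.pred} {M N : Obj 𝒱} {σ ρ : Fam 𝒱} :
      Derives 𝒪 Sg (.obj Γ M ρ) → Derives 𝒪 Sg (.obj Γ N σ) →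
      Derives 𝒪 Sg (.obj Γ (.lock p N σ M) (.flock p N σ ρ))
  | objTopUnlock {Sg : Sig 𝒱} {Γ : Ctx 𝒱} {p : 𝒱.pred} {M N : Obj 𝒱} {σ ρ : Fam 𝒱} :
      Derives 𝒪 Sg (.obj Γ M (.flock p N σ ρ)) → 𝒪 p Sg Γ N σ →
      Derives 𝒪 Sg (.obj Γ (.unlock p N σ M) ρ)
  | objGuardedUnlock {Sg : Sig 𝒱} {Γ : Ctx 𝒱} {p : 𝒱.pred} {S S' M N : Obj 𝒱}
      {σ σ' ρ τ : Fam 𝒱} :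
      Derives 𝒪 Sg (.obj (τ :: Γ) (.lock p (shift S) (shift σ) M)
        (.flock p (shift S) (shift σ) ρ)) →
      Derives 𝒪 Sg (.obj Γ N (.flock p S' σ' τ)) → Conv σ σ' → Conv S S' →
      Derives 𝒪 Sg (.obj Γ (.lock p S σ (inst M (.unlock p S' σ' N)))
        (.flock p S σ (inst ρ (.unlock p S' σ' N))))

end LLFP

/-! ## Fitch-Prawitz naive set theory -/

namespace FitchPrawitz

/-- The two syntactic categories of naive set theory. -/
inductive SynCat where
  | set
  | form

/-- Set terms and formulas with free individual variables among `x_0, …, x_{n-1}`: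
a set term is a variable or an abstract `{x | A}`; formulas are built from `t ∈ u` by
implication and universal quantification. The binders `abs` and `all` bind the variable `0`. -/
inductive Syn : SynCat → ℕ → Type where
  | var {n : ℕ} (i : Fin n) : Syn .set n
  | abs {n : ℕ} (A : Syn .form (n + 1)) : Syn .set n
  | mem {n : ℕ} (t u : Syn .set n) : Syn .form n
  | imp {n : ℕ} (A B : Syn .form n) : Syn .form n
  | all {n : ℕ} (A : Syn .form (n + 1)) : Syn .form n

abbrev SetTerm (n : ℕ) : Type := Syn .set n
abbrev Formula (n : ℕ) : Type := Syn .form n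

namespace Syn

/-- Extension of a renaming under a binder. -/
def upRen {n m : ℕ} (f : Fin n → Fin m) : Fin (n + 1) → Fin (m + 1) :=
  Fin.cases 0 (fun i => (f i).succ)

def rename : {c : SynCat} → {n m : ℕ} → (Fin n → Fin m) → Syn c n → Syn c m
  | _, _, _, f, .var i => .var (f i)
  | _, _, _, f, .abs A => .abs (rename (upRen f) A)
  | _, _, _, f, .mem t u => .mem (rename f t) (rename f u)
  | _, _, _, f, .imp A B => .imp (rename f A) (rename f B)
  | _, _, _, f, .all A => .all (rename (upRen f) A)

/-- Weakening by one individual variable. -/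
def shift {c : SynCat} {n : ℕ} (e : Syn c n) : Syn c (n + 1) := rename Fin.succ e

/-- Extension of a substitution under a binder. -/
def upSub {n m : ℕ} (θ : Fin n → SetTerm m) : Fin (n + 1) → SetTerm (m + 1) :=
  Fin.cases (.var 0) (fun i => shift (θ i))

def subst : {c : SynCat} → {n m : ℕ} → (Fin n → SetTerm m) → Syn c n → Syn c m
  | _, _, _, θ, .var i => θ i
  | _, _, _, θ, .abs A => .abs (subst (upSub θ) A)
  | _, _, _, θ, .mem t u => .mem (subst θ t) (subst θ u)
  | _, _, _, θ, .imp A B => .imp (subst θ A) (subst θ B)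
  | _, _, _, θ, .all A => .all (subst (upSub θ) A)

/-- `A[t/x]`, where `x` is the variable `0` of `A`. -/
def inst {c : SynCat} {n : ℕ} (A : Syn c (n + 1)) (t : SetTerm n) : Syn c n :=
  subst (Fin.cases t (fun i => .var i)) A

end Syn

/-- Natural deduction proofs, written as the tree of their rules. The leaf `hyp i` is an
assumption with label `i` (de Bruijn index); `impI p` discharges the assumptions of `p` that have
label `0`; in `impE p q`, `p` proves the major premise. -/
inductive Proof where
  | hyp (i : ℕ)
  | impI (p : Proof)
  | impE (p q : Proof)
  | allI (p : Proof)
  | allE (p : Proof)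
  | memI (p : Proof)
  | memE (p : Proof)

namespace Proof

/-- Relabelling of the open assumptions. -/
def rename : (ℕ → ℕ) → Proof → Proof
  | f, .hyp i => .hyp (f i)
  | f, .impI p => .impI (rename (LLFP.upRen f) p)
  | f, .impE p q => .impE (rename f p) (rename f q)
  | f, .allI p => .allI (rename f p)
  | f, .allE p => .allE (rename f p)
  | f, .memI p => .memI (rename f p)
  | f, .memE p => .memE (rename f p)

/-- Extension of a substitution under a discharge. -/
def upSub (θ : ℕ → Proof) : ℕ → Proof
  | 0 => .hyp 0
  | n + 1 => rename Nat.succ (θ n)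

/-- Replacement of open assumptions by proofs. -/
def subst : (ℕ → Proof) → Proof → Proof
  | θ, .hyp i => θ i
  | θ, .impI p => .impI (subst (upSub θ) p)
  | θ, .impE p q => .impE (subst θ p) (subst θ q)
  | θ, .allI p => .allI (subst θ p)
  | θ, .allE p => .allE (subst θ p)
  | θ, .memI p => .memI (subst θ p)
  | θ, .memE p => .memE (subst θ p)

def single (q : Proof) : ℕ → Proof
  | 0 => q
  | n + 1 => .hyp n

/-- `p` with the proof `q` in place of the assumptions with label `0`. -/
def inst (p q : Proof) : Proof := subst (single q) p

/-- One step of proof normalization: removal of an introduction that is immediately followed by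
the elimination of the same connective. -/
inductive Step : Proof → Proof → Prop where
  | imp (p q : Proof) : Step (.impE (.impI p) q) (inst p q)
  | all (p : Proof) : Step (.allE (.allI p)) p
  | mem (p : Proof) : Step (.memE (.memI p)) p
  | impI {p p' : Proof} : Step p p' → Step (.impI p) (.impI p')
  | impEMajor {p p' q : Proof} : Step p p' → Step (.impE p q) (.impE p' q)
  | impEMinor {p q q' : Proof} : Step q q' → Step (.impE p q) (.impE p q')
  | allI {p p' : Proof} : Step p p' → Step (.allI p) (.allI p')
  | allE {p p' : Proof} : Step p p' → Step (.allE p) (.allE p')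
  | memI {p p' : Proof} : Step p p' → Step (.memI p) (.memI p')
  | memE {p p' : Proof} : Step p p' → Step (.memE p) (.memE p')

/-- A proof is normal if it contains no detour. -/
def Normal (p : Proof) : Prop := ∀ q, ¬ Step p q

/-- A proof is normalizable if it reduces to a normal proof. -/
def Normalizable (p : Proof) : Prop := ∃ q, Relation.ReflTransGen Step p q ∧ Normal q

end Proof

/-- `Deduces Γ p A`: the rule tree `p` is a natural deduction of `A` from the assumptions `Γ`
(where `Γ[i]` is the assumption with label `i`), by the introduction and elimination rules for
implication, universal quantification and set abstraction, normalizable or not. In `allI` the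
eigenvariable `x_0` does not occur in the assumptions. -/
inductive Deduces : {n : ℕ} → List (Formula n) → Proof → Formula n → Prop where
  | hyp {n : ℕ} {Γ : List (Formula n)} {i : ℕ} {A : Formula n} :
      Γ[i]? = some A → Deduces Γ (.hyp i) A
  | impI {n : ℕ} {Γ : List (Formula n)} {p : Proof} {A B : Formula n} :
      Deduces (A :: Γ) p B → Deduces Γ (.impI p) (.imp A B)
  | impE {n : ℕ} {Γ : List (Formula n)} {p q : Proof} {A B : Formula n} :
      Deduces Γ p (.imp A B) → Deduces Γ q A → Deduces Γ (.impE p q) B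
  | allI {n : ℕ} {Γ : List (Formula n)} {p : Proof} {A : Formula (n + 1)} :
      Deduces (Γ.map Syn.shift) p A → Deduces Γ (.allI p) (.all A)
  | allE {n : ℕ} {Γ : List (Formula n)} {p : Proof} {A : Formula (n + 1)} (t : SetTerm n) :
      Deduces Γ p (.all A) → Deduces Γ (.allE p) (Syn.inst A t)
  | memI {n : ℕ} {Γ : List (Formula n)} {p : Proof} {A : Formula (n + 1)} {t : SetTerm n} :
      Deduces Γ p (Syn.inst A t) → Deduces Γ (.memI p) (.mem t (.abs A))
  | memE {n : ℕ} {Γ : List (Formula n)} {p : Proof} {A : Formula (n + 1)} {t : SetTerm n} :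
      Deduces Γ p (.mem t (.abs A)) → Deduces Γ (.memE p) (Syn.inst A t)

/-- Derivability in Fitch-Prawitz naive set theory: only normalizable deductions are admitted. -/
def Derivable {n : ℕ} (Γ : List (Formula n)) (A : Formula n) : Prop :=
  ∃ p, Deduces Γ p A ∧ p.Normalizable

/-! ## The signature -/

/-- Type constants: propositions, individuals, the apodictic judgement `T` and the generic
judgement `V`. -/
inductive FamConst where
  | o
  | ι
  | T
  | V

inductive ObjConst where
  | lam
  | all
  | mem
  | imp
  | δ
  | impI
  | impE
  | allI
  | allE
  | memI
  | memE

inductive Pred where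
  | fitch

abbrev voc : LLFP.Vocabulary where
  famConst := FamConst
  objConst := ObjConst
  pred := Pred

open LLFP

/-- The type of propositions. -/
def tyO : Fam voc := .fconst FamConst.o

/-- The type of individuals. -/
def tyI : Fam voc := .fconst FamConst.ι

/-- The apodictic judgement `T(A)`. -/
def tyT (A : Obj voc) : Fam voc := .fapp (.fconst FamConst.T) A

/-- The generic judgement `V(A)`. -/
def tyV (A : Obj voc) : Fam voc := .fapp (.fconst FamConst.V) A

def cst (c : ObjConst) : Obj voc := .const c

def cLam (P : Obj voc) : Obj voc := .app (cst .lam) P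
def cAll (P : Obj voc) : Obj voc := .app (cst .all) P
def cMem (t u : Obj voc) : Obj voc := .app (.app (cst .mem) t) u
def cImp (A B : Obj voc) : Obj voc := .app (.app (cst .imp) A) B

/-- `δ` with only its first argument, of type `V(A) → T(A)`. -/
def cDeltaFun (A : Obj voc) : Obj voc := .app (cst .δ) A
def cDelta (A x : Obj voc) : Obj voc := .app (cDeltaFun A) x

def cImpI (A B F : Obj voc) : Obj voc := .app (.app (.app (cst .impI) A) B) F
def cImpE (A B x y : Obj voc) : Obj voc := .app (.app (.app (.app (cst .impE) A) B) x) y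
def cAllI (P F : Obj voc) : Obj voc := .app (.app (cst .allI) P) F
def cAllE (P t x : Obj voc) : Obj voc := .app (.app (.app (cst .allE) P) t) x
def cMemI (P t x : Obj voc) : Obj voc := .app (.app (.app (cst .memI) P) t) x
def cMemE (P t x : Obj voc) : Obj voc := .app (.app (.app (cst .memE) P) t) x

/-- The type `T(A) → T(A ⊃ B) → T(B)` of the functions that a pair takes as argument. -/
def pairArgTy (A B : Obj voc) : Fam voc :=
  Expr.arrow (tyT A) (Expr.arrow (tyT (cImp A B)) (tyT B))

/-- The type `T(A) × T(A ⊃ B)` of pairs, encoded as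
`(T(A) → T(A ⊃ B) → T(B)) → T(B)`. -/
def pairTy (A B : Obj voc) : Fam voc := Expr.arrow (pairArgTy A B) (tyT B)

/-- The body `λ u : τ. u x y` of a pair. -/
def pairFun (τ : Fam voc) (x y : Obj voc) : Obj voc :=
  .lam τ (.app (.app (.var 0) (Expr.shift x)) (Expr.shift y))

/-- The pair `⟨x, y⟩ = λ u : T(A) → T(A ⊃ B) → T(B). u x y`. -/
def pair (A B x y : Obj voc) : Obj voc := pairFun (pairArgTy A B) x y

/-- The signature of Fitch-Prawitz set theory (the latest declaration first). In mathematical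
notation, and in the order of declaration:
`o : Type`, `ι : Type`, `T : o → Type`, `V : o → Type`, `lam : (ι → o) → ι`,
`∀ : (ι → o) → o`, `ε : ι → ι → o`, `⊃ : o → o → o`, `δ : ΠA:o. V(A) → T(A)`,
`⊃I : ΠA,B:o. (V(A) → T(B)) → T(A ⊃ B)`,
`⊃E : ΠA,B:o. Πx:T(A). Πy:T(A ⊃ B). L^Fitch_{⟨x,y⟩, T(A) × T(A ⊃ B)}[T(B)]`,
`∀I : ΠP:ι→o. (Πx:ι. T(P x)) → T(∀ P)`,
`∀E : ΠP:ι→o. Πt:ι. T(∀ P) → T(P t)`,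
`εI : ΠP:ι→o. Πt:ι. T(P t) → T(ε t (lam P))`,
`εE : ΠP:ι→o. Πt:ι. T(ε t (lam P)) → T(P t)`. -/
def sigFPST : Sig voc :=
  [ .obj ObjConst.memE (.pi (Expr.arrow tyI tyO) (.pi tyI
      (Expr.arrow (tyT (cMem (.var 0) (cLam (.var 1)))) (tyT (.app (.var 1) (.var 0)))))),
    .obj ObjConst.memI (.pi (Expr.arrow tyI tyO) (.pi tyI
      (Expr.arrow (tyT (.app (.var 1) (.var 0))) (tyT (cMem (.var 0) (cLam (.var 1))))))),
    .obj ObjConst.allE (.pi (Expr.arrow tyI tyO) (.pi tyI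
      (Expr.arrow (tyT (cAll (.var 1))) (tyT (.app (.var 1) (.var 0)))))),
    .obj ObjConst.allI (.pi (Expr.arrow tyI tyO)
      (Expr.arrow (.pi tyI (tyT (.app (.var 1) (.var 0)))) (tyT (cAll (.var 0))))),
    .obj ObjConst.impE (.pi tyO (.pi tyO (.pi (tyT (.var 1)) (.pi (tyT (cImp (.var 2) (.var 1)))
      (.flock Pred.fitch (pair (.var 3) (.var 2) (.var 1) (.var 0)) (pairTy (.var 3) (.var 2))
        (tyT (.var 2))))))),
    .obj ObjConst.impI (.pi tyO (.pi tyO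
      (Expr.arrow (Expr.arrow (tyV (.var 1)) (tyT (.var 0))) (tyT (cImp (.var 1) (.var 0)))))),
    .obj ObjConst.δ (.pi tyO (Expr.arrow (tyV (.var 0)) (tyT (.var 0)))),
    .obj ObjConst.imp (Expr.arrow tyO (Expr.arrow tyO tyO)),
    .obj ObjConst.mem (Expr.arrow tyI (Expr.arrow tyI tyO)),
    .obj ObjConst.all (Expr.arrow (Expr.arrow tyI tyO) tyO),
    .obj ObjConst.lam (Expr.arrow (Expr.arrow tyI tyO) tyI),
    .fam FamConst.V (.kpi tyO .type),
    .fam FamConst.T (.kpi tyO .type),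
    .fam FamConst.ι .type,
    .fam FamConst.o .type ]

/-! ## Normalizable proof objects and the lock predicate -/

/-- Passing under a binder of an individual variable: no new assumption label. The variable `0` is
not an assumption, so that its value is irrelevant. -/
def underInd (e : ℕ → ℕ) : ℕ → ℕ
  | 0 => 0
  | n + 1 => e n

/-- `Reads e M p`: the object `M`, in which the use of every rule is visible, is the encoding of
the natural deduction proof `p`; the variable with index `x` stands for the assumption with label
`e x`. In `impIEta` the function `δ A` stands for `λ x : V(A). δ A x`. -/
inductive Reads : (ℕ → ℕ) → Obj voc → Proof → Prop where
  | hyp (e : ℕ → ℕ) (A : Obj voc) (x : ℕ) : Reads e (cDelta A (.var x)) (.hyp (e x))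
  | impI {e : ℕ → ℕ} (A B : Obj voc) (σ : Fam voc) {M : Obj voc} {p : Proof} :
      Reads (upRen e) M p → Reads e (cImpI A B (.lam σ M)) (.impI p)
  | impIEta (e : ℕ → ℕ) (A B A' : Obj voc) :
      Reads e (cImpI A B (cDeltaFun A')) (.impI (.hyp 0))
  | impE {e : ℕ → ℕ} (A B S : Obj voc) (σ : Fam voc) {x y : Obj voc} {p q : Proof} :
      Reads e x q → Reads e y p →
      Reads e (.unlock Pred.fitch S σ (cImpE A B x y)) (.impE p q)
  | allI {e : ℕ → ℕ} (P : Obj voc) (σ : Fam voc) {M : Obj voc} {p : Proof} :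
      Reads (underInd e) M p → Reads e (cAllI P (.lam σ M)) (.allI p)
  | allE {e : ℕ → ℕ} (P t : Obj voc) {M : Obj voc} {p : Proof} :
      Reads e M p → Reads e (cAllE P t M) (.allE p)
  | memI {e : ℕ → ℕ} (P t : Obj voc) {M : Obj voc} {p : Proof} :
      Reads e M p → Reads e (cMemI P t M) (.memI p)
  | memE {e : ℕ → ℕ} (P t : Obj voc) {M : Obj voc} {p : Proof} :
      Reads e M p → Reads e (cMemE P t M) (.memE p)

/-- A proof object is normalizable if, after `βℒ`-reduction of the framework, it encodes a
natural deduction proof that is normalizable. -/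
def NormalizableObj (M : Obj voc) : Prop :=
  ∃ R p, Expr.Red M R ∧ Reads id R p ∧ p.Normalizable

/-- `OccursUnguarded e i`: the variable `i` has a free occurrence in `e` outside the scope (that
is, the second argument) of `δ`. -/
def OccursUnguarded : {s : Cat} → Expr voc s → ℕ → Prop
  | _, .type, _ => False
  | _, .kpi σ K, i => OccursUnguarded σ i ∨ OccursUnguarded K (i + 1)
  | _, .fconst _, _ => False
  | _, .pi σ τ, i => OccursUnguarded σ i ∨ OccursUnguarded τ (i + 1)
  | _, .fapp σ N, i => OccursUnguarded σ i ∨ OccursUnguarded N i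
  | _, .flock _ N σ ρ, i => OccursUnguarded N i ∨ OccursUnguarded σ i ∨ OccursUnguarded ρ i
  | _, .const _, _ => False
  | _, .var j, i => j = i
  | _, .lam σ M, i => OccursUnguarded σ i ∨ OccursUnguarded M (i + 1)
  | _, .app M N, i =>
      OccursUnguarded M i ∨ ((¬ ∃ A, M = cDeltaFun A) ∧ OccursUnguarded N i)
  | _, .lock _ N σ M, i => OccursUnguarded N i ∨ OccursUnguarded σ i ∨ OccursUnguarded M i
  | _, .unlock _ N σ M, i => OccursUnguarded N i ∨ OccursUnguarded σ i ∨ OccursUnguarded M i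

/-- All occurrences in `M` of free variables of judgement type (`T(A)` or `V(A)`) lie within the
scope of a `δ`. -/
def Guarded (Γ : Ctx voc) (M : Obj voc) : Prop :=
  ∀ i A, (Γ[i]? = some (tyT A) ∨ Γ[i]? = some (tyV A)) → ¬ OccursUnguarded M i

/-- The predicate `Fitch(Γ ⊢ ⟨x, y⟩ : T(A) × T(A ⊃ B))`: the proof obtained by combining `x` and
`y` by elimination of implication is normalizable, and all occurrences of free variables of
judgement type in it lie within the scope of a `δ`. Both requirements are about the proof as it
appears after `βℒ`-reduction, and the type may be replaced by a convertible one. -/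
def Fitch (Γ : Ctx voc) (N : Obj voc) (σ : Fam voc) : Prop :=
  ∃ (A B x y : Obj voc) (τ : Fam voc), N = pairFun τ x y ∧ Expr.Conv σ (pairTy A B) ∧
    ∃ (R : Obj voc) (p : Proof), Expr.Red (.unlock Pred.fitch N σ (cImpE A B x y)) R ∧
      Reads id R p ∧ p.Normalizable ∧ Guarded Γ R

def oracle : Oracle voc := fun _ _ Γ N σ => Fitch Γ N σ

/-! ## The encoding -/

/-- The encoding of set terms and formulas as objects of type `ι` and `o`. -/
def enc : {c : SynCat} → {n : ℕ} → Syn c n → Obj voc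
  | _, _, .var i => .var i
  | _, _, .abs A => cLam (.lam tyI (enc A))
  | _, _, .mem t u => cMem (enc t) (enc u)
  | _, _, .imp A B => cImp (enc A) (enc B)
  | _, _, .all A => cAll (.lam tyI (enc A))

/-- The encoding of a formula in a context with `m` further variables after the individual ones. -/
def encAt {n : ℕ} (m : ℕ) (A : Formula n) : Obj voc := Expr.rename (· + m) (enc A)

/-- The context `y_1 : ι, …, y_n : ι, x_1 : V(A_1), …, x_m : V(A_m)` for the list
`[A_m, …, A_1]` of formulas over `n` individual variables. -/
def encCtx {n : ℕ} : List (Formula n) → Ctx voc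
  | [] => List.replicate n tyI
  | A :: Γ => tyV (encAt Γ.length A) :: encCtx Γ

/-- Typing of objects in the framework over the signature of Fitch-Prawitz set theory. -/
def Typed (Γ : Ctx voc) (M : Obj voc) (σ : Fam voc) : Prop :=
  Derives oracle sigFPST (.obj Γ M σ)

end FitchPrawitz

namespace FitchPrawitz

open LLFP

/-! ## Erasure of locks and dependencies -/

/-! The two directions are of different nature: a deduction becomes an object by direct encoding, an
object becomes a deduction by evaluation in a model.

From objects to deductions. A syntactic analysis of typed objects would have to face raw conversion,
a release rule with repeated subscripts, and guarded unlocks that introduce unlock objects whose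
predicate has not been checked. Erasure removes all this: lock types, lock objects and unlock
objects become their bodies, and abstractions keep only the simple type of their domain. A release
step becomes trivial, a guarded unlock becomes an ordinary substitution, and what is left of
reduction is confluent β-reduction. Convertible families then have the same shape and joinable
indices (`er_conv_fam`).

The erased language is interpreted in presheaves over worlds. A world has `n` individual variables;
a morphism substitutes set terms for them and relabels assumptions. The base types denote set terms,
formulas and rule trees. Function spaces are presheaf exponentials, so a binding constant can apply
its argument to a fresh variable or a fresh assumption and bind the result. A Kripke logical
predicate `Val` on this model says that a valid element of `T(A)` under the assumptions `Δ` is a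
deduction of `A` from `Δ`, and that one of `V(A)` is an assumption `A`. Validity of the constants is
exactly the list of deduction rules (`val_cden`), and every typed object has a valid value, whatever
the lock predicates mean (`valid`). Values survive reduction, and an object that encodes `p` has the
value `p` (`Reads.ev`). So if `M : T(A)` reduces to an encoding of `p`, then `p` deduces `A`
(`deduces_of_typed`); that `p` is normalizable is part of the normalizability of `M`.

From deductions to objects. A normalizable deduction is first replaced by its normal form, which
deduces the same formula (`Deduces.steps`). All subdeductions of a normal deduction are normal, so
each unlock needed for an implication elimination is granted by `Fitch`: the combined proof is
already visible and normal, and assumptions enter only below `δ`, so that only individual variables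
occur unguarded (`IndOnly`). The encoding is the induction `Deduces.exists_encoding`; it rests on
the well-formedness of the signature (`sig_sigFPST`). -/

/-- Simple types: individuals, propositions, proofs, functions. -/
inductive STy where
  | ind
  | prop
  | prf
  | arr (a b : STy)

/-- Lock-free objects, the abstractions of which are annotated with simple types. -/
inductive Tm where
  | var (i : ℕ)
  | const (c : ObjConst)
  | app (M N : Tm)
  | lam (a : STy) (M : Tm)

/-- Lock-free families. -/
inductive EFam where
  | const (a : FamConst)
  | pi (σ τ : EFam)
  | app (σ : EFam) (N : Tm)

/-- Simple kinds. -/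
inductive SKind where
  | type
  | pi (a : STy) (k : SKind)

namespace Tm

def rename : (ℕ → ℕ) → Tm → Tm
  | f, .var i => .var (f i)
  | _, .const c => .const c
  | f, .app M N => .app (rename f M) (rename f N)
  | f, .lam a M => .lam a (rename (LLFP.upRen f) M)

def upSub (θ : ℕ → Tm) : ℕ → Tm
  | 0 => .var 0
  | n + 1 => rename Nat.succ (θ n)

def subst : (ℕ → Tm) → Tm → Tm
  | θ, .var i => θ i
  | _, .const c => .const c
  | θ, .app M N => .app (subst θ M) (subst θ N)
  | θ, .lam a M => .lam a (subst (upSub θ) M)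

def single (N : Tm) : ℕ → Tm
  | 0 => N
  | n + 1 => .var n

def inst (M N : Tm) : Tm := subst (single N) M

inductive Step : Tm → Tm → Prop where
  | beta (a : STy) (M N : Tm) : Step (.app (.lam a M) N) (inst M N)
  | lam {a : STy} {M M' : Tm} : Step M M' → Step (.lam a M) (.lam a M')
  | appFun {M M' N : Tm} : Step M M' → Step (.app M N) (.app M' N)
  | appArg {M N N' : Tm} : Step N N' → Step (.app M N) (.app M N')

def Red : Tm → Tm → Prop := Relation.ReflTransGen Step

end Tm

/-! ### Renaming and substitution of erased terms. -/

theorem upRen_comp (f g : ℕ → ℕ) : LLFP.upRen g ∘ LLFP.upRen f = LLFP.upRen (g ∘ f) := by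
  funext i; cases i <;> rfl

theorem upRen_id : LLFP.upRen id = id := by
  funext i; cases i <;> rfl

namespace Tm

theorem rename_rename (f g : ℕ → ℕ) (M : Tm) : rename g (rename f M) = rename (g ∘ f) M := by
  induction M generalizing f g with
  | lam a M ih => simp [rename, ih, upRen_comp]
  | _ => simp_all [rename]

theorem upSub_comp_upRen (f : ℕ → ℕ) (θ : ℕ → Tm) : upSub θ ∘ LLFP.upRen f = upSub (θ ∘ f) := by
  funext i; cases i <;> rfl

theorem subst_rename (f : ℕ → ℕ) (θ : ℕ → Tm) (M : Tm) :
    subst θ (rename f M) = subst (θ ∘ f) M := by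
  induction M generalizing f θ with
  | lam a M ih => simp [rename, subst, ih, upSub_comp_upRen]
  | _ => simp_all [rename, subst]

theorem rename_comp_upSub (f : ℕ → ℕ) (θ : ℕ → Tm) :
    rename (LLFP.upRen f) ∘ upSub θ = upSub (rename f ∘ θ) := by
  funext i
  cases i with
  | zero => rfl
  | succ i =>
    simp only [upSub, Function.comp, rename_rename]
    rfl

theorem rename_subst (f : ℕ → ℕ) (θ : ℕ → Tm) (M : Tm) :
    rename f (subst θ M) = subst (rename f ∘ θ) M := by
  induction M generalizing f θ with
  | lam a M ih => simp [rename, subst, ih, rename_comp_upSub]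
  | _ => simp_all [rename, subst]

theorem subst_comp_upSub (θ η : ℕ → Tm) :
    subst (upSub η) ∘ upSub θ = upSub (subst η ∘ θ) := by
  funext i
  cases i with
  | zero => rfl
  | succ i =>
    simp only [upSub, Function.comp, subst_rename, rename_subst]
    rfl

theorem subst_subst (θ η : ℕ → Tm) (M : Tm) :
    subst η (subst θ M) = subst (subst η ∘ θ) M := by
  induction M generalizing θ η with
  | lam a M ih => simp [subst, ih, subst_comp_upSub]
  | _ => simp_all [subst]

theorem upSub_var : upSub Tm.var = Tm.var := by
  funext i; cases i <;> rfl

theorem subst_var (M : Tm) : subst Tm.var M = M := by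
  induction M with
  | lam a M ih => simp [subst, upSub_var, ih]
  | _ => simp_all [subst]

theorem upSub_comp_var (f : ℕ → ℕ) : upSub (Tm.var ∘ f) = Tm.var ∘ LLFP.upRen f := by
  funext i; cases i <;> rfl

theorem rename_eq_subst (f : ℕ → ℕ) (M : Tm) : rename f M = subst (Tm.var ∘ f) M := by
  induction M generalizing f with
  | lam a M ih => simp [rename, subst, ih, upSub_comp_var]
  | _ => simp_all [rename, subst]

theorem rename_inst (f : ℕ → ℕ) (M N : Tm) :
    rename f (inst M N) = inst (rename (LLFP.upRen f) M) (rename f N) := by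
  simp only [inst, rename_subst, subst_rename]
  congr 1
  funext i; cases i <;> rfl

theorem subst_inst (θ : ℕ → Tm) (M N : Tm) :
    subst θ (inst M N) = inst (subst (upSub θ) M) (subst θ N) := by
  simp only [inst, subst_subst]
  congr 1
  funext i
  cases i with
  | zero => rfl
  | succ i =>
    simp only [Function.comp, single, subst, upSub, subst_rename]
    exact (subst_var _).symm

/-! ### Confluence -/

/-- Parallel reduction. -/
inductive Par : Tm → Tm → Prop where
  | var (i : ℕ) : Par (.var i) (.var i)
  | const (c : ObjConst) : Par (.const c) (.const c)
  | app {M M' N N' : Tm} : Par M M' → Par N N' → Par (.app M N) (.app M' N')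
  | lam {a : STy} {M M' : Tm} : Par M M' → Par (.lam a M) (.lam a M')
  | beta {a : STy} {M M' N N' : Tm} :
      Par M M' → Par N N' → Par (.app (.lam a M) N) (inst M' N')

theorem Par.refl (M : Tm) : Par M M := by
  induction M with
  | var i => exact .var i
  | const c => exact .const c
  | app M N ihM ihN => exact .app ihM ihN
  | lam a M ih => exact .lam ih

theorem Par.rename {M M' : Tm} (h : Par M M') (f : ℕ → ℕ) : Par (M.rename f) (M'.rename f) := by
  induction h generalizing f with
  | var i => exact .refl _
  | const c => exact .refl _
  | app _ _ ih₁ ih₂ => exact .app (ih₁ f) (ih₂ f)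
  | lam _ ih => exact .lam (ih _)
  | beta _ _ ih₁ ih₂ =>
    rw [rename_inst]
    exact .beta (ih₁ _) (ih₂ f)

theorem Par.upSub {θ θ' : ℕ → Tm} (h : ∀ i, Par (θ i) (θ' i)) (i : ℕ) :
    Par (Tm.upSub θ i) (Tm.upSub θ' i) := by
  cases i with
  | zero => exact .refl _
  | succ i => exact (h i).rename _

theorem Par.subst {M M' : Tm} (h : Par M M') {θ θ' : ℕ → Tm} (hθ : ∀ i, Par (θ i) (θ' i)) :
    Par (M.subst θ) (M'.subst θ') := by
  induction h generalizing θ θ' with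
  | var i => exact hθ i
  | const c => exact .refl _
  | app _ _ ih₁ ih₂ => exact .app (ih₁ hθ) (ih₂ hθ)
  | lam _ ih => exact .lam (ih (Par.upSub hθ))
  | beta _ _ ih₁ ih₂ =>
    rw [subst_inst]
    exact .beta (ih₁ (Par.upSub hθ)) (ih₂ hθ)

theorem Par.inst {M M' N N' : Tm} (hM : Par M M') (hN : Par N N') :
    Par (M.inst N) (M'.inst N') := by
  refine hM.subst fun i => ?_
  cases i with
  | zero => exact hN
  | succ i => exact .refl _

/-- Complete development. -/
def dev : Tm → Tm
  | .var i => .var i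
  | .const c => .const c
  | .lam a M => .lam a (dev M)
  | .app (.lam _ M) N => inst (dev M) (dev N)
  | .app M N => .app (dev M) (dev N)

/-- Takahashi's triangle: the complete development contracts every redex of `M`, so whichever
redexes a parallel step has contracted, the remaining ones can still be contracted. The diamond
property is immediate from it. -/
theorem Par.dev {M M' : Tm} (h : Par M M') : Par M' M.dev := by
  induction h with
  | var i => exact .refl _
  | const c => exact .refl _
  | lam _ ih => exact .lam ih
  | beta _ _ ih₁ ih₂ => exact ih₁.inst ih₂
  | @app M M' N N' hM _ ih₁ ih₂ =>
    cases M with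
    | lam a M₀ =>
      cases hM with
      | lam h₀ =>
        cases ih₁ with
        | lam h₁ => exact .beta h₁ ih₂
    | var i => exact .app ih₁ ih₂
    | const c => exact .app ih₁ ih₂
    | app P Q => exact .app ih₁ ih₂

theorem Red.app {M M' N N' : Tm} (hM : Red M M') (hN : Red N N') :
    Red (.app M N) (.app M' N') :=
  (hM.lift (Tm.app · N) fun _ _ => Step.appFun).trans (hN.lift (Tm.app M') fun _ _ => Step.appArg)

theorem Red.lam {a : STy} {M M' : Tm} (h : Red M M') : Red (.lam a M) (.lam a M') :=
  h.lift (Tm.lam a) fun _ _ => Step.lam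

theorem Par.red {M M' : Tm} (h : Par M M') : Red M M' := by
  induction h with
  | var i => exact .refl
  | const c => exact .refl
  | app _ _ ih₁ ih₂ => exact Red.app ih₁ ih₂
  | lam _ ih => exact Red.lam ih
  | beta _ _ ih₁ ih₂ => exact (Red.app (Red.lam ih₁) ih₂).tail (.beta _ _ _)

theorem Step.par {M M' : Tm} (h : Step M M') : Par M M' := by
  induction h with
  | beta a M N => exact .beta (.refl _) (.refl _)
  | lam _ ih => exact .lam ih
  | appFun _ ih => exact .app ih (.refl _)
  | appArg _ ih => exact .app (.refl _) ih

theorem red_iff_reflTransGen_par {M M' : Tm} : Red M M' ↔ Relation.ReflTransGen Par M M' := by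
  constructor
  · exact Relation.ReflTransGen.mono (fun _ _ => Step.par) _ _
  · intro h
    induction h with
    | refl => exact .refl
    | tail _ h ih => exact ih.trans h.red

/-- Having a common reduct. -/
def Joinable : Tm → Tm → Prop := Relation.Join Red

/-- Transitivity is the Church–Rosser property. It is needed because conversion in the framework is
raw: a chain of conversions may pass through expressions that have no type and no value, so its two
ends can be compared only through a common reduct. -/
theorem equivalence_joinable : Equivalence Joinable := by
  have : Red = Relation.ReflTransGen Par := by
    funext M N; exact propext red_iff_reflTransGen_par
  unfold Joinable
  rw [this]
  exact Relation.equivalence_join_reflTransGen fun M _ _ hb hc =>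
    ⟨M.dev, .single hb.dev, .single hc.dev⟩

end Tm

/-! ### Erased families, their simple types and their convertibility. -/

namespace EFam

/-- The simple type of the elements of a family. -/
def sty : EFam → STy
  | .const .o => .prop
  | .const .ι => .ind
  | .const .T => .prf
  | .const .V => .prf
  | .pi σ τ => .arr σ.sty τ.sty
  | .app σ _ => σ.sty

/-- The simple kind of a family. -/
def skind : EFam → SKind
  | .const .o => .type
  | .const .ι => .type
  | .const .T => .pi .prop .type
  | .const .V => .pi .prop .type
  | .pi _ _ => .type
  | .app σ _ => match σ.skind with
    | .type => .type
    | .pi _ k => k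

def rename : (ℕ → ℕ) → EFam → EFam
  | _, .const a => .const a
  | f, .pi σ τ => .pi (rename f σ) (rename (LLFP.upRen f) τ)
  | f, .app σ N => .app (rename f σ) (N.rename f)

def subst : (ℕ → Tm) → EFam → EFam
  | _, .const a => .const a
  | θ, .pi σ τ => .pi (subst θ σ) (subst (Tm.upSub θ) τ)
  | θ, .app σ N => .app (subst θ σ) (N.subst θ)

theorem rename_eq_subst (f : ℕ → ℕ) (σ : EFam) : rename f σ = subst (Tm.var ∘ f) σ := by
  induction σ generalizing f with
  | const a => rfl
  | pi σ τ ih₁ ih₂ => simp [rename, subst, ih₁, ih₂, Tm.upSub_comp_var]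
  | app σ N ih => simp [rename, subst, ih, Tm.rename_eq_subst]

/-- Objects enter a family only as indices of judgements, which the simple type forgets. -/
theorem sty_subst (θ : ℕ → Tm) (σ : EFam) : (subst θ σ).sty = σ.sty := by
  induction σ generalizing θ with
  | const a => rfl
  | pi σ τ ih₁ ih₂ => simp [sty, subst, ih₁, ih₂]
  | app σ N ih => simp [sty, subst, ih]

theorem sty_rename (f : ℕ → ℕ) (σ : EFam) : (rename f σ).sty = σ.sty := by
  rw [rename_eq_subst, sty_subst]

/-- Convertibility of families. -/
inductive Equiv : EFam → EFam → Prop where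
  | const (a : FamConst) : Equiv (.const a) (.const a)
  | pi {σ σ' τ τ' : EFam} : Equiv σ σ' → Equiv τ τ' → Equiv (.pi σ τ) (.pi σ' τ')
  | app {σ σ' : EFam} {N N' : Tm} : Equiv σ σ' → Tm.Joinable N N' →
      Equiv (.app σ N) (.app σ' N')

theorem Equiv.refl (σ : EFam) : Equiv σ σ := by
  induction σ with
  | const a => exact .const a
  | pi _ _ ih₁ ih₂ => exact .pi ih₁ ih₂
  | app _ N ih => exact .app ih (Tm.equivalence_joinable.refl N)

theorem Equiv.symm {σ τ : EFam} (h : Equiv σ τ) : Equiv τ σ := by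
  induction h with
  | const a => exact .const a
  | pi _ _ ih₁ ih₂ => exact .pi ih₁ ih₂
  | app _ hN ih => exact .app ih (Tm.equivalence_joinable.symm hN)

theorem Equiv.trans {ρ σ τ : EFam} (h : Equiv ρ σ) (h' : Equiv σ τ) : Equiv ρ τ := by
  induction h generalizing τ with
  | const a => exact h'
  | pi _ _ ih₁ ih₂ => cases h' with | pi h₁ h₂ => exact .pi (ih₁ h₁) (ih₂ h₂)
  | app _ hN ih =>
    cases h' with | app h₁ hN' => exact .app (ih h₁) (Tm.equivalence_joinable.trans hN hN')

theorem Equiv.sty_eq {σ τ : EFam} (h : Equiv σ τ) : σ.sty = τ.sty := by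
  induction h with
  | const a => rfl
  | pi _ _ ih₁ ih₂ => simp [sty, ih₁, ih₂]
  | app _ _ ih => exact ih

end EFam

/-! ### The erasure map and its effect on reduction. -/

/-- What an expression of a given category is erased to. -/
@[reducible] def Erasure : Cat → Type
  | .kind => SKind
  | .fam => EFam
  | .obj => Tm

namespace Erasure

def rename : {s : Cat} → (ℕ → ℕ) → Erasure s → Erasure s
  | .kind, _, K => K
  | .fam, f, σ => EFam.rename f σ
  | .obj, f, M => Tm.rename f M

def subst : {s : Cat} → (ℕ → Tm) → Erasure s → Erasure s
  | .kind, _, K => K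
  | .fam, θ, σ => EFam.subst θ σ
  | .obj, θ, M => Tm.subst θ M

/-- The relation that the erasures of the two sides of a reduction step satisfy. -/
def Reduces : {s : Cat} → Erasure s → Erasure s → Prop
  | .kind, K, K' => K = K'
  | .fam, σ, σ' => EFam.Equiv σ σ'
  | .obj, M, M' => Tm.Red M M'

end Erasure

/-- Erasure of locks and dependencies. -/
def er : {s : Cat} → Expr voc s → Erasure s
  | _, .type => SKind.type
  | _, .kpi σ K => SKind.pi (EFam.sty (er σ)) (er K)
  | _, .fconst a => EFam.const a
  | _, .pi σ τ => EFam.pi (er σ) (er τ)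
  | _, .fapp σ N => EFam.app (er σ) (er N)
  | _, .flock _ _ _ ρ => er ρ
  | _, .const c => Tm.const c
  | _, .var i => Tm.var i
  | _, .lam σ M => Tm.lam (EFam.sty (er σ)) (er M)
  | _, .app M N => Tm.app (er M) (er N)
  | _, .lock _ _ _ M => er M
  | _, .unlock _ _ _ M => er M

theorem er_rename {s : Cat} (f : ℕ → ℕ) (e : Expr voc s) :
    er (e.rename f) = (er e).rename f := by
  induction e generalizing f <;>
    simp_all [er, Expr.rename, Erasure.rename, EFam.rename, Tm.rename, EFam.sty_rename]

theorem er_comp_upSub (θ : ℕ → Obj voc) :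
    (fun i => er (Expr.upSub θ i)) = Tm.upSub (fun i => er (θ i)) := by
  funext i
  cases i with
  | zero => rfl
  | succ i => exact er_rename _ _

theorem er_subst {s : Cat} (θ : ℕ → Obj voc) (e : Expr voc s) :
    er (e.subst θ) = (er e).subst (fun i => er (θ i)) := by
  induction e generalizing θ <;>
    simp_all [er, Expr.subst, Erasure.subst, EFam.subst, Tm.subst, EFam.sty_subst, er_comp_upSub]

theorem er_comp_single (N : Obj voc) : (fun i => er (Expr.single N i)) = Tm.single (er N) := by
  funext i; cases i <;> rfl

theorem er_inst {s : Cat} (e : Expr voc s) (N : Obj voc) :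
    er (e.inst N) = (er e).subst (Tm.single (er N)) := by
  rw [Expr.inst, er_subst, er_comp_single]

/-- Steps in the subscripts of locks disappear, a release leaves the erasure unchanged, and a step
in the domain of an abstraction preserves the simple annotation. Only β-steps on objects survive,
and in families these occur only inside indices. -/
theorem er_step {s : Cat} {e e' : Expr voc s} (h : Expr.Step e e') :
    (er e).Reduces (er e') := by
  induction h with
  | beta σ M N =>
    rw [er_inst]
    exact .single (.beta _ _ _)
  | release => exact .refl
  | kpiDom _ ih => exact congrArg (SKind.pi · _) (EFam.Equiv.sty_eq ih)
  | kpiCod _ ih => exact congrArg (SKind.pi _) ih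
  | piDom _ ih => exact .pi ih (.refl _)
  | piCod _ ih => exact .pi (.refl _) ih
  | fappFun _ ih => exact .app ih (Tm.equivalence_joinable.refl _)
  | fappArg _ ih => exact .app (.refl _) ⟨_, ih, .refl⟩
  | flockObj => exact .refl _
  | flockFam => exact .refl _
  | flockBody _ ih => exact ih
  | lamDom _ ih =>
    simp only [er, Erasure.Reduces]
    rw [EFam.Equiv.sty_eq ih]
    exact .refl
  | lamBody _ ih => exact Tm.Red.lam ih
  | appFun _ ih => exact Tm.Red.app ih .refl
  | appArg _ ih => exact Tm.Red.app .refl ih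
  | lockObj => exact .refl
  | lockFam => exact .refl
  | lockBody _ ih => exact ih
  | unlockObj => exact .refl
  | unlockFam => exact .refl
  | unlockBody _ ih => exact ih

theorem er_red {M M' : Obj voc} (h : Expr.Red M M') : Tm.Red (er M) (er M') := by
  induction h with
  | refl => exact .refl
  | tail _ h ih => exact ih.trans (er_step h)

theorem er_conv_fam {σ τ : Fam voc} (h : Expr.Conv σ τ) : EFam.Equiv (er σ) (er τ) := by
  induction h with
  | rel _ _ h => exact er_step h
  | refl => exact .refl _
  | symm _ _ _ ih => exact ih.symm
  | trans _ _ _ _ _ ih₁ ih₂ => exact ih₁.trans ih₂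

theorem er_conv_kind {K K' : Kind voc} (h : Expr.Conv K K') : er K = er K' := by
  induction h with
  | rel _ _ h => exact er_step h
  | refl => rfl
  | symm _ _ _ ih => exact ih.symm
  | trans _ _ _ _ _ ih₁ ih₂ => exact ih₁.trans ih₂

/-! ## Substitution in naive set theory -/

namespace Syn

theorem upRen_comp {n m k : ℕ} (f : Fin n → Fin m) (g : Fin m → Fin k) :
    upRen g ∘ upRen f = upRen (g ∘ f) := by
  funext i; cases i using Fin.cases <;> rfl

theorem rename_rename {c : SynCat} {n m k : ℕ} (f : Fin n → Fin m) (g : Fin m → Fin k)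
    (e : Syn c n) : rename g (rename f e) = rename (g ∘ f) e := by
  induction e generalizing m k <;> simp_all [rename, upRen_comp]

theorem upSub_comp_upRen {n m k : ℕ} (f : Fin n → Fin m) (θ : Fin m → SetTerm k) :
    upSub θ ∘ upRen f = upSub (θ ∘ f) := by
  funext i; cases i using Fin.cases <;> rfl

theorem subst_rename {c : SynCat} {n m k : ℕ} (f : Fin n → Fin m) (θ : Fin m → SetTerm k)
    (e : Syn c n) : subst θ (rename f e) = subst (θ ∘ f) e := by
  induction e generalizing m k <;> simp_all [rename, subst, upSub_comp_upRen]

theorem rename_comp_upSub {n m k : ℕ} (f : Fin m → Fin k) (θ : Fin n → SetTerm m) :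
    rename (upRen f) ∘ upSub θ = upSub (rename f ∘ θ) := by
  funext i
  cases i using Fin.cases with
  | zero => rfl
  | succ i =>
    simp only [upSub, Function.comp, Fin.cases_succ, shift, rename_rename]
    rfl

theorem rename_subst {c : SynCat} {n m k : ℕ} (f : Fin m → Fin k) (θ : Fin n → SetTerm m)
    (e : Syn c n) : rename f (subst θ e) = subst (rename f ∘ θ) e := by
  induction e generalizing m k <;> simp_all [rename, subst, rename_comp_upSub]

theorem subst_comp_upSub {n m k : ℕ} (θ : Fin n → SetTerm m) (η : Fin m → SetTerm k) :
    subst (upSub η) ∘ upSub θ = upSub (subst η ∘ θ) := by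
  funext i
  cases i using Fin.cases with
  | zero => rfl
  | succ i =>
    simp only [upSub, Function.comp, Fin.cases_succ, shift, subst_rename, rename_subst]
    rfl

theorem subst_subst {c : SynCat} {n m k : ℕ} (θ : Fin n → SetTerm m) (η : Fin m → SetTerm k)
    (e : Syn c n) : subst η (subst θ e) = subst (subst η ∘ θ) e := by
  induction e generalizing m k <;> simp_all [subst, subst_comp_upSub]

theorem upSub_var {n : ℕ} : upSub (Syn.var : Fin n → SetTerm n) = Syn.var := by
  funext i; cases i using Fin.cases <;> rfl

theorem subst_var {c : SynCat} {n : ℕ} (e : Syn c n) : subst Syn.var e = e := by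
  induction e <;> simp_all [subst, upSub_var]

theorem upSub_comp_var {n m : ℕ} (f : Fin n → Fin m) :
    upSub (Syn.var ∘ f) = Syn.var ∘ upRen f := by
  funext i; cases i using Fin.cases <;> rfl

theorem rename_eq_subst {c : SynCat} {n m : ℕ} (f : Fin n → Fin m) (e : Syn c n) :
    rename f e = subst (Syn.var ∘ f) e := by
  induction e generalizing m <;> simp_all [rename, subst, upSub_comp_var]

/-- The substitution of `t` for the variable `0`. -/
def single {n : ℕ} (t : SetTerm n) : Fin (n + 1) → SetTerm n := Fin.cases t (fun i => .var i)

theorem inst_eq {c : SynCat} {n : ℕ} (e : Syn c (n + 1)) (t : SetTerm n) :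
    inst e t = subst (single t) e := rfl

theorem subst_shift {c : SynCat} {n m : ℕ} (θ : Fin (n + 1) → SetTerm m) (e : Syn c n) :
    subst θ (shift e) = subst (fun i => θ i.succ) e := subst_rename _ _ e

theorem inst_shift {c : SynCat} {n : ℕ} (e : Syn c n) (t : SetTerm n) : inst (shift e) t = e := by
  rw [inst_eq, subst_shift]
  exact subst_var e

theorem shift_subst {c : SynCat} {n m : ℕ} (θ : Fin n → SetTerm m) (e : Syn c n) :
    shift (subst θ e) = subst (upSub θ) (shift e) := by
  rw [shift, rename_subst, subst_shift]
  rfl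

theorem subst_inst {c : SynCat} {n m : ℕ} (θ : Fin n → SetTerm m) (e : Syn c (n + 1))
    (t : SetTerm n) : subst θ (inst e t) = inst (subst (upSub θ) e) (subst θ t) := by
  simp only [inst_eq, subst_subst]
  congr 1
  funext i
  cases i using Fin.cases with
  | zero => rfl
  | succ i => exact (inst_shift (θ i) (subst θ t)).symm

end Syn

namespace Proof

theorem rename_rename (f g : ℕ → ℕ) (p : Proof) : rename g (rename f p) = rename (g ∘ f) p := by
  induction p generalizing f g <;> simp_all [rename, FitchPrawitz.upRen_comp]

theorem rename_id (p : Proof) : rename id p = p := by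
  induction p <;> simp_all [rename, FitchPrawitz.upRen_id]

end Proof

/-- Deductions are closed under substitution of individual terms and relabelling. -/
theorem Deduces.subst_rename {n m : ℕ} {Γ : List (Formula n)} {p : Proof} {A : Formula n}
    (h : Deduces Γ p A) {Γ' : List (Formula m)} (θ : Fin n → SetTerm m) (r : ℕ → ℕ)
    (hr : ∀ i B, Γ[i]? = some B → Γ'[r i]? = some (Syn.subst θ B)) :
    Deduces Γ' (p.rename r) (Syn.subst θ A) := by
  induction h generalizing m r with
  | hyp h => exact .hyp (hr _ _ h)
  | impI _ ih =>
    refine .impI (ih θ _ fun i B hB => ?_)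
    cases i with
    | zero =>
      simp only [List.getElem?_cons_zero, Option.some.injEq] at hB
      simp [LLFP.upRen, hB]
    | succ i => simpa [LLFP.upRen] using hr i B hB
  | impE _ _ ih₁ ih₂ => exact .impE (ih₁ θ r hr) (ih₂ θ r hr)
  | allI _ ih =>
    refine .allI (ih (Syn.upSub θ) r fun i B hB => ?_)
    simp only [List.getElem?_map, Option.map_eq_some_iff] at hB ⊢
    obtain ⟨C, hC, rfl⟩ := hB
    exact ⟨_, hr i C hC, Syn.shift_subst _ _⟩
  | allE t _ ih =>
    rw [Syn.subst_inst]
    exact .allE _ (ih θ r hr)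
  | memI _ ih =>
    refine .memI ?_
    rw [← Syn.subst_inst]
    exact ih θ r hr
  | memE _ ih =>
    rw [Syn.subst_inst]
    exact .memE (ih θ r hr)

/-! ## A presheaf model of the erased framework -/

/-- A morphism of worlds: a substitution of individual terms and a relabelling of assumptions. -/
@[ext]
structure Hom (n m : ℕ) where
  sub : Fin n → SetTerm m
  lab : ℕ → ℕ

namespace Hom

def id (n : ℕ) : Hom n n := ⟨Syn.var, _root_.id⟩

def comp {n m k : ℕ} (h : Hom n m) (g : Hom m k) : Hom n k :=
  ⟨fun i => Syn.subst g.sub (h.sub i), g.lab ∘ h.lab⟩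

/-- A new individual variable. -/
def newInd (n : ℕ) : Hom n (n + 1) := ⟨fun i => .var i.succ, _root_.id⟩

/-- A new assumption. -/
def newHyp (n : ℕ) : Hom n n := ⟨Syn.var, Nat.succ⟩

def upInd {n m : ℕ} (h : Hom n m) : Hom (n + 1) (m + 1) := ⟨Syn.upSub h.sub, h.lab⟩

def upHyp {n m : ℕ} (h : Hom n m) : Hom n m := ⟨h.sub, LLFP.upRen h.lab⟩

def instInd {n : ℕ} (t : SetTerm n) : Hom (n + 1) n := ⟨Syn.single t, _root_.id⟩

@[simp] theorem id_comp {n m : ℕ} (h : Hom n m) : (id n).comp h = h := rfl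

@[simp] theorem comp_id {n m : ℕ} (h : Hom n m) : h.comp (id m) = h := by
  ext i
  · exact Syn.subst_var _
  · rfl

theorem comp_assoc {n m k l : ℕ} (h : Hom n m) (g : Hom m k) (f : Hom k l) :
    (h.comp g).comp f = h.comp (g.comp f) := by
  ext i
  · simp only [comp, Syn.subst_subst]; rfl
  · rfl

/-- The commuting square behind the naturality of `generic`; the corresponding square for `newHyp`
serves `discharge`. -/
theorem newInd_comp_upInd {n m : ℕ} (h : Hom n m) :
    (newInd n).comp h.upInd = h.comp (newInd m) := by
  ext i
  · simp only [comp, newInd, upInd, Syn.subst, Syn.upSub, Fin.cases_succ, Syn.shift,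
      Syn.rename_eq_subst]
    rfl
  · rfl

theorem newHyp_comp_upHyp {n m : ℕ} (h : Hom n m) :
    (newHyp n).comp h.upHyp = h.comp (newHyp m) := by
  ext i
  · simp only [comp, newHyp, upHyp, Syn.subst, Syn.subst_var]
  · rfl

end Hom

/-- Presheaves over worlds, with a global element. -/
structure Psh where
  obj : ℕ → Type
  map : {n m : ℕ} → Hom n m → obj n → obj m
  map_id : ∀ {n : ℕ} (x : obj n), map (Hom.id n) x = x
  map_comp : ∀ {n m k : ℕ} (h : Hom n m) (g : Hom m k) (x : obj n),
    map g (map h x) = map (h.comp g) x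
  -- Every type is inhabited in every world, so the codomain of a function value can be recovered
  -- from its values. The default also fills the environment positions beyond the declared
  -- individual variables.
  dflt : (n : ℕ) → obj n
  map_dflt : ∀ {n m : ℕ} (h : Hom n m), map h (dflt n) = dflt m

namespace Psh

@[reducible] def ind : Psh where
  obj := SetTerm
  map h t := Syn.subst h.sub t
  map_id := Syn.subst_var
  map_comp _ _ _ := Syn.subst_subst _ _ _
  dflt _ := .abs (.mem (.var 0) (.var 0))
  map_dflt _ := rfl

@[reducible] def prop : Psh where
  obj := Formula
  map h t := Syn.subst h.sub t
  map_id := Syn.subst_var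
  map_comp _ _ _ := Syn.subst_subst _ _ _
  dflt _ := .all (.mem (.var 0) (.var 0))
  map_dflt _ := rfl

@[reducible] def prf : Psh where
  obj _ := Proof
  map h p := p.rename h.lab
  map_id := Proof.rename_id
  map_comp _ _ _ := Proof.rename_rename _ _ _
  dflt _ := .impI (.hyp 0)
  map_dflt _ := rfl

/-- Exponentials. -/
@[reducible] def exp (A B : Psh) : Psh where
  obj n := {f : ∀ m, Hom n m → A.obj m → B.obj m //
    ∀ m k (h : Hom n m) (g : Hom m k) (a : A.obj m),
      B.map g (f m h a) = f k (h.comp g) (A.map g a)}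
  map h f := ⟨fun m g a => f.1 m (h.comp g) a, fun m k g g' a => by
    rw [f.2, Hom.comp_assoc]⟩
  map_id f := rfl
  map_comp h g f := by
    apply Subtype.ext
    funext m h' a
    simp only [Hom.comp_assoc]
  dflt n := ⟨fun m _ _ => B.dflt m, fun _ _ _ _ _ => B.map_dflt _⟩
  map_dflt _ := rfl

/-- Products. -/
@[reducible] def prod (A B : Psh) : Psh where
  obj n := A.obj n × B.obj n
  map h x := (A.map h x.1, B.map h x.2)
  map_id x := by simp only [A.map_id, B.map_id]
  map_comp h g x := by simp only [A.map_comp, B.map_comp]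
  dflt n := (A.dflt n, B.dflt n)
  map_dflt _ := by simp only [A.map_dflt, B.map_dflt]

variable {A B C : Psh}

/-- Morphisms of presheaves. -/
structure Nat (A B : Psh) where
  app : ∀ n, A.obj n → B.obj n
  nat : ∀ {n m : ℕ} (h : Hom n m) (x : A.obj n), B.map h (app n x) = app m (A.map h x)

def curry (F : Nat (A.prod B) C) : Nat A (B.exp C) where
  app n a := ⟨fun m h b => F.app m (A.map h a, b), fun m k h g b =>
    (F.nat g (A.map h a, b)).trans (by simp only [A.map_comp])⟩
  nat h a := by
    apply Subtype.ext
    funext m g b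
    simp only [A.map_comp]

/-- The global element of an exponential. -/
def global (F : Nat A B) (n : ℕ) : (A.exp B).obj n :=
  ⟨fun m _ a => F.app m a, fun _ _ _ g a => F.nat g a⟩

end Psh

/-! ### Interpretation of simple types and of the constants. -/

namespace STy

/-- The interpretation of simple types. -/
def sem : STy → Psh
  | .ind => .ind
  | .prop => .prop
  | .prf => .prf
  | .arr a b => .exp (sem a) (sem b)

/-- The elements of a simple type in a world. -/
abbrev El (a : STy) (n : ℕ) : Type := a.sem.obj n

end STy

/-- Application of a function of a later world. -/
def apAt {a b : STy} {n m : ℕ} (f : (STy.arr a b).El n) (h : Hom n m) (x : a.El m) : b.El m :=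
  f.1 m h x

theorem map_apAt {a b : STy} {n m k : ℕ} (f : (STy.arr a b).El n) (h : Hom n m) (x : a.El m)
    (g : Hom m k) : b.sem.map g (apAt f h x) = apAt f (h.comp g) (a.sem.map g x) :=
  f.2 m k h g x

theorem apAt_map {a b : STy} {n m k : ℕ} (f : (STy.arr a b).El n) (h : Hom n m) (x : a.El k)
    (g : Hom m k) : apAt ((STy.arr a b).sem.map h f) g x = apAt f (h.comp g) x := rfl

theorem arr_ext {a b : STy} {n : ℕ} {f g : (STy.arr a b).El n}
    (h : ∀ m (k : Hom n m) (x : a.El m), apAt f k x = apAt g k x) : f = g := by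
  apply Subtype.ext
  funext m k x
  exact h m k x

/-- The generic instance of a function on individuals. -/
def generic {b : STy} {n : ℕ} (P : (STy.arr .ind b).El n) : b.El (n + 1) :=
  apAt P (Hom.newInd n) (Syn.var 0 : SetTerm (n + 1))

theorem map_generic {b : STy} {n m : ℕ} (P : (STy.arr .ind b).El n) (h : Hom n m) :
    b.sem.map h.upInd (generic P) = generic ((STy.arr .ind b).sem.map h P) := by
  exact (map_apAt P _ _ _).trans
    (congrArg (fun g => apAt P g (Syn.var 0 : SetTerm (m + 1))) (Hom.newInd_comp_upInd h))

/-- By naturality a function on individuals is determined, at its own world, by its value at a fresh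
variable. For `b = prop` this identifies the syntactic instance `Syn.inst (generic P) t` with
semantic application. -/
theorem map_instInd_generic {b : STy} {n : ℕ} (P : (STy.arr .ind b).El n) (t : SetTerm n) :
    b.sem.map (Hom.instInd t) (generic P) = apAt P (Hom.id n) t := by
  exact map_apAt P _ _ _

/-- The instance of a function on proofs at a new assumption. -/
def discharge {b : STy} {n : ℕ} (F : (STy.arr .prf b).El n) : b.El n :=
  apAt F (Hom.newHyp n) (Proof.hyp 0)

theorem map_discharge {b : STy} {n m : ℕ} (F : (STy.arr .prf b).El n) (h : Hom n m) :
    b.sem.map h.upHyp (discharge F) = discharge ((STy.arr .prf b).sem.map h F) := by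
  exact (map_apAt F _ _ _).trans
    (congrArg (fun g => apAt F g (Proof.hyp 0)) (Hom.newHyp_comp_upHyp h))

/-- The simple types of the constants. -/
def cty : ObjConst → STy
  | .lam => .arr (.arr .ind .prop) .ind
  | .all => .arr (.arr .ind .prop) .prop
  | .mem => .arr .ind (.arr .ind .prop)
  | .imp => .arr .prop (.arr .prop .prop)
  | .δ => .arr .prop (.arr .prf .prf)
  | .impI => .arr .prop (.arr .prop (.arr (.arr .prf .prf) .prf))
  | .impE => .arr .prop (.arr .prop (.arr .prf (.arr .prf .prf)))
  | .allI => .arr (.arr .ind .prop) (.arr (.arr .ind .prf) .prf)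
  | .allE => .arr (.arr .ind .prop) (.arr .ind (.arr .prf .prf))
  | .memI => .arr (.arr .ind .prop) (.arr .ind (.arr .prf .prf))
  | .memE => .arr (.arr .ind .prop) (.arr .ind (.arr .prf .prf))

open Psh in
/-- The interpretation of the constants. -/
def cden (c : ObjConst) (n : ℕ) : (cty c).El n :=
  match c with
  | .lam => global (A := STy.sem (.arr .ind .prop)) (B := .ind)
      ⟨fun _ P => .abs (generic P), fun h P => congrArg Syn.abs (map_generic P h)⟩ n
  | .all => global (A := STy.sem (.arr .ind .prop)) (B := .prop)
      ⟨fun _ P => .all (generic P), fun h P => congrArg Syn.all (map_generic P h)⟩ n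
  | .mem => global (curry (A := .ind) (B := .ind) (C := .prop)
      ⟨fun _ x => .mem x.1 x.2, fun _ _ => rfl⟩) n
  | .imp => global (curry (A := .prop) (B := .prop) (C := .prop)
      ⟨fun _ x => .imp x.1 x.2, fun _ _ => rfl⟩) n
  -- `T` and `V` both consist of rule trees and an assumption is itself a rule tree, so `δ` acts as
  -- the identity.
  | .δ => global (curry (A := .prop) (B := .prf) (C := .prf) ⟨fun _ x => x.2, fun _ _ => rfl⟩) n
  | .impI => global (curry (curry (A := .prod .prop .prop) (B := STy.sem (.arr .prf .prf))
      (C := .prf) ⟨fun _ x => .impI (discharge x.2),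
        fun h x => congrArg Proof.impI (map_discharge x.2 h)⟩)) n
  -- The constant takes the minor premise before the major one, the rule tree the major one first.
  | .impE => global (curry (curry (curry (A := .prod (.prod .prop .prop) .prf) (B := .prf)
      (C := .prf) ⟨fun _ x => .impE x.2 x.1.2, fun _ _ => rfl⟩))) n
  | .allI => global (curry (A := STy.sem (.arr .ind .prop)) (B := STy.sem (.arr .ind .prf))
      (C := .prf) ⟨fun _ x => .allI (generic x.2),
        fun h x => congrArg Proof.allI (map_generic x.2 h)⟩) n
  | .allE => global (curry (curry (A := .prod (STy.sem (.arr .ind .prop)) .ind) (B := .prf)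
      (C := .prf) ⟨fun _ x => .allE x.2, fun _ _ => rfl⟩)) n
  | .memI => global (curry (curry (A := .prod (STy.sem (.arr .ind .prop)) .ind) (B := .prf)
      (C := .prf) ⟨fun _ x => .memI x.2, fun _ _ => rfl⟩)) n
  | .memE => global (curry (curry (A := .prod (STy.sem (.arr .ind .prop)) .ind) (B := .prf)
      (C := .prf) ⟨fun _ x => .memE x.2, fun _ _ => rfl⟩)) n

theorem map_cden (c : ObjConst) {n m : ℕ} (h : Hom n m) :
    (cty c).sem.map h (cden c n) = cden c m := by
  cases c <;> rfl

/-! ### Evaluation -/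

/-- Values of arbitrary simple type in a world. -/
abbrev Dom (n : ℕ) : Type := Σ a : STy, a.El n

def Dom.map {n m : ℕ} (h : Hom n m) (d : Dom n) : Dom m := ⟨d.1, d.1.sem.map h d.2⟩

theorem Dom.map_id {n : ℕ} (d : Dom n) : d.map (Hom.id n) = d := by
  simp [Dom.map, Psh.map_id]

theorem Dom.map_map {n m k : ℕ} (h : Hom n m) (g : Hom m k) (d : Dom n) :
    (d.map h).map g = d.map (h.comp g) := by
  simp [Dom.map, Psh.map_comp]

abbrev Env (n : ℕ) : Type := ℕ → Dom n

namespace Env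

def cons {n : ℕ} (d : Dom n) (η : Env n) : Env n
  | 0 => d
  | i + 1 => η i

def map {n m : ℕ} (h : Hom n m) (η : Env n) : Env m := fun i => (η i).map h

def tail {n : ℕ} (η : Env n) : Env n := fun i => η (i + 1)

theorem map_id {n : ℕ} (η : Env n) : η.map (Hom.id n) = η := by
  funext i; exact Dom.map_id _

theorem map_map {n m k : ℕ} (h : Hom n m) (g : Hom m k) (η : Env n) :
    (η.map h).map g = η.map (h.comp g) := by
  funext i; exact Dom.map_map _ _ _

theorem map_cons {n m : ℕ} (h : Hom n m) (d : Dom n) (η : Env n) :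
    (η.cons d).map h = (η.map h).cons (d.map h) := by
  funext i; cases i <;> rfl

theorem cons_comp_upRen {n : ℕ} (d : Dom n) (η : Env n) (f : ℕ → ℕ) :
    η.cons d ∘ LLFP.upRen f = cons d (η ∘ f) := by
  funext i; cases i <;> rfl

end Env

/-- `Ev M η d`: the value of `M` in the environment `η` is `d`. -/
def Ev : Tm → {n : ℕ} → Env n → Dom n → Prop
  | .var i, _, η, d => d = η i
  | .const c, n, _, d => d = ⟨cty c, cden c n⟩
  | .app M N, n, η, d => ∃ (a b : STy) (f : (STy.arr a b).El n) (x : a.El n),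
      Ev M η ⟨.arr a b, f⟩ ∧ Ev N η ⟨a, x⟩ ∧ d = ⟨b, apAt f (Hom.id n) x⟩
  | .lam a M, n, η, d => ∃ (b : STy) (f : (STy.arr a b).El n), d = ⟨.arr a b, f⟩ ∧
      ∀ m (h : Hom n m) (x : a.El m), Ev M ((η.map h).cons ⟨a, x⟩) ⟨b, apAt f h x⟩

/-- Evaluation is a partial function into values of varying simple type, so uniqueness includes
uniqueness of the type. -/
theorem Ev.functional {M : Tm} {n : ℕ} {η : Env n} {d d' : Dom n} (h : Ev M η d)
    (h' : Ev M η d') : d = d' := by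
  induction M generalizing n with
  | var i => exact h.trans h'.symm
  | const c => exact h.trans h'.symm
  | app M N ihM ihN =>
    obtain ⟨a, b, f, x, hM, hN, rfl⟩ := h
    obtain ⟨a', b', f', x', hM', hN', rfl⟩ := h'
    cases ihM hM hM'
    cases ihN hN hN'
    rfl
  | lam a M ih =>
    obtain ⟨b, f, rfl, hf⟩ := h
    obtain ⟨b', f', rfl, hf'⟩ := h'
    -- The two codomains can be compared only at some argument; the default element provides one.
    obtain rfl : b = b' :=
      congrArg Sigma.fst (ih (hf n (Hom.id n) (a.sem.dflt n)) (hf' n (Hom.id n) (a.sem.dflt n)))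
    obtain rfl : f = f' := arr_ext fun m k x =>
      eq_of_heq (Sigma.mk.inj (ih (hf m k x) (hf' m k x))).2
    rfl

theorem Ev.map {M : Tm} {n m : ℕ} {η : Env n} {d : Dom n} (hM : Ev M η d) (h : Hom n m) :
    Ev M (η.map h) (d.map h) := by
  induction M generalizing n m with
  | var i => exact congrArg (Dom.map h) hM
  | const c =>
    obtain rfl := hM
    simp [Ev, Dom.map, map_cden]
  | app M N ihM ihN =>
    obtain ⟨a, b, f, x, hM, hN, rfl⟩ := hM
    refine ⟨a, b, _, _, ihM hM h, ihN hN h, ?_⟩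
    simp [Dom.map, map_apAt, apAt_map]
  | lam a M ih =>
    obtain ⟨b, f, rfl, hf⟩ := hM
    refine ⟨b, _, rfl, fun k g x => ?_⟩
    rw [Env.map_map, apAt_map]
    exact hf k (h.comp g) x

theorem ev_rename {M : Tm} {f : ℕ → ℕ} {n : ℕ} {η : Env n} {d : Dom n} :
    Ev (M.rename f) η d ↔ Ev M (η ∘ f) d := by
  induction M generalizing f n with
  | var i => rfl
  | const c => rfl
  | app M N ihM ihN => simp only [Tm.rename, Ev, ihM, ihN]
  | lam a M ih =>
    simp only [Tm.rename, Ev, ih, Env.cons_comp_upRen]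
    rfl

/-- `θ` evaluates to the environment `η'`. -/
def EvSub (θ : ℕ → Tm) {n : ℕ} (η η' : Env n) : Prop := ∀ i, Ev (θ i) η (η' i)

theorem EvSub.up {θ : ℕ → Tm} {n m : ℕ} {η η' : Env n} (H : EvSub θ η η') (h : Hom n m)
    (d : Dom m) : EvSub (Tm.upSub θ) ((η.map h).cons d) ((η'.map h).cons d) := by
  intro i
  cases i with
  | zero => rfl
  | succ i => exact ev_rename.2 ((H i).map h)

theorem EvSub.single {N : Tm} {n : ℕ} {η : Env n} {d : Dom n} (h : Ev N η d) :
    EvSub (Tm.single N) η (η.cons d) := by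
  intro i
  cases i with
  | zero => exact h
  | succ i => rfl

theorem EvSub.rename (f : ℕ → ℕ) {n : ℕ} (η : Env n) : EvSub (Tm.var ∘ f) η (η ∘ f) :=
  fun _ => rfl

theorem ev_subst {M : Tm} {θ : ℕ → Tm} {n : ℕ} {η η' : Env n} {d : Dom n} (H : EvSub θ η η') :
    Ev (M.subst θ) η d ↔ Ev M η' d := by
  induction M generalizing θ n with
  | var i => exact ⟨fun h => h.functional (H i), fun h => by rw [show d = _ from h]; exact H i⟩
  | const c => rfl
  | app M N ihM ihN => simp only [Tm.subst, Ev, ihM H, ihN H]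
  | lam a M ih => simp only [Tm.subst, Ev, ih (H.up _ _)]

/-- Only this direction holds in general: an expansion may create an argument that has no value, and
an application is defined only if its argument is. Comparisons of joinable terms therefore ask for
values on both sides. -/
theorem Ev.step {M M' : Tm} (hs : Tm.Step M M') {n : ℕ} {η : Env n} {d : Dom n} (h : Ev M η d) :
    Ev M' η d := by
  induction hs generalizing n with
  | beta a M N =>
    obtain ⟨a', b, f, x, ⟨b', f', he, hf⟩, hN, rfl⟩ := h
    cases he
    refine (ev_subst (EvSub.single hN)).2 ?_
    simpa only [Env.map_id] using hf n (Hom.id n) x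
  | lam _ ih =>
    obtain ⟨b, f, rfl, hf⟩ := h
    exact ⟨b, f, rfl, fun m k x => ih (hf m k x)⟩
  | appFun _ ih =>
    obtain ⟨a, b, f, x, hM, hN, rfl⟩ := h
    exact ⟨a, b, f, x, ih hM, hN, rfl⟩
  | appArg _ ih =>
    obtain ⟨a, b, f, x, hM, hN, rfl⟩ := h
    exact ⟨a, b, f, x, hM, ih hN, rfl⟩

theorem Ev.red {M M' : Tm} (hs : Tm.Red M M') {n : ℕ} {η : Env n} {d : Dom n} (h : Ev M η d) :
    Ev M' η d := by
  induction hs with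
  | refl => exact h
  | tail _ hs ih => exact ih.step hs

theorem Ev.joinable {M M' : Tm} (hj : Tm.Joinable M M') {n : ℕ} {η : Env n} {d d' : Dom n}
    (h : Ev M η d) (h' : Ev M' η d') : d = d' := by
  obtain ⟨C, h₁, h₂⟩ := hj
  exact (h.red h₁).functional (h'.red h₂)

/-! ### Well-formed families -/

/-- All indices of judgements in the family have a value. -/
def Good : EFam → {n : ℕ} → Env n → Prop
  | .const _, _, _ => True
  | .pi σ τ, n, η => Good σ η ∧
      ∀ m (h : Hom n m) (d : Dom m), d.1 = σ.sty → Good τ ((η.map h).cons d)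
  | .app _ N, n, η => ∃ a : Formula n, Ev N η ⟨.prop, a⟩

theorem Good.map {σ : EFam} {n m : ℕ} {η : Env n} (hσ : Good σ η) (h : Hom n m) :
    Good σ (η.map h) := by
  induction σ generalizing n m with
  | const a => trivial
  | pi σ τ ih₁ _ =>
    refine ⟨ih₁ hσ.1 h, fun k g d hd => ?_⟩
    rw [Env.map_map]
    exact hσ.2 k _ d hd
  | app σ N _ =>
    obtain ⟨a, ha⟩ := hσ
    exact ⟨_, ha.map h⟩

theorem good_subst {σ : EFam} {θ : ℕ → Tm} {n : ℕ} {η η' : Env n} (H : EvSub θ η η') :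
    Good (σ.subst θ) η ↔ Good σ η' := by
  induction σ generalizing θ n with
  | const a => rfl
  | pi σ τ ih₁ ih₂ =>
    simp only [EFam.subst, Good, ih₁ H, EFam.sty_subst]
    refine and_congr_right fun _ => forall_congr' fun m => forall_congr' fun h =>
      forall_congr' fun d => imp_congr_right fun _ => ih₂ (H.up h d)
  | app σ N _ => simp only [EFam.subst, Good, ev_subst H]

theorem good_rename {σ : EFam} {f : ℕ → ℕ} {n : ℕ} {η : Env n} :
    Good (σ.rename f) η ↔ Good σ (η ∘ f) := by
  rw [EFam.rename_eq_subst]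
  exact good_subst (EvSub.rename f η)

/-- The values of the variables have the right simple types. -/
def TyEnv (Γ : Ctx voc) {n : ℕ} (η : Env n) : Prop :=
  ∀ i σ, Γ[i]? = some σ → (η i).1 = EFam.sty (er σ)

theorem TyEnv.cons {Γ : Ctx voc} {σ : Fam voc} {n : ℕ} {η : Env n} {d : Dom n}
    (h : TyEnv Γ η) (hd : d.1 = EFam.sty (er σ)) : TyEnv (σ :: Γ) (η.cons d) := by
  intro i τ hi
  cases i with
  | zero =>
    simp only [List.getElem?_cons_zero, Option.some.injEq] at hi
    exact hi ▸ hd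
  | succ i => exact h i τ hi

theorem TyEnv.tail {Γ : Ctx voc} {σ : Fam voc} {n : ℕ} {η : Env n} (h : TyEnv (σ :: Γ) η) :
    TyEnv Γ η.tail :=
  fun i τ hi => h (i + 1) τ hi

theorem TyEnv.map {Γ : Ctx voc} {n m : ℕ} {η : Env n} (hη : TyEnv Γ η) (h : Hom n m) :
    TyEnv Γ (η.map h) := hη

/-- Goodness is asked in all simply typed environments, not only in valid ones, so that it can be
settled before validity is defined and without reference to assumptions. -/
def CtxGood : Ctx voc → Prop
  | [] => True
  | σ :: Γ => CtxGood Γ ∧ ∀ n (η : Env n), TyEnv Γ η → Good (er σ) η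

def SigGood (Sg : Sig voc) : Prop :=
  ∀ c σ, Decl.obj c σ ∈ Sg → ∀ n (η : Env n), Good (er σ) η

theorem CtxGood.lookup {Γ : Ctx voc} (hΓ : CtxGood Γ) {n : ℕ} {η : Env n} (hη : TyEnv Γ η)
    {i : ℕ} {σ : Fam voc} (hi : Γ[i]? = some σ) : Good (er σ) (η ∘ (· + (i + 1))) := by
  induction Γ generalizing i η with
  | nil => simp at hi
  | cons τ Γ ih =>
    cases i with
    | zero =>
      simp only [List.getElem?_cons_zero, Option.some.injEq] at hi
      subst hi
      exact hΓ.2 _ _ hη.tail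
    | succ i =>
      have := ih hΓ.1 hη.tail (i := i) (by simpa using hi)
      exact this

/-- The simple kinding and typing that judgements over the signature entail. -/
def SimplyTyped (Sg : Sig voc) : Judgement voc → Prop
  | .sig => SigGood Sg
  | .ctx Γ => SigGood Sg ∧ CtxGood Γ
  | .kind Γ _ => SigGood Sg ∧ CtxGood Γ
  | .fam Γ σ K => SigGood Sg ∧ CtxGood Γ ∧ EFam.skind (er σ) = er K ∧
      ∀ n (η : Env n), TyEnv Γ η → Good (er σ) η
  | .obj Γ M σ => SigGood Sg ∧ CtxGood Γ ∧
      ∀ n (η : Env n), TyEnv Γ η → Good (er σ) η ∧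
        ∃ d, Ev (er M) η d ∧ d.1 = EFam.sty (er σ)

/-- Only the judgements `T` and `V` take an argument. Hence the index of a well-kinded application
is a proposition, which is what `Good` asks for. -/
theorem skind_eq (σ : EFam) :
    σ.skind = .type ∨ (σ = .const .T ∨ σ = .const .V) ∧ σ.skind = .pi .prop .type := by
  induction σ with
  | const a => cases a <;> simp [EFam.skind]
  | pi => simp [EFam.skind]
  | app σ N ih => obtain h | ⟨_, h⟩ := ih <;> simp [EFam.skind, h]

theorem cty_eq {c : ObjConst} {σ : Fam voc} (h : Decl.obj c σ ∈ sigFPST) :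
    cty c = EFam.sty (er σ) := by
  simp only [sigFPST, List.mem_cons, List.not_mem_nil, or_false, reduceCtorEq,
    Decl.obj.injEq] at h
  rcases h with h | h | h | h | h | h | h | h | h | h | h <;> obtain ⟨rfl, rfl⟩ := h <;> rfl

theorem skind_const_eq {a : FamConst} {K : Kind voc} (h : Decl.fam a K ∈ sigFPST) :
    EFam.skind (.const a) = er K := by
  simp only [sigFPST, List.mem_cons, List.not_mem_nil, or_false, reduceCtorEq, false_or,
    Decl.fam.injEq] at h
  rcases h with h | h | h | h <;> obtain ⟨rfl, rfl⟩ := h <;> rfl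

/-- Evaluation of an abstraction that has a value at all arguments. -/
theorem exists_ev_lam {M : Tm} {a b : STy} {n : ℕ} {η : Env n}
    (H : ∀ m (h : Hom n m) (x : a.El m), ∃ d, Ev M ((η.map h).cons ⟨a, x⟩) d ∧ d.1 = b) :
    ∃ f : (STy.arr a b).El n, Ev (.lam a M) η ⟨.arr a b, f⟩ := by
  have H' : ∀ m (h : Hom n m) (x : a.El m), ∃ y : b.El m,
      Ev M ((η.map h).cons ⟨a, x⟩) ⟨b, y⟩ := by
    intro m h x
    obtain ⟨⟨b', y⟩, hy, rfl⟩ := H m h x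
    exact ⟨y, hy⟩
  choose f hf using H'
  refine ⟨⟨f, fun m k h g x => ?_⟩, b, _, rfl, hf⟩
  -- Naturality of the chosen function comes from uniqueness: the transported value and the value
  -- computed in the later world are values of the same body in the same environment.
  have h₁ := (hf m h x).map g
  rw [Env.map_cons, Env.map_map] at h₁
  exact eq_of_heq (Sigma.mk.inj (h₁.functional (hf k (h.comp g) (a.sem.map g x)))).2

/-- A first soundness pass, at the level of simple types. Validity depends on it twice: an
abstraction has a value only if its body has one at every argument of the right simple type, valid
or not, and invariance under conversion requires the indices on both sides to have values. An
inclusion of signatures is assumed because the derivation of a signature passes through its initial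
segments. -/
theorem simplyTyped {𝒪 : Oracle voc} {Sg : Sig voc} {j : Judgement voc}
    (h : Derives 𝒪 Sg j) (hSg : Sg ⊆ sigFPST) : SimplyTyped Sg j := by
  induction h with
  | sigEmpty => intro c σ h; simp at h
  | sigKind _ _ ih =>
    intro c σ h
    have h := (List.mem_cons.1 h).resolve_left (by simp)
    exact (ih fun _ hx => hSg (List.mem_cons_of_mem _ hx)).1 c σ h
  | sigType _ _ ih =>
    intro c σ h
    have ih := ih fun _ hx => hSg (List.mem_cons_of_mem _ hx)
    rcases List.mem_cons.1 h with h | h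
    · obtain ⟨rfl, rfl⟩ := Decl.obj.inj h
      exact fun n η => ih.2.2.2 n η (by intro i σ hi; simp at hi)
    · exact ih.1 c σ h
  | ctxEmpty _ ih => exact ⟨ih hSg, trivial⟩
  | ctxType _ ih => exact ⟨(ih hSg).1, (ih hSg).2.1, (ih hSg).2.2.2⟩
  | kindType _ ih => exact ih hSg
  | kindPi _ ih => exact ⟨(ih hSg).1, (ih hSg).2.1⟩
  | famConst _ ha ih =>
    exact ⟨(ih hSg).1, (ih hSg).2, skind_const_eq (hSg ha), fun _ _ _ => trivial⟩
  | famPi _ ih =>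
    obtain ⟨h₁, h₂, _, h₄⟩ := ih hSg
    exact ⟨h₁, h₂.1, rfl, fun n η hη => ⟨h₂.2 n η hη, fun m h d hd =>
      h₄ m _ ((hη.map h).cons hd)⟩⟩
  | @famApp Sg Γ σ τ K N _ _ ih₁ ih₂ =>
    obtain ⟨h₁, h₂, h₃, _⟩ := ih₁ hSg
    have h₅ := (ih₂ hSg).2.2
    have hK : er (Expr.inst K N) = er K := er_inst K N
    have h₃ : EFam.skind (er σ) = .pi (EFam.sty (er τ)) (er K) := h₃
    refine ⟨h₁, h₂, ?_, fun n η hη => ?_⟩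
    · rw [hK]
      simp only [er, EFam.skind, h₃]
    · obtain ⟨-, ⟨a, x⟩, hx, ha⟩ := h₅ n η hη
      -- A family that accepts an argument accepts a proposition, so the value of the argument is a
      -- formula.
      obtain h | ⟨_, h⟩ := skind_eq (er σ)
      · rw [h] at h₃; cases h₃
      · rw [h] at h₃
        have : a = .prop := by rw [(SKind.pi.inj h₃).1]; exact ha
        subst this
        exact ⟨x, hx⟩
  | famLock _ _ ih₁ _ => exact ih₁ hSg
  | famConv _ _ hc ih₁ _ =>
    obtain ⟨h₁, h₂, h₃, h₄⟩ := ih₁ hSg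
    exact ⟨h₁, h₂, h₃.trans (er_conv_kind hc), h₄⟩
  | @famGuardedUnlock Sg Γ p S S' N σ σ' ρ τ _ _ _ _ ih₁ ih₂ =>
    obtain ⟨h₁, h₂, h₃, h₄⟩ := ih₁ hSg
    have h₅ := (ih₂ hSg).2.2
    refine ⟨h₁, h₂.1, ?_, fun n η hη => ?_⟩
    · have h₃ : EFam.skind (er ρ) = .type := h₃
      have h₆ : ∀ (θ : ℕ → Tm) (σ : EFam), (σ.subst θ).skind = σ.skind := by
        intro θ σ
        induction σ with
        | const a => rfl
        | pi => rfl
        | app σ N ih => simp [EFam.subst, EFam.skind, ih]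
      simp only [er, er_inst]
      exact (h₆ _ _).trans h₃
    · obtain ⟨-, d, hd, hd'⟩ := h₅ n η hη
      simp only [er, er_inst]
      exact (good_subst (EvSub.single hd)).2 (h₄ n _ (hη.cons hd'))
  | objConst _ hc ih =>
    obtain ⟨h₁, h₂⟩ := ih hSg
    exact ⟨h₁, h₂, fun n η _ => ⟨h₁ _ _ hc n η, _, rfl, cty_eq (hSg hc)⟩⟩
  | @objVar Sg Γ i σ _ hi ih =>
    obtain ⟨h₁, h₂⟩ := ih hSg
    refine ⟨h₁, h₂, fun n η hη => ?_⟩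
    rw [er_rename]
    exact ⟨good_rename.2 (h₂.lookup hη hi), _, rfl, (hη i σ hi).trans (EFam.sty_rename _ _).symm⟩
  | @objAbs Sg Γ σ τ M _ ih =>
    obtain ⟨h₁, h₂, h₃⟩ := ih hSg
    refine ⟨h₁, h₂.1, fun n η hη => ⟨⟨h₂.2 n η hη, fun m h d hd =>
      (h₃ m _ ((hη.map h).cons hd)).1⟩, ?_⟩⟩
    obtain ⟨f, hf⟩ := exists_ev_lam (M := er M) (a := EFam.sty (er σ)) (b := EFam.sty (er τ))
      (η := η) fun m h x => (h₃ m _ ((hη.map h).cons rfl)).2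
    exact ⟨_, hf, rfl⟩
  | @objApp Sg Γ σ τ M N _ _ ih₁ ih₂ =>
    obtain ⟨h₁, h₂, h₃⟩ := ih₁ hSg
    have h₄ := (ih₂ hSg).2.2
    refine ⟨h₁, h₂, fun n η hη => ?_⟩
    obtain ⟨hg, ⟨c, f⟩, hf, hc⟩ := h₃ n η hη
    obtain ⟨-, ⟨a, x⟩, hx, ha⟩ := h₄ n η hη
    have hc : c = .arr (EFam.sty (er σ)) (EFam.sty (er τ)) := hc
    have ha : a = EFam.sty (er σ) := ha
    subst hc ha
    have hg' := hg.2 n (Hom.id n) ⟨_, x⟩ rfl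
    rw [Env.map_id] at hg'
    rw [er_inst]
    exact ⟨(good_subst (EvSub.single hx)).2 hg', _, ⟨_, _, f, x, hf, hx, rfl⟩,
      (EFam.sty_subst _ _).symm⟩
  | objConv _ _ hc ih₁ ih₂ =>
    obtain ⟨h₁, h₂, h₃⟩ := ih₁ hSg
    refine ⟨h₁, h₂, fun n η hη => ⟨(ih₂ hSg).2.2.2 n η hη, ?_⟩⟩
    obtain ⟨-, d, hd, hd'⟩ := h₃ n η hη
    exact ⟨d, hd, hd'.trans (er_conv_fam hc).sty_eq⟩
  | objLock _ _ ih₁ _ => exact ih₁ hSg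
  | objTopUnlock _ _ ih => exact ih hSg
  | @objGuardedUnlock Sg Γ p S S' M N σ σ' ρ τ _ _ _ _ ih₁ ih₂ =>
    obtain ⟨h₁, h₂, h₃⟩ := ih₁ hSg
    have h₅ := (ih₂ hSg).2.2
    refine ⟨h₁, h₂.1, fun n η hη => ?_⟩
    obtain ⟨-, d, hd, hd'⟩ := h₅ n η hη
    obtain ⟨hg, e, he, he'⟩ := h₃ n _ (hη.cons hd')
    simp only [er, er_inst]
    exact ⟨(good_subst (EvSub.single hd)).2 hg, e, (ev_subst (EvSub.single hd)).2 he,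
      he'.trans (EFam.sty_subst _ _).symm⟩

/-! ### Validity -/

/-- A morphism of worlds that preserves the assumptions. -/
def Respects {n m : ℕ} (h : Hom n m) (Δ : List (Formula n)) (Δ' : List (Formula m)) : Prop :=
  ∀ i B, Δ[i]? = some B → Δ'[h.lab i]? = some (Syn.subst h.sub B)

theorem Respects.id {n : ℕ} (Δ : List (Formula n)) : Respects (Hom.id n) Δ Δ := by
  intro i B h
  simpa [Hom.id, Syn.subst_var] using h

theorem Respects.comp {n m k : ℕ} {h : Hom n m} {g : Hom m k} {Δ : List (Formula n)}
    {Δ' : List (Formula m)} {Δ'' : List (Formula k)} (hh : Respects h Δ Δ')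
    (hg : Respects g Δ' Δ'') : Respects (h.comp g) Δ Δ'' := by
  intro i B hB
  have := hg _ _ (hh i B hB)
  rw [Syn.subst_subst] at this
  exact this

theorem Respects.newInd {n : ℕ} (Δ : List (Formula n)) :
    Respects (Hom.newInd n) Δ (Δ.map Syn.shift) := by
  intro i B hB
  simp only [Hom.newInd, List.getElem?_map, id_eq, hB, Option.map_some, Syn.shift,
    Syn.rename_eq_subst]
  rfl

theorem Respects.newHyp {n : ℕ} (Δ : List (Formula n)) (A : Formula n) :
    Respects (Hom.newHyp n) Δ (A :: Δ) := by
  intro i B hB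
  simpa [Hom.newHyp, Syn.subst_var] using hB

theorem Deduces.map {n m : ℕ} {h : Hom n m} {Δ : List (Formula n)} {Δ' : List (Formula m)}
    (hr : Respects h Δ Δ') {p : Proof} {A : Formula n} (hp : Deduces Δ p A) :
    Deduces Δ' (p.rename h.lab) (Syn.subst h.sub A) :=
  hp.subst_rename h.sub h.lab hr

/-- `Val σ Δ η d`: the value `d` is a valid element of the family `σ` under the assumptions `Δ`.
The valid elements of `T(A)` are the proofs of `A`, those of `V(A)` the assumptions `A`. -/
def Val : EFam → {n : ℕ} → List (Formula n) → Env n → Dom n → Prop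
  | .const .o, _, _, _, d => d.1 = .prop
  | .const .ι, _, _, _, d => d.1 = .ind
  | .const .T, _, _, _, _ => False
  | .const .V, _, _, _, _ => False
  | .pi σ τ, n, Δ, η, d => ∃ a b, a = σ.sty ∧ b = τ.sty ∧ ∃ f : (STy.arr a b).El n,
      d = ⟨.arr a b, f⟩ ∧
      ∀ m (Δ' : List (Formula m)) (h : Hom n m), Respects h Δ Δ' → ∀ x : a.El m,
        Val σ Δ' (η.map h) ⟨a, x⟩ → Val τ Δ' ((η.map h).cons ⟨a, x⟩) ⟨b, apAt f h x⟩
  | .app σ N, n, Δ, η, d => match σ with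
    | .const .T => ∃ (a : Formula n) (p : Proof),
        Ev N η ⟨.prop, a⟩ ∧ d = ⟨.prf, p⟩ ∧ Deduces Δ p a
    | .const .V => ∃ (a : Formula n) (i : ℕ),
        Ev N η ⟨.prop, a⟩ ∧ d = ⟨.prf, Proof.hyp i⟩ ∧ Δ[i]? = some a
    | _ => False

theorem Val.sty_eq {σ : EFam} {n : ℕ} {Δ : List (Formula n)} {η : Env n} {d : Dom n}
    (h : Val σ Δ η d) : d.1 = σ.sty := by
  cases σ with
  | const a => cases a <;> first | exact h | exact h.elim
  | pi σ τ =>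
    obtain ⟨a, b, rfl, rfl, f, rfl, -⟩ := h
    rfl
  | app σ N =>
    match σ, h with
    | .const .T, ⟨a, p, _, h, _⟩ => subst h; rfl
    | .const .V, ⟨a, p, _, h, _⟩ => subst h; rfl

/-- Kripke monotonicity. Function types need no induction, since their clause already quantifies
over all later worlds and assumptions; judgements use closure of deductions under substitution and
relabelling. -/
theorem Val.map {σ : EFam} {n m : ℕ} {Δ : List (Formula n)} {Δ' : List (Formula m)} {η : Env n}
    {d : Dom n} (hd : Val σ Δ η d) {h : Hom n m} (hr : Respects h Δ Δ') :
    Val σ Δ' (η.map h) (d.map h) := by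
  cases σ with
  | const a => cases a <;> exact hd
  | pi σ τ =>
    obtain ⟨a, b, ha, hb, f, rfl, hf⟩ := hd
    refine ⟨a, b, ha, hb, _, rfl, fun k Δ'' g hg x hx => ?_⟩
    rw [Env.map_map] at hx ⊢
    exact hf k Δ'' _ (hr.comp hg) x hx
  | app σ N =>
    match σ, hd with
    | .const .T, ⟨a, p, ha, hd, hp⟩ =>
      subst hd
      exact ⟨_, _, ha.map h, rfl, hp.map hr⟩
    | .const .V, ⟨a, i, ha, hd, hi⟩ =>
      subst hd
      exact ⟨_, _, ha.map h, rfl, hr _ _ hi⟩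

theorem val_subst {σ : EFam} {θ : ℕ → Tm} {n : ℕ} {Δ : List (Formula n)} {η η' : Env n}
    {d : Dom n} (H : EvSub θ η η') : Val (σ.subst θ) Δ η d ↔ Val σ Δ η' d := by
  induction σ generalizing θ n with
  | const a => cases a <;> rfl
  | pi σ τ ih₁ ih₂ =>
    simp only [EFam.subst, Val, EFam.sty_subst]
    refine exists_congr fun a => exists_congr fun b => and_congr_right fun _ =>
      and_congr_right fun _ => exists_congr fun f => and_congr_right fun _ =>
      forall_congr' fun m => forall_congr' fun Δ' => forall_congr' fun h =>
      imp_congr_right fun _ => forall_congr' fun x => ?_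
    rw [ih₁ (fun i => (H i).map h), ih₂ (H.up h _)]
    rfl
  | app σ N _ =>
    match σ with
    | .const .T => simp only [EFam.subst, Val, ev_subst H]
    | .const .V => simp only [EFam.subst, Val, ev_subst H]
    | .const .o => rfl
    | .const .ι => rfl
    | .pi _ _ => rfl
    | .app _ _ => rfl

theorem val_rename {σ : EFam} {f : ℕ → ℕ} {n : ℕ} {Δ : List (Formula n)} {η : Env n} {d : Dom n} :
    Val (σ.rename f) Δ η d ↔ Val σ Δ (η ∘ f) d := by
  rw [EFam.rename_eq_subst]
  exact val_subst (EvSub.rename f η)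

/-- Convertible families have the same shape, so only the indices matter. Both being good, joinable
indices have values, and these coincide by `Ev.joinable`. -/
theorem Val.equiv {σ τ : EFam} (he : EFam.Equiv σ τ) {n : ℕ} {Δ : List (Formula n)} {η : Env n}
    {d : Dom n} (hσ : Good σ η) (hτ : Good τ η) : Val σ Δ η d ↔ Val τ Δ η d := by
  induction he generalizing n with
  | const a => rfl
  | @pi σ σ' τ τ' e₁ e₂ ih₁ ih₂ =>
    simp only [Val, e₁.sty_eq, e₂.sty_eq]
    refine exists_congr fun a => exists_congr fun b => and_congr_right fun ha =>
      and_congr_right fun _ => exists_congr fun f => and_congr_right fun _ =>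
      forall_congr' fun m => forall_congr' fun Δ' => forall_congr' fun h =>
      imp_congr_right fun _ => forall_congr' fun x => ?_
    rw [ih₁ (hσ.1.map h) (hτ.1.map h),
      ih₂ (hσ.2 m h ⟨a, x⟩ (ha.trans e₁.sty_eq.symm)) (hτ.2 m h ⟨a, x⟩ ha)]
  | @app σ σ' N N' e hN _ =>
    obtain ⟨a, ha⟩ := hσ
    obtain ⟨b, hb⟩ := hτ
    have hab : ∀ c : Formula n, Ev N η ⟨.prop, c⟩ ↔ Ev N' η ⟨.prop, c⟩ := fun c =>
      ⟨fun h => by rw [h.joinable hN hb]; exact hb,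
       fun h => by rw [← ha.joinable hN h]; exact ha⟩
    cases e with
    | const c => cases c <;> simp only [Val, hab]
    | pi => rfl
    | app => rfl

theorem val_T {N : Tm} {n : ℕ} {Δ : List (Formula n)} {η : Env n} {p : Proof} :
    Val (.app (.const .T) N) Δ η ⟨.prf, p⟩ ↔
      ∃ a : Formula n, Ev N η ⟨.prop, a⟩ ∧ Deduces Δ p a := by
  constructor
  · rintro ⟨a, q, ha, he, hq⟩
    cases he
    exact ⟨a, ha, hq⟩
  · rintro ⟨a, ha, hp⟩
    exact ⟨a, p, ha, rfl, hp⟩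

/-- The values of the variables are valid. -/
def EnvVal : Ctx voc → {n : ℕ} → List (Formula n) → Env n → Prop
  | [], _, _, _ => True
  | σ :: Γ, _, Δ, η => Val (er σ) Δ η.tail (η 0) ∧ EnvVal Γ Δ η.tail

theorem EnvVal.map {Γ : Ctx voc} {n m : ℕ} {Δ : List (Formula n)} {Δ' : List (Formula m)}
    {η : Env n} (hη : EnvVal Γ Δ η) {h : Hom n m} (hr : Respects h Δ Δ') :
    EnvVal Γ Δ' (η.map h) := by
  induction Γ generalizing η with
  | nil => trivial
  | cons σ Γ ih => exact ⟨hη.1.map hr, ih hη.2⟩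

theorem EnvVal.lookup {Γ : Ctx voc} {n : ℕ} {Δ : List (Formula n)} {η : Env n}
    (hη : EnvVal Γ Δ η) {i : ℕ} {σ : Fam voc} (hi : Γ[i]? = some σ) :
    Val (er σ) Δ (η ∘ (· + (i + 1))) (η i) := by
  induction Γ generalizing i η with
  | nil => simp at hi
  | cons τ Γ ih =>
    cases i with
    | zero =>
      simp only [List.getElem?_cons_zero, Option.some.injEq] at hi
      subst hi
      exact hη.1
    | succ i => exact ih hη.2 (by simpa using hi)

theorem EnvVal.tyEnv {Γ : Ctx voc} {n : ℕ} {Δ : List (Formula n)} {η : Env n}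
    (hη : EnvVal Γ Δ η) : TyEnv Γ η :=
  fun _ _ hi => (hη.lookup hi).sty_eq

/-! ### The constants are valid -/

theorem Ev.app {M N : Tm} {a b : STy} {n : ℕ} {η : Env n} {f : (STy.arr a b).El n} {x : a.El n}
    (hM : Ev M η ⟨.arr a b, f⟩) (hN : Ev N η ⟨a, x⟩) :
    Ev (.app M N) η ⟨b, apAt f (Hom.id n) x⟩ :=
  ⟨a, b, f, x, hM, hN, rfl⟩

section

variable {n : ℕ} {η : Env n}

theorem ev_lam {P : Tm} {P' : (STy.arr .ind .prop).El n} (h : Ev P η ⟨.arr .ind .prop, P'⟩) :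
    Ev (.app (.const .lam) P) η ⟨.ind, Syn.abs (generic P')⟩ :=
  ⟨_, _, cden .lam n, _, rfl, h, rfl⟩

theorem ev_all {P : Tm} {P' : (STy.arr .ind .prop).El n} (h : Ev P η ⟨.arr .ind .prop, P'⟩) :
    Ev (.app (.const .all) P) η ⟨.prop, Syn.all (generic P')⟩ :=
  ⟨_, _, cden .all n, _, rfl, h, rfl⟩

theorem ev_mem {t u : Tm} {t' u' : SetTerm n} (ht : Ev t η ⟨.ind, t'⟩) (hu : Ev u η ⟨.ind, u'⟩) :
    Ev (.app (.app (.const .mem) t) u) η ⟨.prop, Syn.mem t' u'⟩ :=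
  ⟨_, _, _, _, ⟨_, _, cden .mem n, _, rfl, ht, rfl⟩, hu,
    congrArg (fun s => (⟨.prop, Syn.mem s u'⟩ : Dom n)) (Syn.subst_var t').symm⟩

theorem ev_imp {A B : Tm} {a b : Formula n} (ha : Ev A η ⟨.prop, a⟩) (hb : Ev B η ⟨.prop, b⟩) :
    Ev (.app (.app (.const .imp) A) B) η ⟨.prop, Syn.imp a b⟩ :=
  ⟨_, _, _, _, ⟨_, _, cden .imp n, _, rfl, ha, rfl⟩, hb,
    congrArg (fun s => (⟨.prop, Syn.imp s b⟩ : Dom n)) (Syn.subst_var a).symm⟩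

theorem ev_instance {P t : Tm} {P' : (STy.arr .ind .prop).El n} {t' : SetTerm n}
    (hP : Ev P η ⟨.arr .ind .prop, P'⟩) (ht : Ev t η ⟨.ind, t'⟩) :
    Ev (.app P t) η ⟨.prop, Syn.inst (generic P') t'⟩ := by
  have := hP.app ht
  rw [← map_instInd_generic P' t'] at this
  exact this

theorem val_T_iff {N : Tm} {a : Formula n} (ha : Ev N η ⟨.prop, a⟩) {Δ : List (Formula n)}
    {p : Proof} : Val (.app (.const .T) N) Δ η ⟨.prf, p⟩ ↔ Deduces Δ p a := by
  rw [val_T]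
  constructor
  · rintro ⟨b, hb, hp⟩
    cases ha.functional hb
    exact hp
  · exact fun hp => ⟨a, ha, hp⟩

theorem Val.pi {σ τ : EFam} {Δ : List (Formula n)} {f : (STy.arr σ.sty τ.sty).El n}
    (H : ∀ m (Δ' : List (Formula m)) (h : Hom n m), Respects h Δ Δ' → ∀ x : σ.sty.El m,
      Val σ Δ' (η.map h) ⟨_, x⟩ → Val τ Δ' ((η.map h).cons ⟨_, x⟩) ⟨_, apAt f h x⟩) :
    Val (.pi σ τ) Δ η ⟨.arr σ.sty τ.sty, f⟩ :=
  ⟨_, _, rfl, rfl, f, rfl, H⟩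

theorem Val.pi_apply {σ τ : EFam} {Δ : List (Formula n)} {f : (STy.arr σ.sty τ.sty).El n}
    (H : Val (.pi σ τ) Δ η ⟨.arr σ.sty τ.sty, f⟩) {m : ℕ} {Δ' : List (Formula m)} {h : Hom n m}
    (hr : Respects h Δ Δ') {x : σ.sty.El m} (hx : Val σ Δ' (η.map h) ⟨_, x⟩) :
    Val τ Δ' ((η.map h).cons ⟨_, x⟩) ⟨_, apAt f h x⟩ := by
  obtain ⟨a, b, rfl, rfl, g, he, hg⟩ := H
  cases he
  exact hg m Δ' h hr x hx

end

/-- Once the products are unfolded and the indices evaluated, the claim for a constant of a rule is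
that very rule of `Deduces`; the syntactic constants only need the right simple type. -/
theorem val_cden {c : ObjConst} {σ : Fam voc} (h : Decl.obj c σ ∈ sigFPST) {n : ℕ}
    (Δ : List (Formula n)) (η : Env n) : Val (er σ) Δ η ⟨cty c, cden c n⟩ := by
  simp only [sigFPST, List.mem_cons, List.not_mem_nil, or_false, reduceCtorEq,
    Decl.obj.injEq] at h
  rcases h with h | h | h | h | h | h | h | h | h | h | h <;> obtain ⟨rfl, rfl⟩ := h
  · refine Val.pi fun _ _ _ _ P _ => Val.pi fun _ _ h₂ _ t _ => Val.pi fun k _ h₃ _ p hp => ?_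
    let P' : (STy.arr .ind .prop).El k := (STy.arr .ind .prop).sem.map h₃
      ((STy.arr .ind .prop).sem.map h₂ P)
    let t' : SetTerm k := STy.ind.sem.map h₃ t
    have hp := (val_T_iff (ev_mem (t' := t') (by rfl) (ev_lam (P' := P') (by rfl)))).1 hp
    exact (val_T_iff (ev_instance (P' := P') (t' := t') (by rfl) (by rfl))).2 (.memE hp)
  · refine Val.pi fun _ _ _ _ P _ => Val.pi fun _ _ h₂ _ t _ => Val.pi fun k _ h₃ _ p hp => ?_
    let P' : (STy.arr .ind .prop).El k := (STy.arr .ind .prop).sem.map h₃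
      ((STy.arr .ind .prop).sem.map h₂ P)
    let t' : SetTerm k := STy.ind.sem.map h₃ t
    have hp := (val_T_iff (ev_instance (P' := P') (t' := t') (by rfl) (by rfl))).1 hp
    exact (val_T_iff (ev_mem (t' := t') (by rfl) (ev_lam (P' := P') (by rfl)))).2 (.memI hp)
  · refine Val.pi fun _ _ _ _ P _ => Val.pi fun _ _ h₂ _ t _ => Val.pi fun k _ h₃ _ p hp => ?_
    let P' : (STy.arr .ind .prop).El k := (STy.arr .ind .prop).sem.map h₃
      ((STy.arr .ind .prop).sem.map h₂ P)
    let t' : SetTerm k := STy.ind.sem.map h₃ t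
    have hp := (val_T_iff (ev_all (P' := P') (by rfl))).1 hp
    exact (val_T_iff (ev_instance (P' := P') (t' := t') (by rfl) (by rfl))).2 (.allE _ hp)
  · refine Val.pi fun _ _ _ _ P _ => Val.pi fun k Δ' h₂ _ F hF => ?_
    let P' : (STy.arr .ind .prop).El k := (STy.arr .ind .prop).sem.map h₂ P
    -- At a fresh individual variable, with the assumptions shifted past it, the given function
    -- yields the premise of the rule with its eigenvariable condition.
    have hF := hF.pi_apply (Respects.newInd Δ') (x := (Syn.var 0 : SetTerm (k + 1))) rfl
    have hF := (val_T_iff (ev_instance (P' := (STy.arr .ind .prop).sem.map (Hom.newInd k) P')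
      (t' := .var 0) (by rfl) (by rfl))).1 hF
    -- Instantiating the weakened predicate at the fresh variable gives back the body under the
    -- quantifier.
    have e : Syn.inst (generic ((STy.arr .ind .prop).sem.map (Hom.newInd k) P')) (.var 0) =
        generic P' :=
      (map_instInd_generic (b := .prop) ((STy.arr .ind .prop).sem.map (Hom.newInd k) P')
        (Syn.var 0)).trans
        (congrArg (fun g => apAt P' g (Syn.var 0 : SetTerm (k + 1))) (Hom.comp_id (Hom.newInd k)))
    rw [e] at hF
    exact (val_T_iff (ev_all (P' := P') (by rfl))).2 (.allI hF)
  · refine Val.pi fun _ _ _ _ A _ => Val.pi fun _ _ h₂ _ B _ => Val.pi fun _ _ h₃ _ p hp =>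
      Val.pi fun k _ h₄ r₄ q hq => ?_
    -- The minor premise was supplied in an earlier world than the major one and has to be
    -- transported to it.
    have hp := ((val_T_iff (a := STy.prop.sem.map h₃ (STy.prop.sem.map h₂ A)) (by rfl)).1 hp).map r₄
    have hq := (val_T_iff (ev_imp
      (a := STy.prop.sem.map h₄ (STy.prop.sem.map h₃ (STy.prop.sem.map h₂ A)))
      (b := STy.prop.sem.map h₄ (STy.prop.sem.map h₃ B)) (by rfl) (by rfl))).1 hq
    exact (val_T_iff (a := STy.prop.sem.map h₄ (STy.prop.sem.map h₃ B)) (by rfl)).2 (.impE hq hp)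
  · refine Val.pi fun _ _ _ _ A _ => Val.pi fun _ _ h₂ _ B _ => Val.pi fun k Δ' h₃ _ F hF => ?_
    let A' : Formula k := STy.prop.sem.map h₃ (STy.prop.sem.map h₂ A)
    let B' : Formula k := STy.prop.sem.map h₃ B
    -- The function is defined on valid elements of `V(A)`, that is on assumptions; it is applied to
    -- the newly added one, with label `0`, which the rule then discharges.
    have hF := hF.pi_apply (Respects.newHyp Δ' A') (x := Proof.hyp 0)
      ⟨A', 0, (STy.prop.sem.map_id A').symm ▸ rfl, rfl, rfl⟩
    have hF := (val_T_iff (a := B') (by exact (STy.prop.sem.map_id B').symm ▸ rfl)).1 hF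
    exact (val_T_iff (ev_imp (a := A') (b := B') (by rfl) (by rfl))).2 (.impI hF)
  · refine Val.pi fun _ _ _ _ A _ => Val.pi fun _ _ h₂ _ p hp => ?_
    obtain ⟨a, i, ha, he, hi⟩ := hp
    cases he
    exact ⟨a, .hyp i, ha, rfl, .hyp hi⟩
  · exact Val.pi fun _ _ _ _ _ _ => Val.pi fun _ _ _ _ _ _ => rfl
  · exact Val.pi fun _ _ _ _ _ _ => Val.pi fun _ _ _ _ _ _ => rfl
  · exact Val.pi fun _ _ _ _ _ _ => rfl
  · exact Val.pi fun _ _ _ _ _ _ => rfl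

/-- Soundness of the model. -/
theorem valid {𝒪 : Oracle voc} {Γ : Ctx voc} {M : Obj voc} {σ : Fam voc}
    (h : Derives 𝒪 sigFPST (.obj Γ M σ)) {n : ℕ} {Δ : List (Formula n)} {η : Env n}
    (hη : EnvVal Γ Δ η) : ∃ d, Ev (er M) η d ∧ Val (er σ) Δ η d := by
  generalize hS : sigFPST = Sg at h
  generalize hj : Judgement.obj Γ M σ = j at h
  induction h generalizing Γ M σ n with
  | sigEmpty | sigKind | sigType | ctxEmpty | ctxType | kindType | kindPi | famConst | famPi
  | famApp | famLock | famConv | famGuardedUnlock => cases hj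
  | objConst _ hc =>
    cases hj; subst hS
    exact ⟨_, rfl, val_cden hc Δ η⟩
  | objVar _ hi =>
    cases hj
    rw [er_rename]
    exact ⟨_, rfl, val_rename.2 (hη.lookup hi)⟩
  | @objAbs Sg Γ σ τ M h ih =>
    cases hj; subst hS
    -- The function value, defined at all arguments, comes from simple typing; the induction
    -- hypothesis speaks only of valid arguments and contributes the validity of the results.
    obtain ⟨-, -, H⟩ := simplyTyped (Derives.objAbs h) (List.Subset.refl _)
    obtain ⟨-, d, ⟨b, f, rfl, hf⟩, hd⟩ := H n η hη.tyEnv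
    obtain rfl : b = EFam.sty (er τ) := (STy.arr.inj hd).2
    refine ⟨_, ⟨_, f, rfl, hf⟩, Val.pi fun m Δ' k hr x hx => ?_⟩
    obtain ⟨d, hd, hv⟩ := ih (η := (η.map k).cons ⟨_, x⟩)
      (show EnvVal (σ :: Γ) Δ' _ from ⟨hx, hη.map hr⟩) rfl rfl
    rw [← hd.functional (hf m k x)]
    exact hv
  | @objApp Sg Γ σ τ M N _ _ ih₁ ih₂ =>
    cases hj; subst hS
    obtain ⟨_, hM, a, b, ha, rfl, f, rfl, hf⟩ := ih₁ hη rfl rfl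
    obtain ⟨⟨a', x⟩, hN, hx⟩ := ih₂ hη rfl rfl
    obtain rfl : a = a' := ha.trans hx.sty_eq.symm
    refine ⟨_, hM.app hN, ?_⟩
    rw [er_inst]
    refine (val_subst (EvSub.single hN)).2 ?_
    have := hf n Δ (Hom.id n) (Respects.id Δ) x
    rw [Env.map_id] at this
    exact this hx
  | @objConv Sg Γ σ τ M h₁ h₂ hc ih₁ _ =>
    cases hj; subst hS
    obtain ⟨d, hd, hv⟩ := ih₁ hη rfl rfl
    exact ⟨d, hd, (Val.equiv (er_conv_fam hc)
      ((simplyTyped h₁ (List.Subset.refl _)).2.2 n η hη.tyEnv).1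
      ((simplyTyped h₂ (List.Subset.refl _)).2.2.2 n η hη.tyEnv)).1 hv⟩
  | @objLock Sg Γ p M N σ ρ _ _ ih₁ _ =>
    cases hj
    exact ih₁ (M := M) (σ := ρ) hη hS rfl
  | @objTopUnlock Sg Γ p M N σ ρ _ _ ih =>
    cases hj
    exact ih (M := M) (σ := .flock p N σ ρ) hη hS rfl
  | @objGuardedUnlock Sg Γ p S S' M N σ σ' ρ τ _ _ _ _ ih₁ ih₂ =>
    cases hj
    -- After erasure the locked object `N` already has a valid value of the type `τ`, so the unlock
    -- object substituted by this rule has a value although its predicate was never checked.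
    obtain ⟨d, hd, hv⟩ := ih₂ hη hS rfl
    obtain ⟨e, he, hv'⟩ := ih₁ (η := η.cons d)
      (show EnvVal (τ :: Γ) Δ _ from ⟨hv, hη⟩) hS rfl
    simp only [er, er_inst]
    exact ⟨e, (ev_subst (EvSub.single hd)).2 he, (val_subst (EvSub.single hd)).2 hv'⟩

/-! ### Reading off deductions -/

/-- The proof variables of `η` are the assumptions with the labels `e`. -/
def Labels (e : ℕ → ℕ) {n : ℕ} (η : Env n) : Prop :=
  ∀ x (q : Proof), η x = ⟨.prf, q⟩ → q = .hyp (e x)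

theorem Labels.map_lab {e : ℕ → ℕ} {n m : ℕ} {η : Env n} (hη : Labels e η) (h : Hom n m) {x : ℕ}
    {q : Proof} (hq : (η x).map h = ⟨.prf, q⟩) : q = .hyp (h.lab (e x)) := by
  generalize hd : η x = d at hq
  obtain ⟨a, v⟩ := d
  obtain rfl : a = .prf := congrArg Sigma.fst hq
  cases hη x v hd
  cases hq
  rfl

/-- Each proof constant appends its own rule to the trees of its arguments, and an abstraction below
it is evaluated at a fresh assumption or individual. Thus a visible object evaluates to the tree
that it displays, provided that it has a value at all. -/
theorem Reads.ev {e : ℕ → ℕ} {M : Obj voc} {p : Proof} (hM : Reads e M p) {n : ℕ} {η : Env n}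
    (hη : Labels e η) {d : Dom n} (hd : Ev (er M) η d) : d = ⟨.prf, p⟩ := by
  induction hM generalizing n with
  | hyp e A x =>
    obtain ⟨_, _, _, v, ⟨_, _, _, _, hc, -, h⟩, hv, rfl⟩ := hd
    cases hc; cases h
    cases hη x v hv.symm
    rfl
  | @impI e A B σ M p _ ih =>
    obtain ⟨_, _, _, F, ⟨_, _, _, _, ⟨_, _, _, _, hc, -, h⟩, -, h'⟩, ⟨b, f, hF, hf⟩, rfl⟩ := hd
    cases hc; cases h; cases h'
    -- The annotation `σ` is arbitrary in `Reads`; since the application has a value, the domain of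
    -- the abstraction must have the simple type that the constant expects.
    obtain ⟨ha, hb⟩ := STy.arr.inj (congrArg Sigma.fst hF)
    generalize EFam.sty (er σ) = a at *
    subst ha hb
    cases hF
    have := ih (η := (η.map (Hom.newHyp n)).cons ⟨.prf, Proof.hyp 0⟩) (by
      intro x q hq
      cases x with
      | zero => cases hq; rfl
      | succ x => exact hη.map_lab (Hom.newHyp n) hq) (hf n (Hom.newHyp n) (Proof.hyp 0))
    cases this
    rfl
  | impIEta e A B A' =>
    obtain ⟨_, _, _, F, ⟨_, _, _, _, ⟨_, _, _, _, hc, -, h⟩, -, h'⟩, ⟨_, _, _, _, hc', -, h''⟩,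
      rfl⟩ := hd
    cases hc; cases h; cases h'; cases hc'; cases h''
    rfl
  | @impE e A B S σ x y p q _ _ ih₁ ih₂ =>
    obtain ⟨_, _, _, y', ⟨_, _, _, x', ⟨_, _, _, _, ⟨_, _, _, _, hc, -, h⟩, -, h'⟩, hx, h''⟩, hy,
      rfl⟩ := hd
    cases hc; cases h; cases h'; cases h''
    cases ih₁ hη hx
    cases ih₂ hη hy
    -- Currying transports the minor premise along the identity morphism, hence the relabelling by
    -- the identity.
    exact congrArg (fun q => (⟨.prf, Proof.impE p q⟩ : Dom n)) (Proof.rename_id q)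
  | @allI e P σ M p _ ih =>
    obtain ⟨_, _, _, F, ⟨_, _, _, _, hc, -, h⟩, ⟨b, f, hF, hf⟩, rfl⟩ := hd
    cases hc; cases h
    obtain ⟨ha, hb⟩ := STy.arr.inj (congrArg Sigma.fst hF)
    generalize EFam.sty (er σ) = a at *
    subst ha hb
    cases hF
    have := ih (η := (η.map (Hom.newInd n)).cons ⟨.ind, (Syn.var 0 : SetTerm (n + 1))⟩) (by
      intro x q hq
      cases x with
      | zero => cases hq
      | succ x => exact hη.map_lab (Hom.newInd n) hq)
      (hf (n + 1) (Hom.newInd n) (Syn.var 0 : SetTerm (n + 1)))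
    cases this
    rfl
  | allE P t _ ih =>
    obtain ⟨_, _, _, y, ⟨_, _, _, _, ⟨_, _, _, _, hc, -, h⟩, -, h'⟩, hy, rfl⟩ := hd
    cases hc; cases h; cases h'
    cases ih hη hy
    rfl
  | memI P t _ ih =>
    obtain ⟨_, _, _, y, ⟨_, _, _, _, ⟨_, _, _, _, hc, -, h⟩, -, h'⟩, hy, rfl⟩ := hd
    cases hc; cases h; cases h'
    cases ih hη hy
    rfl
  | memE P t _ ih =>
    obtain ⟨_, _, _, y, ⟨_, _, _, _, ⟨_, _, _, _, hc, -, h⟩, -, h'⟩, hy, rfl⟩ := hd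
    cases hc; cases h; cases h'
    cases ih hη hy
    rfl

/-! ### Values of encodings and the generic environment. -/

/-- The value of a set term or of a formula. -/
def synDom : {c : SynCat} → {n : ℕ} → Syn c n → Dom n
  | .set, _, t => ⟨.ind, t⟩
  | .form, _, A => ⟨.prop, A⟩

/-- The encoding of `e` evaluates to `e`. -/
theorem ev_enc {c : SynCat} {n m : ℕ} (e : Syn c n) {η : Env m} (θ : Fin n → SetTerm m)
    (hη : ∀ i : Fin n, η i = ⟨.ind, θ i⟩) : Ev (er (enc e)) η (synDom (Syn.subst θ e)) := by
  have key : ∀ {n m : ℕ} (A : Formula (n + 1)) (η : Env m) (θ : Fin n → SetTerm m),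
      (∀ i : Fin n, η i = ⟨.ind, θ i⟩) →
      (∀ {k : ℕ} {η : Env k} (θ : Fin (n + 1) → SetTerm k), (∀ i : Fin (n + 1), η i = ⟨.ind, θ i⟩) →
        Ev (er (enc A)) η (synDom (Syn.subst θ A))) →
      ∃ P' : (STy.arr .ind .prop).El m,
        Ev (er (.lam tyI (enc A))) η ⟨.arr .ind .prop, P'⟩ ∧
        generic P' = Syn.subst (Syn.upSub θ) A := by
    intro n m A η θ hη ih
    have h : ∀ k (h : Hom m k) (x : SetTerm k), Ev (er (enc A)) ((η.map h).cons ⟨.ind, x⟩)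
        ⟨.prop, Syn.subst (Fin.cases x fun i => Syn.subst h.sub (θ i)) A⟩ := fun k h x =>
      ih (Fin.cases x fun i => Syn.subst h.sub (θ i)) fun i => by
        cases i using Fin.cases with
        | zero => rfl
        | succ i => exact congrArg (Dom.map h) (hη i)
    obtain ⟨P', b, f, hP, hf⟩ := exists_ev_lam (a := .ind) (b := .prop) (η := η)
      fun k g x => ⟨_, h k g x, rfl⟩
    cases hP
    refine ⟨P', ⟨_, P', rfl, hf⟩, ?_⟩
    -- The body is evaluated at a fresh variable in two ways: through the function value, which
    -- gives `generic P'`, and through the induction hypothesis, which gives the substituted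
    -- formula.
    have e₁ := (hf (m + 1) (Hom.newInd m) (Syn.var 0 : SetTerm (m + 1))).functional
      (h (m + 1) (Hom.newInd m) (Syn.var 0))
    refine (eq_of_heq (Sigma.mk.inj e₁).2).trans ?_
    congr 1
    funext i
    cases i using Fin.cases with
    | zero => rfl
    | succ i => exact (Syn.rename_eq_subst _ _).symm
  induction e generalizing m with
  | var i => exact (hη i).symm
  | abs A ih =>
    obtain ⟨P', hP, hg⟩ := key A η θ hη ih
    have := ev_lam hP
    rw [hg] at this
    exact this
  | mem t u iht ihu => exact ev_mem (iht θ hη) (ihu θ hη)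
  | imp A B ihA ihB => exact ev_imp (ihA θ hη) (ihB θ hη)
  | all A ih =>
    obtain ⟨P', hP, hg⟩ := key A η θ hη ih
    have := ev_all hP
    rw [hg] at this
    exact this

/-- The environment of individual variables. -/
def indEnv (n : ℕ) : Env n := fun i =>
  ⟨.ind, if h : i < n then (Syn.var ⟨i, h⟩ : SetTerm n) else Psh.ind.dflt n⟩

/-- The generic environment for an encoded context: `m` assumptions and `n` individuals. -/
def genericEnv (n m : ℕ) : Env n := fun i =>
  if i < m then ⟨.prf, Proof.hyp i⟩ else indEnv n (i - m)

theorem ev_enc_indEnv {c : SynCat} {n : ℕ} (e : Syn c n) :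
    Ev (er (enc e)) (indEnv n) (synDom e) := by
  have := ev_enc e (η := indEnv n) Syn.var fun i => by simp [indEnv]
  rwa [Syn.subst_var] at this

theorem ev_encAt {n : ℕ} (A : Formula n) {m : ℕ} {η : Env n} (hη : η ∘ (· + m) = indEnv n) :
    Ev (er (encAt m A)) η ⟨.prop, A⟩ := by
  rw [encAt, er_rename]
  refine ev_rename.2 ?_
  rw [hη]
  exact ev_enc_indEnv A

theorem envVal_replicate (n k : ℕ) (Δ : List (Formula n)) (η : Env n)
    (hη : ∀ i, (η i).1 = .ind) : EnvVal (List.replicate k tyI) Δ η := by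
  induction k generalizing η with
  | zero => trivial
  | succ k ih => exact ⟨hη 0, ih _ fun i => hη _⟩

/-- The offset `j` counts the assumptions already peeled off: `Γ` shrinks in the induction while the
assumptions `Δ` of the world stay whole, so the labels of the remaining variables move up. -/
theorem envVal_encCtx {n : ℕ} (Γ : List (Formula n)) (Δ : List (Formula n)) (j : ℕ)
    (hΔ : ∀ i A, Γ[i]? = some A → Δ[i + j]? = some A) (η : Env n)
    (h₁ : ∀ i < Γ.length, η i = ⟨.prf, Proof.hyp (i + j)⟩)
    (h₂ : η ∘ (· + Γ.length) = indEnv n) : EnvVal (encCtx Γ) Δ η := by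
  induction Γ generalizing j η with
  | nil => exact envVal_replicate n n Δ η fun i => congrArg Sigma.fst (congrFun h₂ i)
  | cons A Γ ih =>
    refine ⟨⟨A, 0 + j, ev_encAt A h₂, h₁ 0 (by simp), hΔ 0 A rfl⟩, ih (j + 1) ?_ _ ?_ ?_⟩
    · intro i B hB
      rw [← hΔ (i + 1) B hB]
      congr 1; omega
    · intro i hi
      rw [show i + (j + 1) = i + 1 + j by omega]
      exact h₁ (i + 1) (by simpa using hi)
    · exact h₂

/-- An object that encodes a deduction can be typed only by what it deduces. -/
theorem deduces_of_typed {n : ℕ} {Γ : List (Formula n)} {A : Formula n} {M R : Obj voc} {p : Proof}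
    (hM : Typed (encCtx Γ) M (tyT (encAt Γ.length A))) (hR : Expr.Red M R) (hp : Reads id R p) :
    Deduces Γ p A := by
  have h₂ : genericEnv n Γ.length ∘ (· + Γ.length) = indEnv n := by
    funext i; simp [genericEnv]
  have hη : EnvVal (encCtx Γ) Γ (genericEnv n Γ.length) :=
    envVal_encCtx Γ Γ 0 (fun i A h => h) _ (fun i hi => by simp [genericEnv, hi]) h₂
  obtain ⟨d, hd, hv⟩ := valid hM hη
  have hl : Labels id (genericEnv n Γ.length) := by
    intro x q hq
    unfold genericEnv at hq
    split at hq
    · cases hq; rfl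
    · cases hq
  -- The reduct has the value of `M`, which is therefore `p`. Only `M` has to be typed, so subject
  -- reduction for the framework is not required.
  obtain rfl := hp.ev hl (hd.red (er_red hR))
  exact (val_T_iff (ev_encAt A h₂)).1 hv

end FitchPrawitz

namespace LLFP.Expr

variable {𝒱 : Vocabulary}

/-! ## Substitution in the framework -/

theorem rename_rename {s : Cat} (f g : ℕ → ℕ) (e : Expr 𝒱 s) :
    rename g (rename f e) = rename (g ∘ f) e := by
  induction e generalizing f g <;> simp_all [rename, FitchPrawitz.upRen_comp]

theorem upSub_comp_upRen (f : ℕ → ℕ) (θ : ℕ → Obj 𝒱) : upSub θ ∘ upRen f = upSub (θ ∘ f) := by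
  funext i; cases i <;> rfl

theorem subst_rename {s : Cat} (f : ℕ → ℕ) (θ : ℕ → Obj 𝒱) (e : Expr 𝒱 s) :
    subst θ (rename f e) = subst (θ ∘ f) e := by
  induction e generalizing f θ <;> simp_all [rename, subst, upSub_comp_upRen]

theorem rename_comp_upSub (f : ℕ → ℕ) (θ : ℕ → Obj 𝒱) :
    rename (upRen f) ∘ upSub θ = upSub (rename f ∘ θ) := by
  funext i
  cases i with
  | zero => rfl
  | succ i =>
    simp only [upSub, Function.comp, shift, rename_rename]
    rfl

theorem rename_subst {s : Cat} (f : ℕ → ℕ) (θ : ℕ → Obj 𝒱) (e : Expr 𝒱 s) :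
    rename f (subst θ e) = subst (rename f ∘ θ) e := by
  induction e generalizing f θ <;> simp_all [rename, subst, rename_comp_upSub]

theorem upSub_var : upSub (Expr.var : ℕ → Obj 𝒱) = Expr.var := by
  funext i; cases i <;> rfl

theorem subst_var {s : Cat} (e : Expr 𝒱 s) : subst Expr.var e = e := by
  induction e <;> simp_all [subst, upSub_var]

theorem subst_upSub_shift {s : Cat} (θ : ℕ → Obj 𝒱) (e : Expr 𝒱 s) :
    subst (upSub θ) (shift e) = shift (subst θ e) := by
  rw [shift, shift, subst_rename, rename_subst]
  rfl

theorem subst_single_shift {s : Cat} (N : Obj 𝒱) (e : Expr 𝒱 s) :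
    subst (single N) (shift e) = e := by
  rw [shift, subst_rename]
  exact subst_var e

theorem subst_arrow (θ : ℕ → Obj 𝒱) (σ τ : Fam 𝒱) :
    subst θ (arrow σ τ) = arrow (subst θ σ) (subst θ τ) := by
  rw [arrow, subst, subst_upSub_shift, arrow]

theorem rename_inst {s : Cat} (f : ℕ → ℕ) (e : Expr 𝒱 s) (N : Obj 𝒱) :
    rename f (inst e N) = inst (rename (upRen f) e) (rename f N) := by
  simp only [inst, rename_subst, subst_rename]
  congr 1
  funext i; cases i <;> rfl

theorem inst_rename_upRen_succ {s : Cat} (e : Expr 𝒱 s) :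
    inst (rename (upRen Nat.succ) e) (.var 0) = e := by
  rw [inst, subst_rename]
  refine (congrArg (subst · e) ?_).trans (subst_var e)
  funext i; cases i <;> rfl

end LLFP.Expr

namespace FitchPrawitz

open LLFP

/-! ## Subject reduction for natural deductions -/

theorem Deduces.subst_hyps {n : ℕ} {Γ Γ' : List (Formula n)} {p : Proof} {A : Formula n}
    (h : Deduces Γ p A) {θ : ℕ → Proof} (hθ : ∀ i B, Γ[i]? = some B → Deduces Γ' (θ i) B) :
    Deduces Γ' (p.subst θ) A := by
  induction h generalizing θ with
  | hyp h => exact hθ _ _ h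
  | @impI n Γ p A C _ ih =>
    refine .impI (ih fun i B hB => ?_)
    cases i with
    | zero => exact .hyp hB
    | succ i =>
      have := (hθ i B hB).map (Respects.newHyp Γ' A)
      rwa [show Syn.subst (Hom.newHyp _).sub B = B from Syn.subst_var B] at this
  | impE _ _ ih₁ ih₂ => exact .impE (ih₁ hθ) (ih₂ hθ)
  | allI _ ih =>
    refine .allI (ih fun i B hB => ?_)
    simp only [List.getElem?_map, Option.map_eq_some_iff] at hB
    obtain ⟨C, hC, rfl⟩ := hB
    have := (hθ i C hC).map (Respects.newInd Γ')
    rw [show (Hom.newInd _).lab = id from rfl, Proof.rename_id] at this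
    rw [Syn.shift, Syn.rename_eq_subst]
    exact this
  | allE t _ ih => exact .allE t (ih hθ)
  | memI _ ih => exact .memI (ih hθ)
  | memE _ ih => exact .memE (ih hθ)

theorem Deduces.step {n : ℕ} {Γ : List (Formula n)} {p q : Proof} {A : Formula n}
    (h : Deduces Γ p A) (hs : Proof.Step p q) : Deduces Γ q A := by
  induction hs generalizing n with
  | imp p q =>
    cases h with
    | impE hp hq =>
      cases hp with
      | impI hp =>
        refine hp.subst_hyps fun i B hB => ?_
        cases i with
        | zero =>
          simp only [List.getElem?_cons_zero, Option.some.injEq] at hB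
          exact hB ▸ hq
        | succ i => exact .hyp hB
  | all p =>
    cases h with
    | allE t hp =>
      cases hp with
      | allI hp =>
        -- Rule trees record no individual terms: replacing the eigenvariable by `t` changes the
        -- formulas and leaves the tree as it is.
        have := hp.subst_rename (Γ' := Γ) (Syn.single t) id fun i B hB => by
          simp only [List.getElem?_map, Option.map_eq_some_iff] at hB
          obtain ⟨C, hC, rfl⟩ := hB
          rw [← Syn.inst_eq, Syn.inst_shift]
          exact hC
        rw [Proof.rename_id] at this
        exact this
  | mem p =>
    cases h with
    | memE hp => cases hp with | memI hp => exact hp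
  | impI _ ih => cases h with | impI h => exact .impI (ih h)
  | impEMajor _ ih => cases h with | impE h₁ h₂ => exact .impE (ih h₁) h₂
  | impEMinor _ ih => cases h with | impE h₁ h₂ => exact .impE h₁ (ih h₂)
  | allI _ ih => cases h with | allI h => exact .allI (ih h)
  | allE _ ih => cases h with | allE t h => exact .allE t (ih h)
  | memI _ ih => cases h with | memI h => exact .memI (ih h)
  | memE _ ih => cases h with | memE h => exact .memE (ih h)

theorem Deduces.steps {n : ℕ} {Γ : List (Formula n)} {p q : Proof} {A : Formula n}
    (h : Deduces Γ p A) (hs : Relation.ReflTransGen Proof.Step p q) : Deduces Γ q A := by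
  induction hs with
  | refl => exact h
  | tail _ hs ih => exact ih.step hs

/-- Relabelling reflects reduction steps. -/
theorem Proof.exists_step_of_rename {f : ℕ → ℕ} {p q : Proof} (h : Proof.Step (p.rename f) q) :
    ∃ q', Proof.Step p q' := by
  generalize hp : p.rename f = r at h
  induction h generalizing p f with
  | imp =>
    obtain _ | _ | ⟨p₁, p₂⟩ | _ | _ | _ | _ := p <;> simp only [Proof.rename, reduceCtorEq,
      Proof.impE.injEq] at hp
    cases p₁ <;> simp only [Proof.rename, reduceCtorEq, false_and] at hp
    exact ⟨_, .imp _ _⟩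
  | all =>
    obtain _ | _ | _ | _ | p₁ | _ | _ := p <;> simp only [Proof.rename, reduceCtorEq,
      Proof.allE.injEq] at hp
    cases p₁ <;> simp only [Proof.rename, reduceCtorEq] at hp
    exact ⟨_, .all _⟩
  | mem =>
    obtain _ | _ | _ | _ | _ | _ | p₁ := p <;> simp only [Proof.rename, reduceCtorEq,
      Proof.memE.injEq] at hp
    cases p₁ <;> simp only [Proof.rename, reduceCtorEq] at hp
    exact ⟨_, .mem _⟩
  | impI _ ih =>
    cases p <;> simp only [Proof.rename, reduceCtorEq, Proof.impI.injEq] at hp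
    obtain ⟨q', h⟩ := ih hp
    exact ⟨_, .impI h⟩
  | impEMajor _ ih =>
    cases p <;> simp only [Proof.rename, reduceCtorEq, Proof.impE.injEq] at hp
    obtain ⟨q', h⟩ := ih hp.1
    exact ⟨_, .impEMajor h⟩
  | impEMinor _ ih =>
    cases p <;> simp only [Proof.rename, reduceCtorEq, Proof.impE.injEq] at hp
    obtain ⟨q', h⟩ := ih hp.2
    exact ⟨_, .impEMinor h⟩
  | allI _ ih =>
    cases p <;> simp only [Proof.rename, reduceCtorEq, Proof.allI.injEq] at hp
    obtain ⟨q', h⟩ := ih hp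
    exact ⟨_, .allI h⟩
  | allE _ ih =>
    cases p <;> simp only [Proof.rename, reduceCtorEq, Proof.allE.injEq] at hp
    obtain ⟨q', h⟩ := ih hp
    exact ⟨_, .allE h⟩
  | memI _ ih =>
    cases p <;> simp only [Proof.rename, reduceCtorEq, Proof.memI.injEq] at hp
    obtain ⟨q', h⟩ := ih hp
    exact ⟨_, .memI h⟩
  | memE _ ih =>
    cases p <;> simp only [Proof.rename, reduceCtorEq, Proof.memE.injEq] at hp
    obtain ⟨q', h⟩ := ih hp
    exact ⟨_, .memE h⟩

theorem Proof.Normal.rename {p : Proof} (h : p.Normal) (f : ℕ → ℕ) : (p.rename f).Normal := by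
  intro q hq
  obtain ⟨q', hq'⟩ := Proof.exists_step_of_rename hq
  exact h q' hq'

/-! ## The signature is well-formed -/

/-- The signature contains the syntax of naive set theory and its judgements. -/
structure HasSyntax (Sg : Sig voc) : Prop where
  o : Decl.fam FamConst.o .type ∈ Sg
  ι : Decl.fam FamConst.ι .type ∈ Sg
  T : Decl.fam FamConst.T (.kpi tyO .type) ∈ Sg
  V : Decl.fam FamConst.V (.kpi tyO .type) ∈ Sg
  lam : Decl.obj ObjConst.lam (Expr.arrow (Expr.arrow tyI tyO) tyI) ∈ Sg
  all : Decl.obj ObjConst.all (Expr.arrow (Expr.arrow tyI tyO) tyO) ∈ Sg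
  mem : Decl.obj ObjConst.mem (Expr.arrow tyI (Expr.arrow tyI tyO)) ∈ Sg
  imp : Decl.obj ObjConst.imp (Expr.arrow tyO (Expr.arrow tyO tyO)) ∈ Sg

/-- The seven latest declarations are those of the proof constants. All stages of the signature at
which one of them is declared thus share the syntax, and one set of typing lemmas serves them all.
-/
theorem HasSyntax.drop {k : ℕ} (hk : k ≤ 7) : HasSyntax (sigFPST.drop k) := by
  interval_cases k <;> constructor <;> simp [sigFPST]

section

variable {𝒪 : Oracle voc} {Sg : Sig voc} {Γ : Ctx voc}

theorem typed_app_arrow {M N : Obj voc} {σ τ : Fam voc}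
    (hM : Derives 𝒪 Sg (.obj Γ M (Expr.arrow σ τ))) (hN : Derives 𝒪 Sg (.obj Γ N σ)) :
    Derives 𝒪 Sg (.obj Γ (.app M N) τ) := by
  have := Derives.objApp hM hN
  rwa [Expr.inst, Expr.subst_single_shift] at this

theorem typed_var {i : ℕ} {σ τ : Fam voc} (hΓ : Derives 𝒪 Sg (.ctx Γ)) (hi : Γ[i]? = some σ)
    (he : Expr.rename (· + (i + 1)) σ = τ) : Derives 𝒪 Sg (.obj Γ (.var i) τ) :=
  he ▸ .objVar hΓ hi

namespace HasSyntax

theorem fam_I (hS : HasSyntax Sg) (hΓ : Derives 𝒪 Sg (.ctx Γ)) :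
    Derives 𝒪 Sg (.fam Γ tyI .type) :=
  .famConst hΓ hS.ι

theorem fam_O (hS : HasSyntax Sg) (hΓ : Derives 𝒪 Sg (.ctx Γ)) :
    Derives 𝒪 Sg (.fam Γ tyO .type) :=
  .famConst hΓ hS.o

theorem fam_predicate (hS : HasSyntax Sg) (hΓ : Derives 𝒪 Sg (.ctx Γ)) :
    Derives 𝒪 Sg (.fam Γ (Expr.arrow tyI tyO) .type) :=
  .famPi (hS.fam_O (.ctxType (hS.fam_I hΓ)))

theorem fam_T (hS : HasSyntax Sg) (hΓ : Derives 𝒪 Sg (.ctx Γ)) {A : Obj voc}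
    (hA : Derives 𝒪 Sg (.obj Γ A tyO)) : Derives 𝒪 Sg (.fam Γ (tyT A) .type) :=
  .famApp (.famConst hΓ hS.T) hA

theorem fam_V (hS : HasSyntax Sg) (hΓ : Derives 𝒪 Sg (.ctx Γ)) {A : Obj voc}
    (hA : Derives 𝒪 Sg (.obj Γ A tyO)) : Derives 𝒪 Sg (.fam Γ (tyV A) .type) :=
  .famApp (.famConst hΓ hS.V) hA

theorem typed_cLam (hS : HasSyntax Sg) (hΓ : Derives 𝒪 Sg (.ctx Γ)) {P : Obj voc}
    (hP : Derives 𝒪 Sg (.obj Γ P (Expr.arrow tyI tyO))) : Derives 𝒪 Sg (.obj Γ (cLam P) tyI) :=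
  typed_app_arrow (.objConst hΓ hS.lam) hP

theorem typed_cAll (hS : HasSyntax Sg) (hΓ : Derives 𝒪 Sg (.ctx Γ)) {P : Obj voc}
    (hP : Derives 𝒪 Sg (.obj Γ P (Expr.arrow tyI tyO))) : Derives 𝒪 Sg (.obj Γ (cAll P) tyO) :=
  typed_app_arrow (.objConst hΓ hS.all) hP

theorem typed_cMem (hS : HasSyntax Sg) (hΓ : Derives 𝒪 Sg (.ctx Γ)) {t u : Obj voc}
    (ht : Derives 𝒪 Sg (.obj Γ t tyI)) (hu : Derives 𝒪 Sg (.obj Γ u tyI)) :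
    Derives 𝒪 Sg (.obj Γ (cMem t u) tyO) :=
  typed_app_arrow (typed_app_arrow (.objConst hΓ hS.mem) ht) hu

theorem typed_cImp (hS : HasSyntax Sg) (hΓ : Derives 𝒪 Sg (.ctx Γ)) {A B : Obj voc}
    (hA : Derives 𝒪 Sg (.obj Γ A tyO)) (hB : Derives 𝒪 Sg (.obj Γ B tyO)) :
    Derives 𝒪 Sg (.obj Γ (cImp A B) tyO) :=
  typed_app_arrow (typed_app_arrow (.objConst hΓ hS.imp) hA) hB

theorem fam_T_app (hS : HasSyntax Sg) (hΓ : Derives 𝒪 Sg (.ctx Γ)) {i j : ℕ}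
    (hi : Γ[i]? = some (Expr.arrow tyI tyO)) (hj : Γ[j]? = some tyI) :
    Derives 𝒪 Sg (.fam Γ (tyT (.app (.var i) (.var j))) .type) :=
  hS.fam_T hΓ (typed_app_arrow (typed_var hΓ hi rfl) (typed_var hΓ hj rfl))

theorem fam_T_mem (hS : HasSyntax Sg) (hΓ : Derives 𝒪 Sg (.ctx Γ)) {i j : ℕ}
    (hi : Γ[i]? = some (Expr.arrow tyI tyO)) (hj : Γ[j]? = some tyI) :
    Derives 𝒪 Sg (.fam Γ (tyT (cMem (.var j) (cLam (.var i)))) .type) :=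
  hS.fam_T hΓ (hS.typed_cMem hΓ (typed_var hΓ hj rfl) (hS.typed_cLam hΓ (typed_var hΓ hi rfl)))

theorem fam_T_all (hS : HasSyntax Sg) (hΓ : Derives 𝒪 Sg (.ctx Γ)) {i : ℕ}
    (hi : Γ[i]? = some (Expr.arrow tyI tyO)) :
    Derives 𝒪 Sg (.fam Γ (tyT (cAll (.var i))) .type) :=
  hS.fam_T hΓ (hS.typed_cAll hΓ (typed_var hΓ hi rfl))

theorem fam_T_var (hS : HasSyntax Sg) (hΓ : Derives 𝒪 Sg (.ctx Γ)) {i : ℕ}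
    (hi : Γ[i]? = some tyO) : Derives 𝒪 Sg (.fam Γ (tyT (.var i)) .type) :=
  hS.fam_T hΓ (typed_var hΓ hi rfl)

theorem fam_V_var (hS : HasSyntax Sg) (hΓ : Derives 𝒪 Sg (.ctx Γ)) {i : ℕ}
    (hi : Γ[i]? = some tyO) : Derives 𝒪 Sg (.fam Γ (tyV (.var i)) .type) :=
  hS.fam_V hΓ (typed_var hΓ hi rfl)

theorem fam_T_imp (hS : HasSyntax Sg) (hΓ : Derives 𝒪 Sg (.ctx Γ)) {i j : ℕ}
    (hi : Γ[i]? = some tyO) (hj : Γ[j]? = some tyO) :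
    Derives 𝒪 Sg (.fam Γ (tyT (cImp (.var i) (.var j))) .type) :=
  hS.fam_T hΓ (hS.typed_cImp hΓ (typed_var hΓ hi rfl) (typed_var hΓ hj rfl))

end HasSyntax

theorem sig_syntax : Derives 𝒪 (sigFPST.drop 7) .sig := by
  have h₁ : Derives 𝒪 (sigFPST.drop 14) .sig :=
    .sigKind (.kindType (.ctxEmpty .sigEmpty)) (by simp)
  have h₂ : Derives 𝒪 (sigFPST.drop 13) .sig :=
    .sigKind (.kindType (.ctxEmpty h₁)) (by simp)
  have o₂ : ∀ {Γ}, Derives 𝒪 (sigFPST.drop 13) (.ctx Γ) →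
      Derives 𝒪 (sigFPST.drop 13) (.fam Γ tyO .type) := fun h => .famConst h (by simp [sigFPST])
  have h₃ : Derives 𝒪 (sigFPST.drop 12) .sig :=
    .sigKind (.kindPi (.kindType (.ctxType (o₂ (.ctxEmpty h₂))))) (by simp)
  have o₃ : ∀ {Γ}, Derives 𝒪 (sigFPST.drop 12) (.ctx Γ) →
      Derives 𝒪 (sigFPST.drop 12) (.fam Γ tyO .type) := fun h => .famConst h (by simp [sigFPST])
  have h₄ : Derives 𝒪 (sigFPST.drop 11) .sig :=
    .sigKind (.kindPi (.kindType (.ctxType (o₃ (.ctxEmpty h₃))))) (by simp)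
  have o : ∀ {k : ℕ} {Γ}, k ≤ 11 → Derives 𝒪 (sigFPST.drop k) (.ctx Γ) →
      Derives 𝒪 (sigFPST.drop k) (.fam Γ tyO .type) := fun hk h =>
    .famConst h (by interval_cases ‹ℕ› <;> simp [sigFPST])
  have ι : ∀ {k : ℕ} {Γ}, k ≤ 11 → Derives 𝒪 (sigFPST.drop k) (.ctx Γ) →
      Derives 𝒪 (sigFPST.drop k) (.fam Γ tyI .type) := fun hk h =>
    .famConst h (by interval_cases ‹ℕ› <;> simp [sigFPST])
  have arr : ∀ {k : ℕ} {Γ}, k ≤ 11 → Derives 𝒪 (sigFPST.drop k) (.ctx Γ) →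
      Derives 𝒪 (sigFPST.drop k) (.fam Γ (Expr.arrow tyI tyO) .type) := fun hk h =>
    .famPi (o hk (.ctxType (ι hk h)))
  have h₅ : Derives 𝒪 (sigFPST.drop 10) .sig :=
    .sigType (.famPi (ι (by simp) (.ctxType (arr (by simp) (.ctxEmpty h₄))))) (by simp)
  have h₆ : Derives 𝒪 (sigFPST.drop 9) .sig :=
    .sigType (.famPi (o (by simp) (.ctxType (arr (by simp) (.ctxEmpty h₅))))) (by simp)
  have h₇ : Derives 𝒪 (sigFPST.drop 8) .sig :=
    .sigType (.famPi (arr (by simp) (.ctxType (ι (by simp) (.ctxEmpty h₆))))) (by simp)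
  exact .sigType (.famPi (.famPi (o (by simp) (.ctxType (o (by simp) (.ctxType (o (by simp)
    (.ctxEmpty h₇)))))))) (by simp)

theorem sig_drop_four : Derives 𝒪 (sigFPST.drop 4) .sig := by
  have h₈ : Derives 𝒪 (sigFPST.drop 6) .sig := by
    have hS : HasSyntax (sigFPST.drop 7) := .drop (by simp)
    have c₁ := Derives.ctxType (hS.fam_O (.ctxEmpty (sig_syntax (𝒪 := 𝒪))))
    have c₂ := Derives.ctxType (hS.fam_V_var c₁ (i := 0) rfl)
    exact .sigType (.famPi (.famPi (hS.fam_T_var c₂ (i := 1) rfl))) (by simp)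
  have h₉ : Derives 𝒪 (sigFPST.drop 5) .sig := by
    have hS : HasSyntax (sigFPST.drop 6) := .drop (by simp)
    have c₁ := Derives.ctxType (hS.fam_O (.ctxEmpty h₈))
    have c₂ := Derives.ctxType (hS.fam_O c₁)
    have c₃ := Derives.ctxType (hS.fam_V_var c₂ (i := 1) rfl)
    have F := Derives.famPi (hS.fam_T_var c₃ (i := 1) rfl)
    exact .sigType (.famPi (.famPi (.famPi (hS.fam_T_imp (.ctxType F) (i := 2) (j := 1) rfl rfl))))
      (by simp)
  have hS : HasSyntax (sigFPST.drop 5) := .drop (by simp)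
  have c₁ := Derives.ctxType (hS.fam_O (.ctxEmpty h₉))
  have c₂ := Derives.ctxType (hS.fam_O c₁)
  have c₃ := Derives.ctxType (hS.fam_T_var c₂ (i := 1) rfl)
  have c₄ := Derives.ctxType (hS.fam_T_imp c₃ (i := 2) (j := 1) rfl rfl)
  have d₁ := Derives.ctxType (hS.fam_T_var c₄ (i := 3) rfl)
  have d₂ := Derives.ctxType (hS.fam_T_imp d₁ (i := 4) (j := 3) rfl rfl)
  have F : Derives 𝒪 (sigFPST.drop 5) (.fam _ (pairArgTy (.var 3) (.var 2)) .type) :=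
    .famPi (.famPi (hS.fam_T_var d₂ (i := 4) rfl))
  have c₅ := Derives.ctxType F
  have P : Derives 𝒪 (sigFPST.drop 5) (.obj _ (pair (.var 3) (.var 2) (.var 1) (.var 0))
      (pairTy (.var 3) (.var 2))) :=
    .objAbs (typed_app_arrow (typed_app_arrow (typed_var c₅ (i := 0) rfl rfl)
      (typed_var c₅ (i := 2) rfl rfl)) (typed_var c₅ (i := 1) rfl rfl))
  exact .sigType (.famPi (.famPi (.famPi (.famPi (.famLock (hS.fam_T_var c₄ (i := 2) rfl) P)))))
    (by simp)

theorem sig_sigFPST : Derives 𝒪 sigFPST .sig := by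
  have h₁₁ : Derives 𝒪 (sigFPST.drop 3) .sig := by
    have hS : HasSyntax (sigFPST.drop 4) := .drop (by simp)
    have c₁ := Derives.ctxType (hS.fam_predicate (.ctxEmpty (sig_drop_four (𝒪 := 𝒪))))
    have F := Derives.famPi (hS.fam_T_app (.ctxType (hS.fam_I c₁)) (i := 1) (j := 0) rfl rfl)
    exact .sigType (.famPi (.famPi (hS.fam_T_all (.ctxType F) (i := 1) rfl))) (by simp)
  have h₁₂ : Derives 𝒪 (sigFPST.drop 2) .sig := by
    have hS : HasSyntax (sigFPST.drop 3) := .drop (by simp)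
    have c₁ := Derives.ctxType (hS.fam_predicate (.ctxEmpty h₁₁))
    have c₂ := Derives.ctxType (hS.fam_I c₁)
    have c₃ := Derives.ctxType (hS.fam_T_all c₂ (i := 1) rfl)
    exact .sigType (.famPi (.famPi (.famPi (hS.fam_T_app c₃ (i := 2) (j := 1) rfl rfl))))
      (by simp)
  have h₁₃ : Derives 𝒪 (sigFPST.drop 1) .sig := by
    have hS : HasSyntax (sigFPST.drop 2) := .drop (by simp)
    have c₁ := Derives.ctxType (hS.fam_predicate (.ctxEmpty h₁₂))
    have c₂ := Derives.ctxType (hS.fam_I c₁)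
    have c₃ := Derives.ctxType (hS.fam_T_app c₂ (i := 1) (j := 0) rfl rfl)
    exact .sigType (.famPi (.famPi (.famPi (hS.fam_T_mem c₃ (i := 2) (j := 1) rfl rfl))))
      (by simp)
  have hS : HasSyntax (sigFPST.drop 1) := .drop (by simp)
  have c₁ := Derives.ctxType (hS.fam_predicate (.ctxEmpty h₁₃))
  have c₂ := Derives.ctxType (hS.fam_I c₁)
  have c₃ := Derives.ctxType (hS.fam_T_mem c₂ (i := 1) (j := 0) rfl rfl)
  exact .sigType (.famPi (.famPi (.famPi (hS.fam_T_app c₃ (i := 2) (j := 1) rfl rfl))))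
    (by simp)

end

/-! ## Typing of the proof constants -/

section

open Expr

theorem subst_tyT (θ : ℕ → Obj voc) (A : Obj voc) : subst θ (tyT A) = tyT (subst θ A) := rfl

theorem subst_tyV (θ : ℕ → Obj voc) (A : Obj voc) : subst θ (tyV A) = tyV (subst θ A) := rfl

theorem subst_tyI (θ : ℕ → Obj voc) : subst θ tyI = tyI := rfl

theorem subst_cImp (θ : ℕ → Obj voc) (A B : Obj voc) :
    subst θ (cImp A B) = cImp (subst θ A) (subst θ B) := rfl

theorem subst_cMem (θ : ℕ → Obj voc) (t u : Obj voc) :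
    subst θ (cMem t u) = cMem (subst θ t) (subst θ u) := rfl

theorem subst_cAll (θ : ℕ → Obj voc) (P : Obj voc) : subst θ (cAll P) = cAll (subst θ P) := rfl

theorem subst_cLam (θ : ℕ → Obj voc) (P : Obj voc) : subst θ (cLam P) = cLam (subst θ P) := rfl

theorem subst_pairArgTy (θ : ℕ → Obj voc) (A B : Obj voc) :
    subst θ (pairArgTy A B) = pairArgTy (subst θ A) (subst θ B) := by
  simp only [pairArgTy, subst_arrow, subst_tyT, subst_cImp]

theorem subst_pairTy (θ : ℕ → Obj voc) (A B : Obj voc) :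
    subst θ (pairTy A B) = pairTy (subst θ A) (subst θ B) := by
  simp only [pairTy, subst_arrow, subst_tyT, subst_pairArgTy]

theorem subst_pair (θ : ℕ → Obj voc) (A B x y : Obj voc) :
    subst θ (pair A B x y) = pair (subst θ A) (subst θ B) (subst θ x) (subst θ y) := by
  simp only [pair, pairFun, subst, subst_pairArgTy, subst_upSub_shift, upSub]

variable {Γ : Ctx voc} {A B P t x y F : Obj voc}

theorem hasSyntax_sigFPST : HasSyntax sigFPST := .drop (k := 0) (by simp)

theorem typed_const (hΓ : Derives oracle sigFPST (.ctx Γ)) {c : ObjConst} {σ : Fam voc}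
    (hc : Decl.obj c σ ∈ sigFPST) : Typed Γ (cst c) σ :=
  .objConst hΓ hc

theorem typed_app_pi {M N : Obj voc} {σ τ τ' : Fam voc} (hM : Typed Γ M (.pi σ τ))
    (hN : Typed Γ N σ) (h : subst (single N) τ = τ') : Typed Γ (.app M N) τ' :=
  h ▸ Derives.objApp hM hN

theorem typed_cDelta (hΓ : Derives oracle sigFPST (.ctx Γ)) (hA : Typed Γ A tyO)
    (hx : Typed Γ x (tyV A)) : Typed Γ (cDelta A x) (tyT A) := by
  have h₁ := typed_const hΓ (c := .δ) (by simp [sigFPST]; rfl)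
  have h₂ := typed_app_pi h₁ hA rfl
  simp only [subst_arrow, subst_tyV, subst_tyT, subst, single] at h₂
  exact typed_app_arrow h₂ hx

theorem typed_cImpI (hΓ : Derives oracle sigFPST (.ctx Γ)) (hA : Typed Γ A tyO)
    (hB : Typed Γ B tyO) (hF : Typed Γ F (arrow (tyV A) (tyT B))) :
    Typed Γ (cImpI A B F) (tyT (cImp A B)) := by
  have h₁ := typed_const hΓ (c := .impI) (by simp [sigFPST]; rfl)
  have h₂ := typed_app_pi h₁ hA (by simp only [subst]; rfl)
  have h₃ := typed_app_pi h₂ hB rfl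
  simp only [subst_arrow, subst_tyV, subst_tyT, subst_cImp, subst, single, upSub,
    subst_single_shift] at h₃
  exact typed_app_arrow h₃ hF

theorem typed_cImpE (hΓ : Derives oracle sigFPST (.ctx Γ)) (hA : Typed Γ A tyO)
    (hB : Typed Γ B tyO) (hx : Typed Γ x (tyT A)) (hy : Typed Γ y (tyT (cImp A B))) :
    Typed Γ (cImpE A B x y) (.flock Pred.fitch (pair A B x y) (pairTy A B) (tyT B)) := by
  have h₁ := typed_const hΓ (c := .impE) (by simp [sigFPST]; rfl)
  have h₂ := typed_app_pi h₁ hA (by simp only [subst]; rfl)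
  have h₃ := typed_app_pi h₂ hB (by simp only [subst]; rfl)
  simp only [subst_tyT, subst_cImp, subst, single, upSub, subst_single_shift, subst_upSub_shift,
    subst_pair, subst_pairTy] at h₃
  have h₄ := typed_app_pi h₃ hx (by simp only [subst]; rfl)
  simp only [subst_tyT, subst_cImp, subst, single, upSub, subst_single_shift, subst_upSub_shift,
    subst_pair, subst_pairTy] at h₄
  refine typed_app_pi h₄ hy ?_
  simp only [subst_tyT, subst, single, subst_single_shift, subst_pair, subst_pairTy]

theorem typed_cAllI (hΓ : Derives oracle sigFPST (.ctx Γ)) (hP : Typed Γ P (arrow tyI tyO))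
    (hF : Typed Γ F (.pi tyI (tyT (.app (shift P) (.var 0))))) :
    Typed Γ (cAllI P F) (tyT (cAll P)) := by
  have h₁ := typed_const hΓ (c := .allI) (by simp [sigFPST]; rfl)
  have h₂ := typed_app_pi h₁ hP rfl
  simp only [subst_arrow, subst_tyT, subst_tyI, subst_cAll, subst, single, upSub] at h₂
  exact typed_app_arrow h₂ hF

theorem typed_cAllE (hΓ : Derives oracle sigFPST (.ctx Γ)) (hP : Typed Γ P (arrow tyI tyO))
    (ht : Typed Γ t tyI) (hx : Typed Γ x (tyT (cAll P))) :
    Typed Γ (cAllE P t x) (tyT (.app P t)) := by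
  have h₁ := typed_const hΓ (c := .allE) (by simp [sigFPST]; rfl)
  have h₂ := typed_app_pi h₁ hP (by simp only [subst]; rfl)
  have h₃ := typed_app_pi h₂ ht rfl
  simp only [subst_arrow, subst_tyT, subst_cAll, subst, single, upSub, subst_single_shift] at h₃
  exact typed_app_arrow h₃ hx

theorem typed_cMemI (hΓ : Derives oracle sigFPST (.ctx Γ)) (hP : Typed Γ P (arrow tyI tyO))
    (ht : Typed Γ t tyI) (hx : Typed Γ x (tyT (.app P t))) :
    Typed Γ (cMemI P t x) (tyT (cMem t (cLam P))) := by
  have h₁ := typed_const hΓ (c := .memI) (by simp [sigFPST]; rfl)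
  have h₂ := typed_app_pi h₁ hP (by simp only [subst]; rfl)
  have h₃ := typed_app_pi h₂ ht rfl
  simp only [subst_arrow, subst_tyT, subst_cMem, subst_cLam, subst, single, upSub,
    subst_single_shift] at h₃
  exact typed_app_arrow h₃ hx

theorem typed_cMemE (hΓ : Derives oracle sigFPST (.ctx Γ)) (hP : Typed Γ P (arrow tyI tyO))
    (ht : Typed Γ t tyI) (hx : Typed Γ x (tyT (cMem t (cLam P)))) :
    Typed Γ (cMemE P t x) (tyT (.app P t)) := by
  have h₁ := typed_const hΓ (c := .memE) (by simp [sigFPST]; rfl)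
  have h₂ := typed_app_pi h₁ hP (by simp only [subst]; rfl)
  have h₃ := typed_app_pi h₂ ht rfl
  simp only [subst_arrow, subst_tyT, subst_cMem, subst_cLam, subst, single, upSub,
    subst_single_shift] at h₃
  exact typed_app_arrow h₃ hx

/-- The signature speaks of `P t` where the encoding has the substituted formula; the two differ by
one β-step. This lemma and `typed_T_expand` cross that gap in the rules for quantifiers and
abstracts. -/
theorem typed_T_step {M : Obj voc} (hΓ : Derives oracle sigFPST (.ctx Γ))
    (hM : Typed Γ M (tyT A)) (hB : Typed Γ B tyO) (h : Step A B) : Typed Γ M (tyT B) :=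
  .objConv hM (hasSyntax_sigFPST.fam_T hΓ hB) (.rel _ _ (.fappArg h))

theorem typed_T_expand {M : Obj voc} (hΓ : Derives oracle sigFPST (.ctx Γ))
    (hM : Typed Γ M (tyT A)) (hB : Typed Γ B tyO) (h : Step B A) : Typed Γ M (tyT B) :=
  .objConv hM (hasSyntax_sigFPST.fam_T hΓ hB) (.symm _ _ (.rel _ _ (.fappArg h)))

end

/-! ## Encodings of formulas -/

theorem enc_rename {c : SynCat} {n m : ℕ} (e : Syn c n) (f : Fin n → Fin m) (g : ℕ → ℕ)
    (h : ∀ i : Fin n, g i = f i) : enc (Syn.rename f e) = Expr.rename g (enc e) := by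
  induction e generalizing m g with
  | var i => simp [Syn.rename, enc, Expr.rename, h]
  | abs A ih =>
    simp only [Syn.rename, enc, cLam, cst, Expr.rename]
    rw [ih (Syn.upRen f) (LLFP.upRen g)]
    · rfl
    · intro i
      cases i using Fin.cases with
      | zero => rfl
      | succ i => simp [Syn.upRen, LLFP.upRen, h]
  | all A ih =>
    simp only [Syn.rename, enc, cAll, cst, Expr.rename]
    rw [ih (Syn.upRen f) (LLFP.upRen g)]
    · rfl
    · intro i
      cases i using Fin.cases with
      | zero => rfl
      | succ i => simp [Syn.upRen, LLFP.upRen, h]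
  | mem t u iht ihu =>
    simp only [Syn.rename, enc, cMem, cst, Expr.rename, iht f g h, ihu f g h]
  | imp A B ihA ihB =>
    simp only [Syn.rename, enc, cImp, cst, Expr.rename, ihA f g h, ihB f g h]

theorem enc_shift {c : SynCat} {n : ℕ} (e : Syn c n) : enc (Syn.shift e) = Expr.shift (enc e) :=
  enc_rename e _ _ fun _ => rfl

theorem enc_subst {c : SynCat} {n m : ℕ} (e : Syn c n) (θ : Fin n → SetTerm m) (η : ℕ → Obj voc)
    (h : ∀ i : Fin n, η i = enc (θ i)) : enc (Syn.subst θ e) = Expr.subst η (enc e) := by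
  induction e generalizing m η with
  | var i => exact (h i).symm
  | abs A ih =>
    simp only [Syn.subst, enc, cLam, cst, Expr.subst]
    rw [ih (Syn.upSub θ) (Expr.upSub η)]
    · rfl
    · intro i
      cases i using Fin.cases with
      | zero => rfl
      | succ i => simp [Syn.upSub, Expr.upSub, h, enc_shift]
  | all A ih =>
    simp only [Syn.subst, enc, cAll, cst, Expr.subst]
    rw [ih (Syn.upSub θ) (Expr.upSub η)]
    · rfl
    · intro i
      cases i using Fin.cases with
      | zero => rfl
      | succ i => simp [Syn.upSub, Expr.upSub, h, enc_shift]
  | mem t u iht ihu =>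
    simp only [Syn.subst, enc, cMem, cst, Expr.subst, iht θ η h, ihu θ η h]
  | imp A B ihA ihB =>
    simp only [Syn.subst, enc, cImp, cst, Expr.subst, ihA θ η h, ihB θ η h]

theorem enc_inst {c : SynCat} {n : ℕ} (e : Syn c (n + 1)) (t : SetTerm n) :
    enc (Syn.inst e t) = Expr.inst (enc e) (enc t) :=
  enc_subst e _ _ fun i => by cases i using Fin.cases <;> rfl

/-- The type of the encodings of a syntactic category. -/
def SynCat.ty : SynCat → Fam voc
  | .set => tyI
  | .form => tyO

/-- The variables `f 0, …, f (n - 1)` are individual variables of the context. -/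
def IndVars (n : ℕ) (f : ℕ → ℕ) (Ψ : Ctx voc) : Prop := ∀ i : Fin n, Ψ[f i]? = some tyI

theorem IndVars.up {n : ℕ} {f : ℕ → ℕ} {Ψ : Ctx voc} (h : IndVars n f Ψ) :
    IndVars (n + 1) (LLFP.upRen f) (tyI :: Ψ) := by
  intro i
  cases i using Fin.cases with
  | zero => rfl
  | succ i => exact h i

theorem IndVars.succ {n : ℕ} {f : ℕ → ℕ} {Ψ : Ctx voc} (h : IndVars n f Ψ) (σ : Fam voc) :
    IndVars n (Nat.succ ∘ f) (σ :: Ψ) := h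

theorem typed_enc {c : SynCat} {n : ℕ} (e : Syn c n) {f : ℕ → ℕ} {Ψ : Ctx voc}
    (hΨ : Derives oracle sigFPST (.ctx Ψ)) (hf : IndVars n f Ψ) :
    Typed Ψ (Expr.rename f (enc e)) c.ty := by
  induction e generalizing f Ψ with
  | var i => exact typed_var hΨ (hf i) rfl
  | abs A ih =>
    exact hasSyntax_sigFPST.typed_cLam hΨ
      (.objAbs (ih (.ctxType (hasSyntax_sigFPST.fam_I hΨ)) hf.up))
  | mem t u iht ihu => exact hasSyntax_sigFPST.typed_cMem hΨ (iht hΨ hf) (ihu hΨ hf)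
  | imp A B ihA ihB => exact hasSyntax_sigFPST.typed_cImp hΨ (ihA hΨ hf) (ihB hΨ hf)
  | all A ih =>
    exact hasSyntax_sigFPST.typed_cAll hΨ
      (.objAbs (ih (.ctxType (hasSyntax_sigFPST.fam_I hΨ)) hf.up))

/-! ### Unguarded occurrences of variables. -/

theorem OccursUnguarded.of_rename {s : Cat} {e : Expr voc s} {f : ℕ → ℕ} {i : ℕ}
    (h : OccursUnguarded (Expr.rename f e) i) : ∃ j, i = f j ∧ OccursUnguarded e j := by
  have up : ∀ {s : Cat} (e : Expr voc s) (f : ℕ → ℕ) (i : ℕ),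
      (∃ j, i + 1 = LLFP.upRen f j ∧ OccursUnguarded e j) →
      ∃ j, i = f j ∧ OccursUnguarded e (j + 1) := by
    rintro s e f i ⟨_ | j, hj, h⟩
    · simp [LLFP.upRen] at hj
    · exact ⟨j, by simpa [LLFP.upRen] using hj, h⟩
  induction e generalizing f i with
  | type | fconst | const => exact h.elim
  | var j => exact ⟨j, h.symm, rfl⟩
  | kpi _ _ ih₁ ih₂ | pi _ _ ih₁ ih₂ | lam _ _ ih₁ ih₂ =>
    rcases h with h | h
    · obtain ⟨j, rfl, h'⟩ := ih₁ h
      exact ⟨j, rfl, .inl h'⟩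
    · obtain ⟨j, rfl, h'⟩ := up _ _ _ (ih₂ h)
      exact ⟨j, rfl, .inr h'⟩
  | fapp _ _ ih₁ ih₂ =>
    rcases h with h | h
    · obtain ⟨j, rfl, h'⟩ := ih₁ h
      exact ⟨j, rfl, .inl h'⟩
    · obtain ⟨j, rfl, h'⟩ := ih₂ h
      exact ⟨j, rfl, .inr h'⟩
  | app _ _ ih₁ ih₂ =>
    rcases h with h | ⟨hδ, h⟩
    · obtain ⟨j, rfl, h'⟩ := ih₁ h
      exact ⟨j, rfl, .inl h'⟩
    · obtain ⟨j, rfl, h'⟩ := ih₂ h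
      refine ⟨j, rfl, .inr ⟨?_, h'⟩⟩
      rintro ⟨A, rfl⟩
      exact hδ ⟨_, rfl⟩
  | flock _ _ _ _ ih₁ ih₂ ih₃ | lock _ _ _ _ ih₁ ih₂ ih₃ | unlock _ _ _ _ ih₁ ih₂ ih₃ =>
    rcases h with h | h | h
    · obtain ⟨j, rfl, h'⟩ := ih₁ h
      exact ⟨j, rfl, .inl h'⟩
    · obtain ⟨j, rfl, h'⟩ := ih₂ h
      exact ⟨j, rfl, .inr (.inl h')⟩
    · obtain ⟨j, rfl, h'⟩ := ih₃ h
      exact ⟨j, rfl, .inr (.inr h')⟩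

theorem OccursUnguarded.of_shift {s : Cat} {e : Expr voc s} {i : ℕ}
    (h : OccursUnguarded (Expr.shift e) (i + 1)) : OccursUnguarded e i := by
  obtain ⟨j, hj, h⟩ := h.of_rename
  cases hj
  exact h

/-- All unguarded occurrences are occurrences of individual variables. -/
def IndOnly {s : Cat} (Ψ : Ctx voc) (e : Expr voc s) : Prop :=
  ∀ i, OccursUnguarded e i → Ψ[i]? = some tyI

theorem indOnly_enc {c : SynCat} {n : ℕ} (e : Syn c n) {f : ℕ → ℕ} {Ψ : Ctx voc}
    (hf : IndVars n f Ψ) : IndOnly Ψ (Expr.rename f (enc e)) := by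
  induction e generalizing f Ψ with
  | var j =>
    intro i h
    cases h
    exact hf j
  | abs A ih | all A ih =>
    rintro i (h | ⟨-, h | h⟩)
    · exact h.elim
    · exact h.elim
    · exact ih hf.up (i + 1) h
  | mem _ _ ih₁ ih₂ | imp _ _ ih₁ ih₂ =>
    rintro i ((h | ⟨-, h⟩) | ⟨-, h⟩)
    · exact h.elim
    · exact ih₁ hf i h
    · exact ih₂ hf i h

namespace IndOnly

variable {Ψ : Ctx voc}

theorem cst (c : ObjConst) : IndOnly Ψ (cst c) := fun _ h => h.elim

theorem app {M N : Obj voc} (hM : IndOnly Ψ M) (hN : IndOnly Ψ N) : IndOnly Ψ (.app M N) := by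
  rintro i (h | ⟨-, h⟩)
  · exact hM i h
  · exact hN i h

theorem lam {σ : Fam voc} {M : Obj voc} (hσ : IndOnly Ψ σ) {σ' : Fam voc}
    (hM : IndOnly (σ' :: Ψ) M) : IndOnly Ψ (.lam σ M) := by
  rintro i (h | h)
  · exact hσ i h
  · exact hM (i + 1) h

/-- The place where assumption variables enter an encoding: as the second argument of `δ` they do
not count, so nothing is asked of `x`. -/
theorem cDelta {A x : Obj voc} (hA : IndOnly Ψ A) : IndOnly Ψ (cDelta A x) := by
  rintro i (h | ⟨h, -⟩)
  · exact (cst .δ).app hA i h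
  · exact (h ⟨A, rfl⟩).elim

theorem arrow {σ τ : Fam voc} (hσ : IndOnly Ψ σ) (hτ : IndOnly Ψ τ) :
    IndOnly Ψ (Expr.arrow σ τ) := by
  rintro i (h | h)
  · exact hσ i h
  · exact hτ i h.of_shift

theorem tyT {A : Obj voc} (hA : IndOnly Ψ A) : IndOnly Ψ (tyT A) := by
  rintro i (h | h)
  · exact h.elim
  · exact hA i h

theorem tyV {A : Obj voc} (hA : IndOnly Ψ A) : IndOnly Ψ (tyV A) := by
  rintro i (h | h)
  · exact h.elim
  · exact hA i h

theorem cImp {A B : Obj voc} (hA : IndOnly Ψ A) (hB : IndOnly Ψ B) : IndOnly Ψ (cImp A B) :=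
  ((cst .imp).app hA).app hB

theorem pairArgTy {A B : Obj voc} (hA : IndOnly Ψ A) (hB : IndOnly Ψ B) :
    IndOnly Ψ (pairArgTy A B) :=
  hA.tyT.arrow ((hA.cImp hB).tyT.arrow hB.tyT)

theorem pair {A B x y : Obj voc} (hA : IndOnly Ψ A) (hB : IndOnly Ψ B) (hx : IndOnly Ψ x)
    (hy : IndOnly Ψ y) : IndOnly Ψ (pair A B x y) := by
  rintro i (h | (h | ⟨-, h⟩) | ⟨-, h⟩)
  · exact hA.pairArgTy hB i h
  · cases h
  · exact hx i h.of_shift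
  · exact hy i h.of_shift

theorem unlock {N M : Obj voc} {σ : Fam voc} (hN : IndOnly Ψ N) (hσ : IndOnly Ψ σ)
    (hM : IndOnly Ψ M) : IndOnly Ψ (.unlock Pred.fitch N σ M) := by
  rintro i (h | h | h)
  · exact hN i h
  · exact hσ i h
  · exact hM i h

/-- `ι` is neither `T(A)` nor `V(A)`. `IndOnly` is the strengthening of `Guarded` that is proved
compositionally. -/
theorem guarded {M : Obj voc} (h : IndOnly Ψ M) : Guarded Ψ M := by
  intro i A hi ho
  rw [h i ho] at hi
  rcases hi with hi | hi <;> cases hi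

end IndOnly

/-! ## Encodings of deductions -/

theorem up_comp_up (e g : ℕ → ℕ) : LLFP.upRen e ∘ LLFP.upRen g = LLFP.upRen (e ∘ g) :=
  upRen_comp g e

/-- The label `j` of an assumption of `Γ` is the variable `g j` of the context. -/
def HypVars {n : ℕ} (Γ : List (Formula n)) (f g : ℕ → ℕ) (Ψ : Ctx voc) : Prop :=
  ∀ j B, Γ[j]? = some B → ∃ σ, Ψ[g j]? = some σ ∧
    Expr.rename (· + (g j + 1)) σ = tyV (Expr.rename f (enc B))

theorem HypVars.hyp {n : ℕ} {Γ : List (Formula n)} {f g : ℕ → ℕ} {Ψ : Ctx voc}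
    (h : HypVars Γ f g Ψ) (A : Formula n) :
    HypVars (A :: Γ) (Nat.succ ∘ f) (LLFP.upRen g) (tyV (Expr.rename f (enc A)) :: Ψ) := by
  intro j B hB
  cases j with
  | zero =>
    simp only [List.getElem?_cons_zero, Option.some.injEq] at hB
    subst hB
    refine ⟨_, rfl, ?_⟩
    simp only [tyV, Expr.rename, Expr.rename_rename]
    rfl
  | succ j =>
    obtain ⟨σ, hσ, he⟩ := h j B hB
    refine ⟨σ, hσ, ?_⟩
    have := congrArg (Expr.rename Nat.succ) he
    simp only [tyV, Expr.rename, Expr.rename_rename] at this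
    exact this

theorem HypVars.ind {n : ℕ} {Γ : List (Formula n)} {f g : ℕ → ℕ} {Ψ : Ctx voc}
    (h : HypVars Γ f g Ψ) :
    HypVars (Γ.map Syn.shift) (LLFP.upRen f) (Nat.succ ∘ g) (tyI :: Ψ) := by
  intro j B hB
  simp only [List.getElem?_map, Option.map_eq_some_iff] at hB
  obtain ⟨C, hC, rfl⟩ := hB
  obtain ⟨σ, hσ, he⟩ := h j C hC
  refine ⟨σ, hσ, ?_⟩
  have := congrArg (Expr.rename Nat.succ) he
  simp only [tyV, Expr.rename, Expr.rename_rename] at this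
  rw [enc_shift, Expr.shift, Expr.rename_rename]
  exact this

/-- Every normal deduction is encoded by an object in each suitable context. -/
theorem Deduces.exists_encoding {n : ℕ} {Γ : List (Formula n)} {p : Proof} {A : Formula n}
    (h : Deduces Γ p A) (hp : p.Normal) {f g : ℕ → ℕ} {Ψ : Ctx voc}
    (hΨ : Derives oracle sigFPST (.ctx Ψ)) (hf : IndVars n f Ψ) (hg : HypVars Γ f g Ψ) :
    ∃ M, Typed Ψ M (tyT (Expr.rename f (enc A))) ∧ IndOnly Ψ M ∧
      ∀ e, Reads e M (p.rename (e ∘ g)) := by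
  -- Below binders, individuals and assumptions interleave in the framework context, so their
  -- positions `f` and `g` are arbitrary. The labelling `e` is arbitrary too, because each binder
  -- extends it.
  induction h generalizing f g Ψ with
  | @hyp n Γ i A hi =>
    obtain ⟨σ, hσ, he⟩ := hg i A hi
    exact ⟨_, typed_cDelta hΨ (typed_enc A hΨ hf) (typed_var hΨ hσ he),
      (indOnly_enc A hf).cDelta, fun e => .hyp e _ _⟩
  | @impI n Γ p A B _ ih =>
    have hA := typed_enc A hΨ hf
    obtain ⟨M, hM, hi, hr⟩ := ih (fun q hq => hp _ (.impI hq))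
      (.ctxType (hasSyntax_sigFPST.fam_V hΨ hA)) (hf.succ _) (hg.hyp A)
    rw [← Expr.rename_rename] at hM
    refine ⟨_, typed_cImpI hΨ hA (typed_enc B hΨ hf) (.objAbs hM),
      (((IndOnly.cst .impI).app (indOnly_enc A hf)).app (indOnly_enc B hf)).app
        ((indOnly_enc A hf).tyV.lam hi), fun e => ?_⟩
    have := hr (LLFP.upRen e)
    rw [up_comp_up] at this
    exact .impI _ _ _ this
  | @impE n Γ p q A B _ _ ih₁ ih₂ =>
    obtain ⟨y, hy, hiy, hry⟩ := ih₁ (fun r hr => hp _ (.impEMajor hr)) hΨ hf hg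
    obtain ⟨x, hx, hix, hrx⟩ := ih₂ (fun r hr => hp _ (.impEMinor hr)) hΨ hf hg
    have hA := indOnly_enc A hf
    have hB := indOnly_enc B hf
    have hr : ∀ (S : Obj voc) (σ : Fam voc) (e : ℕ → ℕ), Reads e
        (.unlock Pred.fitch S σ
          (cImpE (Expr.rename f (enc A)) (Expr.rename f (enc B)) x y))
        ((Proof.impE p q).rename (e ∘ g)) := fun S σ e => .impE _ _ _ _ (hrx e) (hry e)
    have hi := (hA.pair hB hix hiy).unlock ((hA.pairArgTy hB).arrow hB.tyT)
      (((((IndOnly.cst .impE).app hA).app hB).app hix).app hiy)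
    -- The lock opens without any reduction: the unlock object itself already encodes the
    -- elimination, a relabelling of a normal proof and hence normal, and its unguarded variables
    -- are individuals.
    exact ⟨_, .objTopUnlock (typed_cImpE hΨ (typed_enc A hΨ hf) (typed_enc B hΨ hf) hx hy)
      ⟨_, _, _, _, _, rfl, .refl _, _, _, .refl, hr _ _ id, ⟨_, .refl, hp.rename _⟩, hi.guarded⟩,
      hi, hr _ _⟩
  | @allI n Γ p A _ ih =>
    have c := Derives.ctxType (hasSyntax_sigFPST.fam_I hΨ)
    obtain ⟨M, hM, hi, hr⟩ := ih (fun q hq => hp _ (.allI hq)) c hf.up hg.ind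
    have hA := typed_enc A c hf.up
    have hP : Typed Ψ (.lam tyI (Expr.rename (LLFP.upRen f) (enc A))) (Expr.arrow tyI tyO) :=
      .objAbs hA
    have hP' : Typed (tyI :: Ψ) (Expr.shift (.lam tyI (Expr.rename (LLFP.upRen f) (enc A))))
        (Expr.arrow tyI tyO) := by
      rw [Expr.shift, Expr.rename, Expr.rename_rename, upRen_comp]
      exact .objAbs (typed_enc A (.ctxType (hasSyntax_sigFPST.fam_I c))
        (IndVars.up (hf.succ tyI)))
    have s := Expr.Step.beta tyI
      (Expr.rename (LLFP.upRen Nat.succ) (Expr.rename (LLFP.upRen f) (enc A))) (.var 0)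
    rw [Expr.inst_rename_upRen_succ] at s
    -- The body proves the formula itself, whereas the constant asks for the β-redex `P x`.
    have hM' := typed_T_expand c hM (typed_app_arrow hP' (typed_var c (i := 0) rfl rfl)) s
    have hiA : IndOnly (tyI :: Ψ) (Expr.rename (LLFP.upRen f) (enc A)) := indOnly_enc A hf.up
    have hiI : IndOnly Ψ tyI := fun _ h => h.elim
    exact ⟨_, typed_cAllI hΨ hP (.objAbs hM'),
      ((IndOnly.cst .allI).app (hiI.lam hiA)).app (hiI.lam hi),
      fun e => .allI _ _ (hr (underInd e))⟩
  | @allE n Γ p A t _ ih =>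
    obtain ⟨M, hM, hi, hr⟩ := ih (fun q hq => hp _ (.allE hq)) hΨ hf hg
    have c := Derives.ctxType (hasSyntax_sigFPST.fam_I hΨ)
    have hP : Typed Ψ (.lam tyI (Expr.rename (LLFP.upRen f) (enc A))) (Expr.arrow tyI tyO) :=
      .objAbs (typed_enc A c hf.up)
    have hiA : IndOnly (tyI :: Ψ) (Expr.rename (LLFP.upRen f) (enc A)) := indOnly_enc A hf.up
    have hiI : IndOnly Ψ tyI := fun _ h => h.elim
    have s := Expr.Step.beta tyI (Expr.rename (LLFP.upRen f) (enc A)) (Expr.rename f (enc t))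
    rw [← Expr.rename_inst, ← enc_inst] at s
    exact ⟨_, typed_T_step hΨ (typed_cAllE hΨ hP (typed_enc t hΨ hf) hM)
        (typed_enc (Syn.inst A t) hΨ hf) s,
      (((IndOnly.cst .allE).app (hiI.lam hiA)).app (indOnly_enc t hf)).app hi,
      fun e => .allE _ _ (hr e)⟩
  | @memI n Γ p A t _ ih =>
    obtain ⟨M, hM, hi, hr⟩ := ih (fun q hq => hp _ (.memI hq)) hΨ hf hg
    have c := Derives.ctxType (hasSyntax_sigFPST.fam_I hΨ)
    have hP : Typed Ψ (.lam tyI (Expr.rename (LLFP.upRen f) (enc A))) (Expr.arrow tyI tyO) :=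
      .objAbs (typed_enc A c hf.up)
    have hiA : IndOnly (tyI :: Ψ) (Expr.rename (LLFP.upRen f) (enc A)) := indOnly_enc A hf.up
    have hiI : IndOnly Ψ tyI := fun _ h => h.elim
    have s := Expr.Step.beta tyI (Expr.rename (LLFP.upRen f) (enc A)) (Expr.rename f (enc t))
    rw [← Expr.rename_inst, ← enc_inst] at s
    have ht := typed_enc t hΨ hf
    exact ⟨_, typed_cMemI hΨ hP ht (typed_T_expand hΨ hM (typed_app_arrow hP ht) s),
      (((IndOnly.cst .memI).app (hiI.lam hiA)).app (indOnly_enc t hf)).app hi,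
      fun e => .memI _ _ (hr e)⟩
  | @memE n Γ p A t _ ih =>
    obtain ⟨M, hM, hi, hr⟩ := ih (fun q hq => hp _ (.memE hq)) hΨ hf hg
    have c := Derives.ctxType (hasSyntax_sigFPST.fam_I hΨ)
    have hP : Typed Ψ (.lam tyI (Expr.rename (LLFP.upRen f) (enc A))) (Expr.arrow tyI tyO) :=
      .objAbs (typed_enc A c hf.up)
    have hiA : IndOnly (tyI :: Ψ) (Expr.rename (LLFP.upRen f) (enc A)) := indOnly_enc A hf.up
    have hiI : IndOnly Ψ tyI := fun _ h => h.elim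
    have s := Expr.Step.beta tyI (Expr.rename (LLFP.upRen f) (enc A)) (Expr.rename f (enc t))
    rw [← Expr.rename_inst, ← enc_inst] at s
    exact ⟨_, typed_T_step hΨ (typed_cMemE hΨ hP (typed_enc t hΨ hf) hM)
        (typed_enc (Syn.inst A t) hΨ hf) s,
      (((IndOnly.cst .memE).app (hiI.lam hiA)).app (indOnly_enc t hf)).app hi,
      fun e => .memE _ _ (hr e)⟩

/-! ## Encoded contexts -/

theorem getElem?_encCtx_add {n : ℕ} (Γ : List (Formula n)) (i : ℕ) :
    (encCtx Γ)[i + Γ.length]? = (List.replicate n tyI)[i]? := by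
  induction Γ with
  | nil => rfl
  | cons A Γ ih => exact ih

theorem indVars_encCtx {n : ℕ} (Γ : List (Formula n)) : IndVars n (· + Γ.length) (encCtx Γ) := by
  intro i
  rw [getElem?_encCtx_add]
  simp

theorem hypVars_encCtx {n : ℕ} (Γ : List (Formula n)) :
    HypVars Γ (· + Γ.length) id (encCtx Γ) := by
  induction Γ with
  | nil => intro j B hB; simp at hB
  | cons A Γ ih =>
    have := ih.hyp A
    rw [upRen_id] at this
    exact this

theorem ctx_encCtx {n : ℕ} (Γ : List (Formula n)) : Derives oracle sigFPST (.ctx (encCtx Γ)) := by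
  induction Γ with
  | nil =>
    have : ∀ k, Derives oracle sigFPST (.ctx (List.replicate k tyI)) := by
      intro k
      induction k with
      | zero => exact .ctxEmpty sig_sigFPST
      | succ k ih => exact .ctxType (hasSyntax_sigFPST.fam_I ih)
    exact this n
  | cons A Γ ih =>
    exact .ctxType (hasSyntax_sigFPST.fam_V ih (typed_enc A ih (indVars_encCtx Γ)))

end FitchPrawitz

/-! ### The adequacy theorem. -/

theorem mainTheorem11 (n : ℕ) (Γ : List (FitchPrawitz.Formula n)) (A : FitchPrawitz.Formula n) :
    FitchPrawitz.Derivable Γ A ↔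
      ∃ M : LLFP.Obj FitchPrawitz.voc, FitchPrawitz.NormalizableObj M ∧
        FitchPrawitz.Typed (FitchPrawitz.encCtx Γ) M
          (FitchPrawitz.tyT (FitchPrawitz.encAt Γ.length A)) := by
  constructor
  · rintro ⟨p, hp, q, hpq, hq⟩
    -- The normal form `q` is encoded rather than `p`: a subdeduction of a normalizable deduction
    -- that disappears through a vacuous discharge need not be normalizable, and its eliminations
    -- could not be unlocked.
    obtain ⟨M, hM, -, hr⟩ := (hp.steps hpq).exists_encoding hq (FitchPrawitz.ctx_encCtx Γ)
      (FitchPrawitz.indVars_encCtx Γ) (FitchPrawitz.hypVars_encCtx Γ)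
    have hr := hr id
    rw [Function.comp_id, FitchPrawitz.Proof.rename_id] at hr
    exact ⟨M, ⟨M, q, .refl, hr, q, .refl, hq⟩, hM⟩
  · rintro ⟨M, ⟨R, p, hR, hp, hn⟩, hM⟩
    exact ⟨p, FitchPrawitz.deduces_of_typed hM hR hp, hn⟩
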